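/- Let $\mathbf C$ be a small category with a strictly initial object $\emptyset$ (an initial object such that every morphism $X\to\emptyset$ is an isomorphism). A representable interval object in $\mathbf C$ is a quadruple $(\mathrm I,m,i_0,i_1)$ consisting of a presheaf of sets $\mathrm I$ on $\mathbf C$ and morphisms of presheaves $m\colon \mathrm I\times \mathrm I\to \mathrm I$ and $i_0,i_1\colon *\to \mathrm I$ such that $X\times \mathrm I$ is representable for every $X\in\mathbf C$ and, with $p\colon \mathrm I\to *$ the canonical morphism, $m(i_0\times \mathrm{id})=m(\mathrm{id}\times i_0)=i_0p$ and $m(i_1\times \mathrm{id})=m(\mathrm{id}\times i_1)=\mathrm{id}$. Let $\mathrm I^\bullet$ be the cosimplicial presheaf with $\mathrm I^n=\mathrm I^{\times n}$ in which $\theta\colon[n]\to[m]$ induces the map $\mathrm I^n\to \mathrm I^m$ whose $k$-th coordinate ($1\le k\le m$) is the $\varphi(k)$-th coordinate of the source, where $\varphi(k)=\min(\{l\in\{0,\dots,n\}: \theta(l)\ge k\}\cup\{n+1\})$, the $0$-th coordinate is read as $i_1$ and the $(n+1)$-st as $i_0$. For a simplicial presheaf $\mathscr F$ on $\mathbf C$,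 put $\mathrm{Sing}^{\mathrm I}\mathscr F(X)=\operatorname{diag}\mathscr F(X\times \mathrm I^\bullet)$. A cd-structure $P$ on $\mathbf C$ is a collection of commutative squares in $\mathbf C$ closed under isomorphism. A simplicial presheaf $\mathscr F$ satisfies $P$-excision if $\mathscr F(\emptyset)$ is weakly contractible and $\mathscr F(Q)$ is homotopy Cartesian for every square $Q\in P$. A presheaf of sets $G$ is $\mathrm I$-invariant if, for every $X\in\mathbf C$, the projection $X\times \mathrm I\to X$ induces a bijection $G(X)\to G(X\times \mathrm I)$. Theorem. Let $\mathrm I$ be a representable interval object in $\mathbf C$ and let $P$ be a cd-structure on $\mathbf C$ such that $Q\in P$ implies $Q\times \mathrm I\in P$. If $\mathscr F$ is a simplicial presheaf on $\mathbf C$ that satisfies $P$-excision and for which the presheaf of sets $\pi_0(\mathscr F)\colon X\mapsto\pi_0(\mathscr F(X))$ is $\mathrm I$-invariant, then $\mathrm{Sing}^{\mathrm I}\mathscr F$ also satisfies $P$-excision. -/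

import Mathlib

open CategoryTheory Limits Opposite MonoidalCategory CartesianMonoidalCategory
open scoped Simplicial

universe u

noncomputable section

namespace SSet

/-- Weak equivalences of simplicial sets: `f : X ⟶ Y` is a weak equivalence when, for every Kan
complex `K`, precomposition with `f` is a bijection from the homotopy classes of maps `Y ⟶ K` to
the homotopy classes of maps `X ⟶ K`; the two clauses below are surjectivity and injectivity.
(As `K` is a Kan complex, `SSet.Homotopy` is an equivalence relation on maps to `K`.) -/
def IsWeakEquivalence {X Y : SSet.{u}} (f : X ⟶ Y) : Prop :=
  ∀ (K : SSet.{u}), KanComplex K →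
    (∀ g : X ⟶ K, ∃ h : Y ⟶ K, Nonempty (Homotopy (f ≫ h) g)) ∧
    (∀ h h' : Y ⟶ K, Nonempty (Homotopy (f ≫ h) (f ≫ h')) → Nonempty (Homotopy h h'))

/-- A simplicial set is weakly contractible when its map to the point is a weak equivalence. -/
def IsWeaklyContractible (X : SSet.{u}) : Prop :=
  IsWeakEquivalence (toUnit X)

open modelCategoryQuillen HomotopicalAlgebra in
/-- A commutative square of simplicial sets
```
X₁ --> X₂
|      |
v      v
X₃ --> X₄
```
is homotopy Cartesian when, for some factorization `X₂ ⟶ E ⟶ X₄` of its right-hand map as a weak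
equivalence followed by a Kan fibration, the map `X₁ ⟶ X₃ ×_{X₄} E` is a weak equivalence.
(Such factorizations exist and, simplicial sets being right proper, the choice is irrelevant.) -/
def IsHomotopyCartesian (sq : Square SSet.{u}) : Prop :=
  ∃ (E : SSet.{u}) (i : sq.X₂ ⟶ E) (p : E ⟶ sq.X₄) (fac : i ≫ p = sq.f₂₄),
    IsWeakEquivalence i ∧ Fibration p ∧
      IsWeakEquivalence (pullback.lift (f := sq.f₃₄) (g := p) sq.f₁₃ (sq.f₁₂ ≫ i)
        (by rw [Category.assoc, fac, sq.fac]))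

/-- The diagonal of a bisimplicial set `Z`: its `n`-simplices are the `n`-simplices of `Z_n`. -/
@[simps]
def diag : (SimplexCategoryᵒᵖ ⥤ SSet.{u}) ⥤ SSet.{u} where
  obj Z :=
    { obj n := (Z.obj n).obj n
      map θ := (Z.map θ).app _ ≫ (Z.obj _).map θ
      map_id n := by simp
      map_comp θ ψ := by simp }
  map f :=
    { app n := (f.app n).app n
      naturality n m θ := by
        have h := NatTrans.congr_app (f.naturality θ) m
        simp only [NatTrans.comp_app] at h
        simp }

end SSet

variable {C : Type u} [SmallCategory C]

variable (C) in
/-- A cd-structure on `C`: a collection of commutative squares closed under isomorphism. -/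
structure CDStructure where
  /-- the distinguished squares -/
  squares : ObjectProperty (Square C)
  isClosedUnderIsomorphisms : squares.IsClosedUnderIsomorphisms

/-- A simplicial presheaf `F` satisfies `P`-excision when `F(∅)` is weakly contractible and `F(Q)`
is homotopy Cartesian for every square `Q` in `P`. -/
def SatisfiesExcision [HasInitial C] (P : CDStructure C) (F : Cᵒᵖ ⥤ SSet.{u}) : Prop :=
  SSet.IsWeaklyContractible (F.obj (op (⊥_ C))) ∧
    ∀ Q : Square C, P.squares Q → SSet.IsHomotopyCartesian (Q.op.map F)

variable (C) in
/-- A representable interval object: a presheaf of sets `I` with a multiplication `m` and two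
endpoints `i₀`, `i₁` such that all `X × I` are representable, `i₀` is absorbing for `m` and `i₁`
is neutral for `m`.

Monomorphy of `i₀ ⨿ i₁ : * ⨿ * ⟶ I` is not imposed. (When `C` has a strict initial object `∅`,
representability of `∅ × I` makes `I(∅)` a singleton, so that this map of presheaves is never
injective at `∅`.) -/
structure RepresentableInterval where
  /-- the underlying presheaf of sets -/
  I : Cᵒᵖ ⥤ Type u
  /-- the multiplication -/
  m : I ⊗ I ⟶ I
  /-- the endpoint `0` -/
  i₀ : 𝟙_ (Cᵒᵖ ⥤ Type u) ⟶ I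
  /-- the endpoint `1` -/
  i₁ : 𝟙_ (Cᵒᵖ ⥤ Type u) ⟶ I
  isRepresentable (X : C) : (yoneda.obj X ⊗ I).IsRepresentable
  i₀_m : lift (toUnit I ≫ i₀) (𝟙 I) ≫ m = toUnit I ≫ i₀
  m_i₀ : lift (𝟙 I) (toUnit I ≫ i₀) ≫ m = toUnit I ≫ i₀
  i₁_m : lift (toUnit I ≫ i₁) (𝟙 I) ≫ m = 𝟙 I
  m_i₁ : lift (𝟙 I) (toUnit I ≫ i₁) ≫ m = 𝟙 I

namespace RepresentableInterval

variable (J : RepresentableInterval C)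

/-- A presheaf of sets `G` is `I`-invariant when, for every `X` in `C`, the projection
`X × I ⟶ X` induces a bijection `G(X) → G(X × I)`. Here `Y` runs over the objects of `C`
representing `X × I`, and `p : Y ⟶ X` is the morphism corresponding to the projection. -/
def IsInvariant (G : Cᵒᵖ ⥤ Type u) : Prop :=
  ∀ (X Y : C) (e : yoneda.obj Y ≅ yoneda.obj X ⊗ J.I) (p : Y ⟶ X),
    yoneda.map p = e.hom ≫ fst _ _ → Function.Bijective (G.map p.op)

/-- `P` is stable under product with `I`: if `Q` is in `P`, then so is `Q × I`, i.e. any square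
`Q'` in `C` that represents the product of `Q` with `I` in presheaves. -/
def StableUnderProduct (P : CDStructure C) : Prop :=
  ∀ Q Q' : Square C, P.squares Q →
    Nonempty (Q'.map yoneda ≅ (Q.map yoneda).map (tensorRight J.I)) → P.squares Q'

/-- A tuple `(s_1, …, s_n)` of sections of `I`, extended by the endpoint `1` in position `0` and
by the endpoint `0` in position `n + 1`. -/
def extend {Y : Cᵒᵖ} {n : ℕ} (s : Fin n → J.I.obj Y) : Fin (n + 2) → J.I.obj Y :=
  Fin.cons (J.i₁.app Y PUnit.unit) (Fin.snoc (α := fun _ ↦ J.I.obj Y) s (J.i₀.app Y PUnit.unit))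

/-- The presheaf `Iⁿ`. -/
@[simps]
def pow (n : ℕ) : Cᵒᵖ ⥤ Type u where
  obj Y := Fin n → J.I.obj Y
  map g := ↾fun s k ↦ J.I.map g (s k)

/-- For `θ : [n] → [m]`, the map `Iⁿ → Iᵐ` on sections: with
`φ k = min ({l ∈ {0, …, n} | k ≤ θ l} ∪ {n + 1})` (which is `SimplexCategory.II.map'`), the `k`-th
coordinate of the image (`1 ≤ k ≤ m`) is the coordinate of the source of index `φ k`, which is
read as the endpoint `1` if `φ k = 0` and as the endpoint `0` if `φ k = n + 1`. -/
def powMap {Y : Cᵒᵖ} {n m : ℕ} (θ : Fin (n + 1) →o Fin (m + 1)) (s : Fin n → J.I.obj Y) :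
    Fin m → J.I.obj Y :=
  fun k ↦ J.extend s (SimplexCategory.II.map' θ k.castSucc.succ)

lemma extend_powMap {Y : Cᵒᵖ} {n m : ℕ} (θ : Fin (n + 1) →o Fin (m + 1))
    (s : Fin n → J.I.obj Y) (k : Fin (m + 2)) :
    J.extend (J.powMap θ s) k = J.extend s (SimplexCategory.II.map' θ k) := by
  induction k using Fin.cases with
  | zero => simp [extend]
  | succ k =>
    induction k using Fin.lastCases with
    | last =>
      have h : (Fin.last m).succ = Fin.last (m + 1) := rfl
      have h' : Fin.last (n + 1) = (Fin.last n).succ := rfl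
      rw [h, SimplexCategory.II.map'_last, ← h, h']
      simp [extend]
    | cast k => simp [extend, powMap]

lemma map_extend {Y Z : Cᵒᵖ} (g : Y ⟶ Z) {n : ℕ} (s : Fin n → J.I.obj Y) (k : Fin (n + 2)) :
    J.I.map g (J.extend s k) = J.extend (fun j ↦ J.I.map g (s j)) k := by
  induction k using Fin.cases with
  | zero => simpa [extend] using! (NatTrans.naturality_apply J.i₁ g PUnit.unit).symm
  | succ k =>
    induction k using Fin.lastCases with
    | last => simpa [extend] using! (NatTrans.naturality_apply J.i₀ g PUnit.unit).symm
    | cast k => simp [extend]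

/-- The cosimplicial presheaf `I^•`, with `I^n` the `n`-fold product of `I` with itself. -/
@[simps]
def cosimplicial : SimplexCategory ⥤ Cᵒᵖ ⥤ Type u where
  obj n := J.pow n.len
  map θ :=
    { app Y := ↾J.powMap θ.toOrderHom
      naturality Y Z g := by
        ext s
        funext k
        exact (J.map_extend g s _).symm }
  map_id n := by
    ext Y s
    funext k
    change J.powMap (SimplexCategory.Hom.toOrderHom (𝟙 n)) s k = s k
    simp only [powMap, SimplexCategory.id_toOrderHom, SimplexCategory.II.map'_id, extend,
      Fin.cons_succ]
    exact Fin.snoc_castSucc (α := fun _ ↦ J.I.obj Y) _ _ _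
  map_comp θ ψ := by
    ext Y s
    funext k
    change J.powMap (ψ.toOrderHom.comp θ.toOrderHom) s k =
      J.powMap ψ.toOrderHom (J.powMap θ.toOrderHom s) k
    exact (congrArg (J.extend s) (SimplexCategory.II.map'_map' _ _ _).symm).trans
      (J.extend_powMap _ _ _).symm

end RepresentableInterval

/-- The value `F(G)` of a simplicial presheaf `F` on a presheaf of sets `G`: its `n`-simplices are
the morphisms `G ⟶ F_n`. For a representable `G` this is the usual value of `F`, by the Yoneda
lemma; see `presheafValueYonedaIso`. -/
abbrev presheafValue (F : Cᵒᵖ ⥤ SSet.{u}) : (Cᵒᵖ ⥤ Type u)ᵒᵖ ⥤ SSet.{u} :=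
  coyoneda ⋙ (Functor.whiskeringLeft _ _ _).obj F.flip

/-- If `Y` represents `G`, then `F(G)` is `F(Y)`. -/
def presheafValueYonedaIso (F : Cᵒᵖ ⥤ SSet.{u}) : yoneda.op ⋙ presheafValue F ≅ F :=
  NatIso.ofComponents (fun X ↦ NatIso.ofComponents (fun n ↦ yonedaEquiv.toIso)
    (fun f ↦ by ext; rfl))
    (fun g ↦ by
      ext n x
      exact (yonedaEquiv_naturality (F := F.flip.obj n) x g.unop).symm)

namespace RepresentableInterval

variable (J : RepresentableInterval C)

/-- The cosimplicial presheaf `n ↦ X × I^n`, functorially in `X`. -/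
abbrev prodPow : C ⥤ SimplexCategory ⥤ Cᵒᵖ ⥤ Type u :=
  yoneda ⋙ curriedTensor _ ⋙ (Functor.whiskeringLeft _ _ _).obj J.cosimplicial

/-- The presheaf of bisimplicial sets `X ↦ F(X × I^•)`, which sends `X` to the simplicial object
`n ↦ F(X × I^n)` in simplicial sets. -/
abbrev singBisimplicial (F : Cᵒᵖ ⥤ SSet.{u}) : Cᵒᵖ ⥤ SimplexCategoryᵒᵖ ⥤ SSet.{u} :=
  J.prodPow.op ⋙ Functor.opHom _ _ ⋙ (Functor.whiskeringRight _ _ _).obj (presheafValue F)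

/-- The singular construction `Sing^I F (X) = diag F(X × I^•)`. -/
def sing (F : Cᵒᵖ ⥤ SSet.{u}) : Cᵒᵖ ⥤ SSet.{u} :=
  J.singBisimplicial F ⋙ SSet.diag

end RepresentableInterval

end

namespace SSet

open HomotopicalAlgebra modelCategoryQuillen

/-! ### Cylinders and their ends -/

section cylinder

/-! The rows of the bisimplicial set `n ↦ F(X × Iⁿ)` are values of `F` at objects of `C`
representing `X × Iⁿ`. For `Q` in `P` every `Q × Iⁿ` is again in `P`, so the square of bisimplicial
sets attached to `Q` is homotopy Cartesian in each row; the question is whether its diagonal is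
homotopy Cartesian too. In general this fails. It holds under a condition on components in the
spirit of Bousfield and Friedlander, here `DegenerateComponents`: every component of every row
contains a degenerate vertex. Invariance of `π₀(F)` provides it, because the projections `X × Iⁿ⁺¹ →
X × Iⁿ` are then surjective on components. At `∅`, strictness gives `∅ × Iⁿ ≅ ∅`, so all rows are
weakly contractible and `isWeakEquivalence_diagonal` suffices.

The diagonal theorem `isHomotopyCartesian_diagonal` replaces the right-hand map by a Reedy fibration
`p` between Reedy fibrant objects. It needs that the diagonal takes rowwise weak equivalences to
weak equivalences (`isWeakEquivalence_diagonal`) and that the diagonal of `p` is a Kan fibration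
(`fibration_diagonal_of_rowConnected`). As rows and diagonals commute with pullbacks, the comparison
map of the diagonal square is then the diagonal of a rowwise weak equivalence. For both facts,
lifting against a union of faces of `Δ[n]` is transposed to lifting `p` against the union of the
products `face ⊠ face` in `Δ[n] ⊠ Δ[n]` (`hasLiftingProperty_diagonal`), and this is solved
rectangle by rectangle (`liftsAlong_iSup_rect`). For a horn the Reedy condition only reaches `Λ ⊠
Δ[n]`. The rest is horn filling across the rows, supplied by the condition on components: two
vertices of a row which agree on a nonempty union of faces, not the whole boundary, are joined by an
edge that is constant there (`RowConnected.joined`).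

With weak equivalences defined through homotopy classes of maps to Kan complexes, the basic input is
that a fibration which is a weak equivalence is a trivial fibration
(`TrivialFibration.of_isWeakEquivalence`). Between Kan complexes this is a direct homotopy argument.
A general base is embedded in a Kan complex by an anodyne extension, the fibration is extended over
it (`extendsFibrations_of_anodyne`), and stability of anodyne extensions under pullback along
fibrations (`anodyne_of_isPullback`) shows that the extended map is still a weak equivalence. -/

lemma congr_app_apply {X Y : SSet.{u}} {f g : X ⟶ Y} (h : f = g) (n : SimplexCategoryᵒᵖ)
    (x : X.obj n) : f.app n x = g.app n x := by rw [h]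

instance {X Y : SSet.{u}} (Z : SSet.{u}) (f : X ⟶ Y) [Mono f] : Mono (Z ◁ f) := by
  have (n : SimplexCategoryᵒᵖ) : Mono ((Z ◁ f).app n) := by
    rw [mono_iff_injective]
    rintro ⟨z, x⟩ ⟨z', x'⟩ h
    have := (mono_iff_injective (f.app n)).1 inferInstance
    exact Prod.ext (congrArg (fun t : Z.obj n × Y.obj n ↦ t.1) h)
      (this (congrArg (fun t : Z.obj n × Y.obj n ↦ t.2) h))
  exact NatTrans.mono_of_mono_app _

instance {X Y : SSet.{u}} (Z : SSet.{u}) (f : X ⟶ Y) [Mono f] : Mono (f ▷ Z) := by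
  have (n : SimplexCategoryᵒᵖ) : Mono ((f ▷ Z).app n) := by
    rw [mono_iff_injective]
    rintro ⟨x, z⟩ ⟨x', z'⟩ h
    have := (mono_iff_injective (f.app n)).1 inferInstance
    exact Prod.ext (this (congrArg (fun t : Y.obj n × Z.obj n ↦ t.1) h))
      (congrArg (fun t : Y.obj n × Z.obj n ↦ t.2) h)
  exact NatTrans.mono_of_mono_app _

/-- The inclusion of an end of the cylinder. -/
def endι (e : Fin 2) (X : SSet.{u}) : X ⟶ X ⊗ Δ[1] :=
  lift (𝟙 X) (const (stdSimplex.obj₀Equiv.symm e))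

/-- The constant simplex of `Δ[1]` at a vertex. -/
def cst (e : Fin 2) (n : SimplexCategoryᵒᵖ) : (Δ[1] : SSet.{u}).obj n :=
  stdSimplex.objMk (OrderHom.const _ e)

@[simp]
lemma endι_fst (e : Fin 2) (X : SSet.{u}) : endι e X ≫ fst _ _ = 𝟙 _ := by simp [endι]

@[simp]
lemma endι_fst_assoc (e : Fin 2) (X : SSet.{u}) {Y : SSet.{u}} (g : X ⟶ Y) :
    endι e X ≫ fst _ _ ≫ g = g := by rw [← Category.assoc, endι_fst, Category.id_comp]

@[simp]
lemma endι_naturality_assoc (e : Fin 2) {X Y Z : SSet.{u}} (f : X ⟶ Y) (g : Y ⊗ Δ[1] ⟶ Z) :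
    endι e X ≫ f ▷ Δ[1] ≫ g = f ≫ endι e Y ≫ g := rfl

lemma ext_cst {n : SimplexCategoryᵒᵖ} {e : Fin 2} {x : (Δ[1] : SSet.{u}).obj n}
    (h : ∀ j, stdSimplex.asOrderHom x j = e) : x = cst e n := by
  apply stdSimplex.ext
  intro j
  exact h j

lemma mem_horn_one {e : Fin 2} {n : SimplexCategoryᵒᵖ} {x : (Δ[1] : SSet.{u}).obj n}
    (hx : x ∈ Λ[1, e].obj n) : x = cst e n := by
  apply ext_cst
  intro j
  by_contra h
  apply hx
  ext k
  simp only [Set.union_singleton, Set.mem_insert_iff, Set.mem_range, Set.mem_univ, iff_true]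
  by_cases hk : k = e
  · exact Or.inl hk
  · refine Or.inr ⟨j, ?_⟩
    generalize stdSimplex.asOrderHom x j = y at h ⊢
    lia

lemma cst_ne (n : SimplexCategoryᵒᵖ) : (cst 1 n : (Δ[1] : SSet.{u}).obj n) ≠ cst 0 n := by
  intro h
  have := congrArg (fun x ↦ stdSimplex.asOrderHom x 0) h
  exact absurd this (by change (1 : Fin 2) ≠ 0; decide)

lemma mem_boundary_one {n : SimplexCategoryᵒᵖ} {x : (Δ[1] : SSet.{u}).obj n}
    (hx : x ∈ ∂Δ[1].obj n) : x = cst 0 n ∨ x = cst 1 n := by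
  by_contra! h
  apply hx
  have h0 : ∃ j, stdSimplex.asOrderHom x j ≠ 0 := by
    by_contra! h'
    exact h.1 (ext_cst h')
  have h1 : ∃ j, stdSimplex.asOrderHom x j ≠ 1 := by
    by_contra! h'
    exact h.2 (ext_cst h')
  obtain ⟨a, ha⟩ := h0
  obtain ⟨b, hb⟩ := h1
  intro k
  by_cases hk : k = 0
  · refine ⟨b, ?_⟩
    generalize stdSimplex.asOrderHom x b = y at hb ⊢
    lia
  · refine ⟨a, ?_⟩
    generalize stdSimplex.asOrderHom x a = y at ha ⊢
    lia

lemma cst_mem_boundary (e : Fin 2) (n : SimplexCategoryᵒᵖ) :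
    (cst e n : (Δ[1] : SSet.{u}).obj n) ∈ ∂Δ[1].obj n := by
  intro h
  obtain ⟨j, hj⟩ := h (1 - e)
  replace hj : e = 1 - e := hj
  lia

/-- The inclusion of an end in the boundary of the cylinder. -/
def endB (e : Fin 2) (X : SSet.{u}) : X ⟶ X ⊗ (∂Δ[1] : SSet.{u}) where
  app n := ↾fun x ↦ (x, ⟨cst e n, cst_mem_boundary e n⟩)
  naturality _ _ _ := rfl

@[simp]
lemma endB_ι (e : Fin 2) (X : SSet.{u}) : endB e X ≫ X ◁ ∂Δ[1].ι = endι e X := rfl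

@[simp]
lemma endB_ι_assoc (e : Fin 2) (X : SSet.{u}) {Y : SSet.{u}} (g : X ⊗ Δ[1] ⟶ Y) :
    endB e X ≫ X ◁ ∂Δ[1].ι ≫ g = endι e X ≫ g := rfl

lemma endB_naturality_assoc (e : Fin 2) {X Y Z : SSet.{u}} (f : X ⟶ Y)
    (g : Y ⊗ (∂Δ[1] : SSet.{u}) ⟶ Z) :
    endB e X ≫ f ▷ _ ≫ g = f ≫ endB e Y ≫ g := rfl

lemma endB_hom_ext {X Y : SSet.{u}} {f g : X ⊗ (∂Δ[1] : SSet.{u}) ⟶ Y}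
    (h : ∀ e, endB e X ≫ f = endB e X ≫ g) : f = g := by
  ext n ⟨x, ⟨t, ht⟩⟩
  obtain rfl | rfl := mem_boundary_one ht
  · exact congr_app_apply (h 0) n x
  · exact congr_app_apply (h 1) n x

open Classical in
/-- The map from the boundary of the cylinder given by two maps. -/
def ends {X Y : SSet.{u}} (f g : X ⟶ Y) : X ⊗ (∂Δ[1] : SSet.{u}) ⟶ Y where
  app n := ↾fun x ↦ if x.2.1 = cst 0 n then f.app n x.1 else g.app n x.1
  naturality n m θ := by
    ext ⟨x, ⟨t, ht⟩⟩
    obtain rfl | rfl := mem_boundary_one ht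
    · exact (if_pos rfl).trans ((NatTrans.naturality_apply f θ x).trans
        (congrArg (Y.map θ) (if_pos rfl).symm))
    · exact (if_neg (cst_ne _)).trans ((NatTrans.naturality_apply g θ x).trans
        (congrArg (Y.map θ) (if_neg (cst_ne _)).symm))

@[simp]
lemma endB_zero_ends {X Y : SSet.{u}} (f g : X ⟶ Y) : endB 0 X ≫ ends f g = f := by
  ext n x
  exact if_pos rfl

@[simp]
lemma endB_zero_ends_assoc {X Y Z : SSet.{u}} (f g : X ⟶ Y) (h : Y ⟶ Z) :
    endB 0 X ≫ ends f g ≫ h = f ≫ h := by rw [← Category.assoc, endB_zero_ends]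

@[simp]
lemma endB_one_ends {X Y : SSet.{u}} (f g : X ⟶ Y) : endB 1 X ≫ ends f g = g := by
  ext n x
  exact if_neg (cst_ne _)

@[simp]
lemma endB_one_ends_assoc {X Y Z : SSet.{u}} (f g : X ⟶ Y) (h : Y ⟶ Z) :
    endB 1 X ≫ ends f g ≫ h = g ≫ h := by rw [← Category.assoc, endB_one_ends]

end cylinder

/-! ### Homotopy lifting and extension -/

section lifting

/-- The pushout-product of a monomorphism and an anodyne extension, in either order, is anodyne; the
lift is read off on the two legs of the pushout. -/
lemma exists_lift_prod {A B S T E Z : SSet.{u}} (i : A ⟶ B) (j : S ⟶ T) (p : E ⟶ Z)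
    [Fibration p] (hij : (Mono i ∧ anodyneExtensions j) ∨ (anodyneExtensions i ∧ Mono j))
    (f : B ⊗ S ⟶ E) (h : A ⊗ T ⟶ E) (K : B ⊗ T ⟶ Z)
    (h₁ : i ▷ S ≫ f = A ◁ j ≫ h) (h₂ : f ≫ p = B ◁ j ≫ K) (h₃ : h ≫ p = i ▷ T ≫ K) :
    ∃ H : B ⊗ T ⟶ E, B ◁ j ≫ H = f ∧ i ▷ T ≫ H = h ∧ H ≫ p = K := by
  let sq := Functor.PushoutObjObj.ofHasPushout (curriedTensor SSet.{u}) i j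
  have hsq : anodyneExtensions sq.ι := by
    obtain ⟨hi, hj⟩ | ⟨hi, hj⟩ := hij
    · exact anodyneExtensions_pushoutObjObjι sq hj
    · exact anodyneExtensions_pushoutObjObjι' sq hi
  have := hsq p (by rwa [← HomotopicalAlgebra.fibration_iff])
  have comm : CommSq (sq.isPushout.desc f h h₁) sq.ι p K := ⟨by
    apply sq.hom_ext
    · simpa using! h₂
    · simpa using! h₃⟩
  refine ⟨comm.lift, ?_, ?_, comm.fac_right⟩
  · have := sq.inl ≫= comm.fac_left
    rw [sq.inl_ι_assoc, sq.isPushout.inl_desc] at this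
    exact this
  · have := sq.inr ≫= comm.fac_left
    rw [sq.inr_ι_assoc, sq.isPushout.inr_desc] at this
    exact this

/-- The homotopy extension lifting property. -/
lemma exists_homotopy_extension {A B E Z : SSet.{u}} (i : A ⟶ B) [Mono i] (p : E ⟶ Z)
    [Fibration p] (e : Fin 2) (f : B ⟶ E) (h : A ⊗ Δ[1] ⟶ E) (K : B ⊗ Δ[1] ⟶ Z)
    (h₁ : endι e A ≫ h = i ≫ f) (h₂ : f ≫ p = endι e B ≫ K) (h₃ : h ≫ p = i ▷ _ ≫ K) :
    ∃ H : B ⊗ Δ[1] ⟶ E, endι e B ≫ H = f ∧ i ▷ _ ≫ H = h ∧ H ≫ p = K := by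
  -- The horn `Λ[1, e]` is the single vertex `e`, so its inclusion plays the role of the end of the
  -- cylinder.
  obtain ⟨H, h₄, h₅, h₆⟩ := exists_lift_prod i Λ[1, e].ι p
    (.inl ⟨inferInstance, anodyneExtensions.horn_ι e⟩) (fst _ _ ≫ f) h K (by
      ext n ⟨a, ⟨t, ht⟩⟩
      obtain rfl := mem_horn_one ht
      exact (congr_app_apply h₁ n a).symm) (by
      ext n ⟨a, ⟨t, ht⟩⟩
      obtain rfl := mem_horn_one ht
      exact congr_app_apply h₂ n a) h₃
  refine ⟨H, ?_, h₅, h₆⟩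
  ext n b
  have hc : (cst e n : (Δ[1] : SSet.{u}).obj n) ∈ Λ[1, e].obj n := by
    intro h
    have : 1 - e ∈ (Set.univ : Set (Fin 2)) := trivial
    erw [← h] at this
    obtain ⟨j, hj⟩ | hj := this
    · replace hj : e = 1 - e := hj
      lia
    · replace hj : 1 - e = e := hj
      lia
  exact congr_app_apply h₄ n (b, ⟨cst e n, hc⟩)

/-- Here the pushout-product is with `∂Δ[1] ⊆ Δ[1]`. This is the uniqueness up to homotopy of
extensions along an anodyne map. -/
lemma exists_homotopy_of_anodyne {A B E Z : SSet.{u}} {i : A ⟶ B} (hi : anodyneExtensions i)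
    (p : E ⟶ Z) [Fibration p] (f₀ f₁ : B ⟶ E) (h : A ⊗ Δ[1] ⟶ E) (K : B ⊗ Δ[1] ⟶ Z)
    (h₀ : endι 0 A ≫ h = i ≫ f₀) (h₁ : endι 1 A ≫ h = i ≫ f₁)
    (k₀ : f₀ ≫ p = endι 0 B ≫ K) (k₁ : f₁ ≫ p = endι 1 B ≫ K) (h₃ : h ≫ p = i ▷ _ ≫ K) :
    ∃ H : B ⊗ Δ[1] ⟶ E, endι 0 B ≫ H = f₀ ∧ endι 1 B ≫ H = f₁ ∧ i ▷ _ ≫ H = h ∧ H ≫ p = K := by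
  obtain ⟨H, h₄, h₅, h₆⟩ := exists_lift_prod i ∂Δ[1].ι p (.inr ⟨hi, inferInstance⟩)
    (ends f₀ f₁) h K (by
      apply endB_hom_ext
      intro e
      rw [endB_naturality_assoc, endB_ι_assoc]
      fin_cases e
      · simpa using! h₀.symm
      · simpa using! h₁.symm) (by
      apply endB_hom_ext
      intro e
      rw [endB_ι_assoc]
      fin_cases e
      · simpa using! k₀
      · simpa using! k₁) h₃
  refine ⟨H, ?_, ?_, h₅, h₆⟩
  · rw [← endB_ι, Category.assoc, h₄, endB_zero_ends]
  · rw [← endB_ι, Category.assoc, h₄, endB_one_ends]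

/-- Completion of three sides of a square of homotopies. -/
lemma exists_square {X E Z : SSet.{u}} (p : E ⟶ Z) [Fibration p] (e : Fin 2)
    (f h₀ h₁ : X ⊗ Δ[1] ⟶ E) (K : (X ⊗ Δ[1]) ⊗ Δ[1] ⟶ Z)
    (hf₀ : endι e X ≫ h₀ = endι 0 X ≫ f) (hf₁ : endι e X ≫ h₁ = endι 1 X ≫ f)
    (k : f ≫ p = endι e _ ≫ K) (k₀ : h₀ ≫ p = endι 0 X ▷ _ ≫ K)
    (k₁ : h₁ ≫ p = endι 1 X ▷ _ ≫ K) :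
    ∃ H : (X ⊗ Δ[1]) ⊗ Δ[1] ⟶ E, endι e _ ≫ H = f ∧ endι 0 X ▷ _ ≫ H = h₀ ∧
      endι 1 X ▷ _ ≫ H = h₁ ∧ H ≫ p = K := by
  let φ : (X ⊗ (∂Δ[1] : SSet.{u})) ⊗ Δ[1] ⟶ (X ⊗ Δ[1]) ⊗ (∂Δ[1] : SSet.{u}) :=
    lift (fst _ _ ▷ _) (fst _ _ ≫ snd _ _)
  have hφ (e) : endB e X ▷ Δ[1] ≫ φ = endB e _ := rfl
  have hφ' (Y : SSet.{u}) (a b : (X ⊗ (∂Δ[1] : SSet.{u})) ⊗ Δ[1] ⟶ Y)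
      (hab : ∀ e, endB e X ▷ Δ[1] ≫ a = endB e X ▷ Δ[1] ≫ b) : a = b := by
    ext n ⟨⟨x, ⟨t, ht⟩⟩, y⟩
    obtain rfl | rfl := mem_boundary_one ht
    · exact congr_app_apply (hab 0) n (x, y)
    · exact congr_app_apply (hab 1) n (x, y)
  have hφ'' (e) : endB e X ▷ Δ[1] ≫ (X ◁ ∂Δ[1].ι) ▷ Δ[1] = endι e X ▷ Δ[1] := rfl
  obtain ⟨H, h₄, h₅, h₆⟩ := exists_homotopy_extension (X ◁ ∂Δ[1].ι) p e f
    (φ ≫ ends h₀ h₁) K (by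
      apply endB_hom_ext
      intro e'
      rw [endB_ι_assoc, ← endι_naturality_assoc, reassoc_of% hφ]
      fin_cases e'
      · simpa using! hf₀
      · simpa using! hf₁) k (by
      apply hφ'
      intro e'
      rw [Category.assoc, reassoc_of% hφ, reassoc_of% hφ'']
      fin_cases e'
      · simpa using! k₀
      · simpa using! k₁)
  refine ⟨H, h₄, ?_, ?_, h₆⟩
  · rw [← hφ'', Category.assoc, h₅, reassoc_of% hφ, endB_zero_ends]
  · rw [← hφ'', Category.assoc, h₅, reassoc_of% hφ, endB_one_ends]

end lifting

/-! ### The homotopy relation -/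

section homotopic

/-- The relation of homotopy between morphisms of simplicial sets. -/
def Homotopic {X Y : SSet.{u}} (f g : X ⟶ Y) : Prop :=
  ∃ h : X ⊗ Δ[1] ⟶ Y, endι 0 X ≫ h = f ∧ endι 1 X ≫ h = g

lemma nonempty_homotopy_iff {X Y : SSet.{u}} (f g : X ⟶ Y) :
    Nonempty (Homotopy f g) ↔ Homotopic f g := by
  constructor
  · rintro ⟨H⟩
    exact ⟨H.h, H.h₀, H.h₁⟩
  · rintro ⟨h, h₀, h₁⟩
    exact ⟨{ h := h, h₀ := h₀, h₁ := h₁, rel := by ext n ⟨⟨x, hx⟩, y⟩; exact hx.elim }⟩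

lemma Homotopic.refl {X Y : SSet.{u}} (f : X ⟶ Y) : Homotopic f f :=
  ⟨fst _ _ ≫ f, by simp, by simp⟩

lemma Homotopic.precomp {X Y Z : SSet.{u}} {f g : Y ⟶ Z} (h : Homotopic f g) (k : X ⟶ Y) :
    Homotopic (k ≫ f) (k ≫ g) := by
  obtain ⟨H, rfl, rfl⟩ := h
  exact ⟨k ▷ _ ≫ H, by simp, by simp⟩

lemma Homotopic.postcomp {X Y Z : SSet.{u}} {f g : X ⟶ Y} (h : Homotopic f g) (k : Y ⟶ Z) :
    Homotopic (f ≫ k) (g ≫ k) := by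
  obtain ⟨H, rfl, rfl⟩ := h
  exact ⟨H ≫ k, by simp, by simp⟩

/-- Fill the open box with the constant homotopy at `f` as base and the two given homotopies as
sides; the opposite side joins `g` to `g'`. -/
lemma Homotopic.euclidean {X K : SSet.{u}} [hK : KanComplex K] {f g g' : X ⟶ K}
    (h : Homotopic f g) (h' : Homotopic f g') : Homotopic g g' := by
  obtain ⟨H, rfl, rfl⟩ := h
  obtain ⟨H', h', rfl⟩ := h'
  have : Fibration (terminal.from K) := hK
  obtain ⟨F, -, h₀, h₁, -⟩ := exists_square (terminal.from K) 0 (fst _ _ ≫ endι 0 X ≫ H) H H'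
    (terminal.from _) (by simp) (by simp [h']) (Subsingleton.elim _ _) (Subsingleton.elim _ _)
    (Subsingleton.elim _ _)
  refine ⟨endι 1 _ ≫ F, ?_, ?_⟩
  · rw [← endι_naturality_assoc, h₀]
  · rw [← endι_naturality_assoc, h₁]

lemma Homotopic.symm {X K : SSet.{u}} [KanComplex K] {f g : X ⟶ K} (h : Homotopic f g) :
    Homotopic g f := h.euclidean (.refl f)

lemma Homotopic.trans {X K : SSet.{u}} [KanComplex K] {f g k : X ⟶ K} (h : Homotopic f g)
    (h' : Homotopic g k) : Homotopic f k := h.symm.euclidean h'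

end homotopic

/-! ### Weak equivalences and trivial fibrations -/

section weakEquivalence

lemma isWeakEquivalence_iff {X Y : SSet.{u}} (f : X ⟶ Y) : IsWeakEquivalence f ↔
    ∀ (K : SSet.{u}), KanComplex K → (∀ g : X ⟶ K, ∃ h : Y ⟶ K, Homotopic (f ≫ h) g) ∧
      (∀ h h' : Y ⟶ K, Homotopic (f ≫ h) (f ≫ h') → Homotopic h h') := by
  simp only [IsWeakEquivalence, nonempty_homotopy_iff]

variable {X Y Z : SSet.{u}}

lemma isWeakEquivalence_of_homotopyEquivalence (f : X ⟶ Y) (g : Y ⟶ X)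
    (h₁ : Homotopic (f ≫ g) (𝟙 X)) (h₂ : Homotopic (g ≫ f) (𝟙 Y)) : IsWeakEquivalence f := by
  rw [isWeakEquivalence_iff]
  refine fun K _ ↦ ⟨fun φ ↦ ⟨g ≫ φ, by simpa using h₁.postcomp φ⟩, fun φ ψ h ↦ ?_⟩
  have := (h.precomp g)
  have h₃ := h₂.postcomp φ
  have h₄ := h₂.postcomp ψ
  simp only [Category.assoc, Category.id_comp] at this h₃ h₄
  exact h₃.symm.trans (this.trans h₄)

lemma isWeakEquivalence_of_isIso (f : X ⟶ Y) [IsIso f] : IsWeakEquivalence f :=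
  isWeakEquivalence_of_homotopyEquivalence f (inv f) (by simpa using .refl _)
    (by simpa using .refl _)

namespace IsWeakEquivalence

variable {f : X ⟶ Y} {g : Y ⟶ Z}

lemma comp (hf : IsWeakEquivalence f) (hg : IsWeakEquivalence g) :
    IsWeakEquivalence (f ≫ g) := by
  rw [isWeakEquivalence_iff] at *
  refine fun K hK ↦ ⟨fun φ ↦ ?_, fun φ ψ h ↦ ?_⟩
  · obtain ⟨a, ha⟩ := (hf K hK).1 φ
    obtain ⟨b, hb⟩ := (hg K hK).1 a
    exact ⟨b, by simpa using (hb.precomp f).trans ha⟩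
  · simp only [Category.assoc] at h
    exact (hg K hK).2 _ _ ((hf K hK).2 _ _ h)

lemma of_precomp (hf : IsWeakEquivalence f) (hfg : IsWeakEquivalence (f ≫ g)) :
    IsWeakEquivalence g := by
  rw [isWeakEquivalence_iff] at *
  refine fun K hK ↦ ⟨fun φ ↦ ?_, fun φ ψ h ↦ ?_⟩
  · obtain ⟨a, ha⟩ := (hfg K hK).1 (f ≫ φ)
    exact ⟨a, (hf K hK).2 _ _ (by simpa using ha)⟩
  · exact (hfg K hK).2 _ _ (by simpa using h.precomp f)

lemma of_postcomp (hg : IsWeakEquivalence g) (hfg : IsWeakEquivalence (f ≫ g)) :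
    IsWeakEquivalence f := by
  rw [isWeakEquivalence_iff] at *
  refine fun K hK ↦ ⟨fun φ ↦ ?_, fun φ ψ h ↦ ?_⟩
  · obtain ⟨a, ha⟩ := (hfg K hK).1 φ
    exact ⟨g ≫ a, by simpa using ha⟩
  · obtain ⟨a, ha⟩ := (hg K hK).1 φ
    obtain ⟨b, hb⟩ := (hg K hK).1 ψ
    have h₁ := ha.precomp f
    have h₂ := hb.precomp f
    exact ha.symm.trans ((((hfg K hK).2 _ _
      (by simpa using (h₁.trans h).trans h₂.symm)).precomp g).trans hb)

lemma exists_homotopyInverse (hf : IsWeakEquivalence f) [KanComplex X] [KanComplex Y] :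
    ∃ g : Y ⟶ X, Homotopic (f ≫ g) (𝟙 X) ∧ Homotopic (g ≫ f) (𝟙 Y) := by
  rw [isWeakEquivalence_iff] at hf
  obtain ⟨g, hg⟩ := (hf X inferInstance).1 (𝟙 X)
  exact ⟨g, hg, (hf Y inferInstance).2 _ _ (by simpa using hg.postcomp f)⟩

end IsWeakEquivalence

/-- Lifting against `K ⟶ *` extends maps to `K` along `f`, and lifting the pushout-product of `f`
with `∂Δ[1] ⊆ Δ[1]` extends homotopies with prescribed ends. -/
lemma isWeakEquivalence_of_anodyne {f : X ⟶ Y} (hf : anodyneExtensions f) :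
    IsWeakEquivalence f := by
  rw [isWeakEquivalence_iff]
  refine fun K hK ↦ ?_
  have : Fibration (terminal.from K) := hK
  refine ⟨fun φ ↦ ?_, fun φ ψ ⟨h, h₀, h₁⟩ ↦ ?_⟩
  · have := hf (terminal.from K) (by rwa [← HomotopicalAlgebra.fibration_iff])
    have sq : CommSq φ f (terminal.from K) (terminal.from _) := ⟨Subsingleton.elim _ _⟩
    exact ⟨sq.lift, by simpa using .refl _⟩
  · obtain ⟨H, h₃, h₄, -⟩ := exists_homotopy_of_anodyne hf (terminal.from K) φ ψ h
      (terminal.from _) h₀ h₁ (Subsingleton.elim _ _) (Subsingleton.elim _ _)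
      (Subsingleton.elim _ _)
    exact ⟨H, h₃, h₄⟩

/-- Morphisms with the right lifting property with respect to monomorphisms. -/
abbrev TrivialFibration (p : X ⟶ Y) : Prop := (MorphismProperty.monomorphisms SSet.{u}).rlp p

lemma TrivialFibration.exists_lift {p : X ⟶ Y} (hp : TrivialFibration p) {A B : SSet.{u}}
    (i : A ⟶ B) [Mono i] (f : A ⟶ X) (g : B ⟶ Y) (h : f ≫ p = i ≫ g) :
    ∃ l : B ⟶ X, i ≫ l = f ∧ l ≫ p = g := by
  have := hp i ‹Mono i›
  have sq : CommSq f i p g := ⟨h⟩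
  exact ⟨sq.lift, sq.fac_left, sq.fac_right⟩

lemma exists_lift_of_anodyne {A B : SSet.{u}} {i : A ⟶ B} (hi : anodyneExtensions i)
    (p : X ⟶ Y) [Fibration p] (f : A ⟶ X) (g : B ⟶ Y) (h : f ≫ p = i ≫ g) :
    ∃ l : B ⟶ X, i ≫ l = f ∧ l ≫ p = g := by
  have := hi p (by rwa [← HomotopicalAlgebra.fibration_iff])
  have sq : CommSq f i p g := ⟨h⟩
  exact ⟨sq.lift, sq.fac_left, sq.fac_right⟩

lemma TrivialFibration.of_exists {p : X ⟶ Y} (h : ∀ {A B : SSet.{u}} (i : A ⟶ B) [Mono i]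
    (f : A ⟶ X) (g : B ⟶ Y), f ≫ p = i ≫ g → ∃ l : B ⟶ X, i ≫ l = f ∧ l ≫ p = g) :
    TrivialFibration p := by
  intro A B i hi
  have : Mono i := hi
  refine ⟨fun {f g} sq ↦ ?_⟩
  obtain ⟨l, h₁, h₂⟩ := h i f g sq.w
  exact ⟨⟨⟨l, h₁, h₂⟩⟩⟩

lemma mono_of_anodyne {A B : SSet.{u}} {i : A ⟶ B} (hi : anodyneExtensions i) : Mono i := by
  have hJ : modelCategoryQuillen.J.{u} ≤ MorphismProperty.monomorphisms SSet.{u} := by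
    intro _ _ _ h
    simp only [J, MorphismProperty.iSup_iff] at h
    obtain ⟨m, ⟨k⟩⟩ := h
    exact inferInstanceAs (Mono _)
  have h : anodyneExtensions.{u} ≤ MorphismProperty.monomorphisms SSet.{u} := by
    rw [anodyneExtensions_eq_retracts_transfiniteCompositions]
    refine MorphismProperty.retracts_le_iff.2 (MorphismProperty.transfiniteCompositions_le_iff.2
      (MorphismProperty.pushouts_le_iff.2 (MorphismProperty.coproducts_le_iff.2 hJ)))
  exact h i hi

lemma TrivialFibration.fibration {p : X ⟶ Y} (hp : TrivialFibration p) : Fibration p := by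
  rw [modelCategoryQuillen.fibration_iff]
  intro A B i hi
  have : Mono i := by
    simp only [J, MorphismProperty.iSup_iff] at hi
    obtain ⟨m, ⟨k⟩⟩ := hi
    infer_instance
  exact hp i this

/-- A fibration which is a fibrewise deformation retraction is a trivial fibration. -/
lemma TrivialFibration.of_section (p : X ⟶ Y) [Fibration p] (s : Y ⟶ X)
    (hs : s ≫ p = 𝟙 Y) (k : X ⊗ Δ[1] ⟶ X) (hk : k ≫ p = fst _ _ ≫ p)
    (k₀ : endι 0 X ≫ k = 𝟙 X) (k₁ : endι 1 X ≫ k = p ≫ s) : TrivialFibration p := by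
  refine .of_exists fun {A B} i _ f g h ↦ ?_
  -- `g ≫ s` lifts `g`, but restricts on `A` to `f ≫ p ≫ s` in place of `f`. The homotopy `k` joins
  -- these inside the fibres; extended from its end `1`, it yields a correct lift at its end `0`.
  obtain ⟨H, h₁, h₂, h₃⟩ := exists_homotopy_extension i p 1 (g ≫ s) (f ▷ _ ≫ k)
    (fst _ _ ≫ g) (by simp [k₁, reassoc_of% h]) (by simp [hs]) (by simp [hk, h])
  refine ⟨endι 0 _ ≫ H, ?_, by simp [h₃]⟩
  rw [← endι_naturality_assoc, h₂]
  simp [k₀]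

lemma TrivialFibration.exists_section {p : X ⟶ Y} (hp : TrivialFibration p) :
    ∃ s : Y ⟶ X, s ≫ p = 𝟙 Y ∧ ∃ k : X ⊗ Δ[1] ⟶ X, k ≫ p = fst _ _ ≫ p ∧
      endι 0 X ≫ k = 𝟙 X ∧ endι 1 X ≫ k = p ≫ s := by
  obtain ⟨s, -, hs⟩ := hp.exists_lift (initial.to Y) (initial.to X) (𝟙 Y) (Subsingleton.elim _ _)
  refine ⟨s, hs, ?_⟩
  obtain ⟨k, h₁, h₂⟩ := hp.exists_lift (X ◁ ∂Δ[1].ι) (ends (𝟙 X) (p ≫ s)) (fst _ _ ≫ p) (by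
    apply endB_hom_ext
    intro e
    have (e : Fin 2) : endB e X ≫ fst X (∂Δ[1] : SSet.{u}) = 𝟙 _ := rfl
    fin_cases e <;> simp [hs, reassoc_of% this])
  refine ⟨k, h₂, ?_, ?_⟩
  · rw [← endB_ι, Category.assoc, h₁, endB_zero_ends]
  · rw [← endB_ι, Category.assoc, h₁, endB_one_ends]

lemma isWeakEquivalence_of_section (p : X ⟶ Y) (s : Y ⟶ X)
    (hs : s ≫ p = 𝟙 Y) (k : X ⊗ Δ[1] ⟶ X) 
    (k₀ : endι 0 X ≫ k = 𝟙 X) (k₁ : endι 1 X ≫ k = p ≫ s) : IsWeakEquivalence p := by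
  rw [isWeakEquivalence_iff]
  refine fun K _ ↦ ⟨fun φ ↦ ⟨s ≫ φ, ?_⟩, fun φ ψ h ↦ ?_⟩
  · have : Homotopic (𝟙 X) (p ≫ s) := ⟨k, k₀, k₁⟩
    simpa using (this.postcomp φ).symm
  · simpa [reassoc_of% hs] using h.precomp s

lemma TrivialFibration.isWeakEquivalence {p : X ⟶ Y} (hp : TrivialFibration p) :
    IsWeakEquivalence p := by
  obtain ⟨s, hs, k, -, k₀, k₁⟩ := hp.exists_section
  exact isWeakEquivalence_of_section p s hs k k₀ k₁

/-- A fibration with an anodyne section is a trivial fibration. -/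
lemma TrivialFibration.of_anodyne_section (p : X ⟶ Y) [Fibration p] {s : Y ⟶ X}
    (hs : anodyneExtensions s) (hsp : s ≫ p = 𝟙 Y) : TrivialFibration p := by
  obtain ⟨k, k₀, k₁, -, hk⟩ := exists_homotopy_of_anodyne hs p (𝟙 X) (p ≫ s) (fst _ _ ≫ s)
    (fst _ _ ≫ p) (by simp) (by simp [reassoc_of% hsp]) (by simp) (by simp [hsp]) (by simp)
  exact .of_section p s hsp k hk k₀ k₁

/-- A homotopy inverse is first deformed to a strict section `s` by homotopy lifting; the homotopy
from the identity to `p ≫ s` is then made fibrewise, and `TrivialFibration.of_section` applies. -/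
lemma TrivialFibration.of_kanComplex (p : X ⟶ Y) [Fibration p] [KanComplex X] [KanComplex Y]
    (hp : IsWeakEquivalence p) : TrivialFibration p := by
  obtain ⟨g, h₁, h₂⟩ := hp.exists_homotopyInverse
  obtain ⟨s, hs, hgs⟩ : ∃ s : Y ⟶ X, s ≫ p = 𝟙 Y ∧ Homotopic g s := by
    obtain ⟨H, h₀, h₁⟩ := h₂
    obtain ⟨H', h₃, -, h₅⟩ := exists_homotopy_extension (⊥ : Y.Subcomplex).ι p 0 g
      { app n := ↾fun x ↦ x.1.2.elim
        naturality _ _ _ := by ext ⟨⟨x, hx⟩, y⟩; exact hx.elim } H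
      (by ext n ⟨x, hx⟩; exact hx.elim) h₀.symm (by ext n ⟨⟨x, hx⟩, y⟩; exact hx.elim)
    exact ⟨endι 1 _ ≫ H', by rw [Category.assoc, h₅, h₁], ⟨H', h₃, rfl⟩⟩
  obtain ⟨h, h₀, h₁⟩ : Homotopic (𝟙 X) (p ≫ s) := h₁.symm.trans (hgs.precomp p)
  -- The sides `h` and `h ≫ p ≫ s` have the same image under `p`, so the box can be filled over a
  -- homotopy independent of the first cylinder coordinate. The face opposite to the constant base
  -- then lies in the fibres of `p`.
  obtain ⟨k, -, k₀, k₁, hk⟩ := exists_square p 1 (fst _ _ ≫ p ≫ s) h (h ≫ p ≫ s)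
    (fst _ _ ▷ _ ≫ h ≫ p) (by simp [h₁]) (by simp [reassoc_of% h₁, reassoc_of% hs])
    (by simp [reassoc_of% h₁]) (by simp [← comp_whiskerRight_assoc])
    (by simp [hs, ← comp_whiskerRight_assoc])
  refine .of_section p s hs (endι 0 _ ≫ k) (by simp [hk, reassoc_of% h₀]) ?_ ?_
  · rw [← endι_naturality_assoc, k₀, h₀]
  · rw [← endι_naturality_assoc, k₁, reassoc_of% h₀]

end weakEquivalence

/-! ### Pullbacks computed on simplices -/

section pullbacks

lemma isPullback_of_existsUnique {P X Y Z : SSet.{u}} {a : P ⟶ X} {b : P ⟶ Y} {f : X ⟶ Z}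
    {g : Y ⟶ Z} (w : a ≫ f = b ≫ g)
    (h : ∀ n (x : X.obj n) (y : Y.obj n), f.app n x = g.app n y →
      ∃ z, a.app n z = x ∧ b.app n z = y)
    (h' : ∀ n (z z' : P.obj n), a.app n z = a.app n z' → b.app n z = b.app n z' → z = z') :
    IsPullback a b f g := by
  refine IsPullback.of_forall_isPullback_app fun n ↦ ?_
  rw [Types.isPullback_iff]
  refine ⟨?_, fun z z' h₁ ↦ h' n z z' h₁.1 h₁.2, fun x y hxy ↦ h n x y hxy⟩
  ext z
  exact congr_app_apply w n z

lemma isPullback_app {P X Y Z : SSet.{u}} {a : P ⟶ X} {b : P ⟶ Y} {f : X ⟶ Z}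
    {g : Y ⟶ Z} (h : IsPullback a b f g) (n) :
    IsPullback (a.app n) (b.app n) (f.app n) (g.app n) :=
  h.map ((evaluation _ _).obj n)

lemma exists_of_isPullback {P X Y Z : SSet.{u}} {a : P ⟶ X} {b : P ⟶ Y} {f : X ⟶ Z}
    {g : Y ⟶ Z} (h : IsPullback a b f g) {n} (x : X.obj n) (y : Y.obj n)
    (hxy : f.app n x = g.app n y) : ∃ z, a.app n z = x ∧ b.app n z = y :=
  ((Types.isPullback_iff _ _ _ _).1 (isPullback_app h n)).2.2 x y hxy

lemma ext_of_isPullback {P X Y Z : SSet.{u}} {a : P ⟶ X} {b : P ⟶ Y} {f : X ⟶ Z}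
    {g : Y ⟶ Z} (h : IsPullback a b f g) {n} (z z' : P.obj n)
    (h₁ : a.app n z = a.app n z') (h₂ : b.app n z = b.app n z') : z = z' :=
  ((Types.isPullback_iff _ _ _ _).1 (isPullback_app h n)).2.1 _ _ ⟨h₁, h₂⟩

lemma fibration_of_isPullback {P X Y Z : SSet.{u}} {a : P ⟶ X} {b : P ⟶ Y} {f : X ⟶ Z}
    {g : Y ⟶ Z} (h : IsPullback a b f g) [Fibration g] : Fibration a := by
  rw [modelCategoryQuillen.fibration_iff]
  exact MorphismProperty.of_isPullback (P := J.rlp) h.flip (by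
    rwa [← modelCategoryQuillen.fibration_iff])

lemma TrivialFibration.of_isPullback {P X Y Z : SSet.{u}} {a : P ⟶ X} {b : P ⟶ Y} {f : X ⟶ Z}
    {g : Y ⟶ Z} (h : IsPullback a b f g) (hg : TrivialFibration g) : TrivialFibration a :=
  MorphismProperty.of_isPullback (P := (MorphismProperty.monomorphisms SSet.{u}).rlp) h.flip hg

variable {X Y Z : SSet.{u}}

/-- The fibre product of two morphisms of simplicial sets, as a subcomplex of the product. -/
def fiberProd (f : X ⟶ Z) (g : Y ⟶ Z) : (X ⊗ Y).Subcomplex where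
  obj n := {x | f.app n x.1 = g.app n x.2}
  map {n m} θ := by
    rintro ⟨x, y⟩ (h : f.app n x = g.app n y)
    change f.app m (X.map θ x) = g.app m (Y.map θ y)
    rw [NatTrans.naturality_apply, NatTrans.naturality_apply, h]

variable (f : X ⟶ Z) (g : Y ⟶ Z)

/-- The first projection of the fibre product. -/
def fiberFst : (fiberProd f g : SSet.{u}) ⟶ X := (fiberProd f g).ι ≫ fst _ _
/-- The second projection of the fibre product. -/
def fiberSnd : (fiberProd f g : SSet.{u}) ⟶ Y := (fiberProd f g).ι ≫ snd _ _

lemma isPullback_fiberProd : IsPullback (fiberFst f g) (fiberSnd f g) f g := by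
  refine isPullback_of_existsUnique ?_ (fun n x y h ↦ ⟨⟨(x, y), h⟩, rfl, rfl⟩) ?_
  · ext n ⟨⟨x, y⟩, h⟩
    exact h
  · rintro n ⟨⟨x, y⟩, h⟩ ⟨⟨x', y'⟩, h'⟩ (rfl : x = x') (rfl : y = y')
    rfl

lemma fiberProd_condition : fiberFst f g ≫ f = fiberSnd f g ≫ g :=
  (isPullback_fiberProd f g).w

/-- The functoriality of the fibre product in the first variable. -/
def fiberMap {X' : SSet.{u}} (i : X' ⟶ X) :
    (fiberProd (i ≫ f) g : SSet.{u}) ⟶ (fiberProd f g : SSet.{u}) :=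
  Subcomplex.lift ((fiberProd (i ≫ f) g).ι ≫ i ▷ Y) (by
    rintro n _ ⟨⟨⟨x, y⟩, h⟩, rfl⟩
    exact h)

instance {X' : SSet.{u}} (i : X' ⟶ X) [Mono i] : Mono (fiberMap f g i) := by
  have : Mono (fiberMap f g i ≫ (fiberProd f g).ι) :=
    inferInstanceAs (Mono ((fiberProd (i ≫ f) g).ι ≫ i ▷ Y))
  exact mono_of_mono _ (fiberProd f g).ι

instance [Fibration g] : Fibration (fiberFst f g) :=
  fibration_of_isPullback (isPullback_fiberProd f g)

end pullbacks

/-! ### Pushforward along a map -/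

section pushforward

variable {E B Y : SSet.{u}} (p : E ⟶ B) (q : Y ⟶ E)

/-- The simplices of the pushforward of `q` along `p`. -/
structure PushforwardSimplex (n : SimplexCategoryᵒᵖ) where
  base : B.obj n
  sec (m : SimplexCategoryᵒᵖ) (θ : n ⟶ m) (e : E.obj m) (h : p.app m e = B.map θ base) : Y.obj m
  q_sec (m θ e h) : q.app m (sec m θ e h) = e
  map_sec (m θ e h m') (ψ : m ⟶ m') : Y.map ψ (sec m θ e h) =
    sec m' (θ ≫ ψ) (E.map ψ e) (by rw [NatTrans.naturality_apply, h]; simp)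

variable {p q} in
lemma PushforwardSimplex.ext' {n : SimplexCategoryᵒᵖ} {x y : PushforwardSimplex p q n}
    (h : x.base = y.base) (h' : ∀ m θ e h₁ h₂, x.sec m θ e h₁ = y.sec m θ e h₂) : x = y := by
  obtain ⟨b, s, _, _⟩ := x
  obtain ⟨b', s', _, _⟩ := y
  obtain rfl : b = b' := h
  obtain rfl : s = s' := by
    funext m θ e h
    exact h' m θ e h h
  rfl

/-- The restriction of simplices of the pushforward. -/
def PushforwardSimplex.map {p : E ⟶ B} {q : Y ⟶ E} {n n' : SimplexCategoryᵒᵖ}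
    (x : PushforwardSimplex p q n) (α : n ⟶ n') : PushforwardSimplex p q n' where
  base := B.map α x.base
  sec m θ e h := x.sec m (α ≫ θ) e (by simp [h])
  q_sec _ _ _ _ := x.q_sec _ _ _ _
  map_sec m θ e h m' ψ := by
    rw [x.map_sec]
    congr 1

lemma PushforwardSimplex.map_sec' {p : E ⟶ B} {q : Y ⟶ E} {n n' : SimplexCategoryᵒᵖ}
    (x : PushforwardSimplex p q n) (α : n ⟶ n') {m} (β : n ⟶ m) (θ e h) (hβ : α ≫ θ = β) (h') :
    (x.map α).sec m θ e h = x.sec m β e h' := by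
  subst hβ
  rfl

/-- The pushforward of `q` along `p`. -/
def pushforward : SSet.{u} where
  obj n := PushforwardSimplex p q n
  map {n n'} α := ↾fun x ↦ x.map α
  map_id n := by
    ext x
    exact PushforwardSimplex.ext' (by simp [PushforwardSimplex.map])
      (fun m θ e h₁ h₂ ↦ x.map_sec' _ _ _ _ _ (by simp) _)
  map_comp α β := by
    ext x
    exact PushforwardSimplex.ext' (by simp [PushforwardSimplex.map])
      (fun m θ e h₁ h₂ ↦ x.map_sec' _ _ _ _ _ (by simp) _)

/-- The projection of the pushforward. -/
def pushforwardπ : pushforward p q ⟶ B where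
  app n := ↾fun x ↦ x.base

variable {p q}

lemma PushforwardSimplex.sec_congr {n m : SimplexCategoryᵒᵖ} (x : PushforwardSimplex p q n)
    {θ θ' : n ⟶ m} {e e' : E.obj m} (hθ : θ = θ') (he : e = e') (h h') :
    x.sec m θ e h = x.sec m θ' e' h' := by
  subst hθ he
  rfl

/-- By naturality, a map to the pushforward is determined by the values of its sections at
identities. This is what makes transposition faithful. -/
lemma sec_of_hom {S : SSet.{u}} (f : S ⟶ pushforward p q) {n m : SimplexCategoryᵒᵖ}
    (α : n ⟶ m) (x : S.obj n) (e : E.obj m) (h h') :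
    (f.app m (S.map α x)).sec m (𝟙 m) e h = (f.app n x).sec m α e h' := by
  have : f.app m (S.map α x) = (f.app n x).map α := NatTrans.naturality_apply f α x
  generalize f.app m (S.map α x) = y at this h
  subst this
  exact PushforwardSimplex.map_sec' _ _ _ _ _ _ (by simp) _

/-- Transposition of morphisms to the pushforward. -/
def pushforwardTranspose {S : SSet.{u}} (f : S ⟶ pushforward p q) :
    (fiberProd (f ≫ pushforwardπ p q) p : SSet.{u}) ⟶ Y where
  app n := ↾fun x ↦ (f.app n x.1.1).sec n (𝟙 n) x.1.2 (by simpa using! x.2.symm)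
  naturality n m θ := by
    ext ⟨⟨x, e⟩, h⟩
    refine Eq.trans ?_ ((f.app n x).map_sec _ _ _ _ _ θ).symm
    refine (sec_of_hom f θ x _ _ ?_).trans (PushforwardSimplex.sec_congr _ (by simp) rfl _ _)
    change p.app m (E.map θ e) = _
    rw [NatTrans.naturality_apply, ← (show _ = p.app n e from h)]
    rfl

/-- The morphism to the pushforward attached to a morphism from a fibre product. -/
def pushforwardUntranspose {T : SSet.{u}} (τ : T ⟶ B) (l : (fiberProd τ p : SSet.{u}) ⟶ Y)
    (hl : l ≫ q = fiberSnd τ p) : T ⟶ pushforward p q where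
  app n := ↾fun x ↦
    { base := τ.app n x
      sec m θ e h := l.app m ⟨(T.map θ x, e), by
        rw [← NatTrans.naturality_apply] at h
        exact h.symm⟩
      q_sec m θ e h := congr_app_apply hl m _
      map_sec m θ e h m' ψ := by
        refine (NatTrans.naturality_apply l ψ _).symm.trans (congrArg (l.app m') ?_)
        apply Subtype.ext
        refine Prod.ext ?_ rfl
        change T.map ψ (T.map θ x) = T.map (θ ≫ ψ) x
        simp }
  naturality n m θ := by
    ext x
    have hx := NatTrans.naturality_apply τ θ x
    refine PushforwardSimplex.ext' hx (fun m' θ' e h h' ↦ ?_)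
    refine congrArg (l.app m') ?_
    apply Subtype.ext
    refine Prod.ext ?_ rfl
    change T.map θ' (T.map θ x) = T.map (θ ≫ θ') x
    simp

lemma transpose_comp_q {S : SSet.{u}} (f : S ⟶ pushforward p q) :
    pushforwardTranspose f ≫ q = fiberSnd _ p := by
  ext n ⟨⟨x, e⟩, h⟩
  exact (f.app n x).q_sec _ _ _ _

lemma comp_pushforwardUntranspose {S T : SSet.{u}} (i : S ⟶ T) (τ : T ⟶ B)
    (f : S ⟶ pushforward p q) (hf : f ≫ pushforwardπ p q = i ≫ τ)
    (l : (fiberProd τ p : SSet.{u}) ⟶ Y) (hl : l ≫ q = fiberSnd τ p)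
    (hfl : fiberMap τ p i ≫ l =
      (Subcomplex.eqToIso (by rw [hf])).hom ≫ pushforwardTranspose f) :
    i ≫ pushforwardUntranspose τ l hl = f := by
  ext n x
  refine PushforwardSimplex.ext' (congr_app_apply hf n x).symm (fun m θ e h h' ↦ ?_)
  have h₃ : p.app m e = τ.app m (i.app m (S.map θ x)) := by
    rw [NatTrans.naturality_apply, NatTrans.naturality_apply]
    exact h
  have := congr_app_apply hfl m ⟨(S.map θ x, e), h₃.symm⟩
  refine Eq.trans ?_ (this.trans ?_)
  · refine congrArg (l.app m) ?_
    apply Subtype.ext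
    refine Prod.ext ?_ rfl
    exact (NatTrans.naturality_apply i θ x).symm
  · change (f.app m (S.map θ x)).sec m (𝟙 m) e _ = _
    exact sec_of_hom f θ x e _ h'

/-- Pushforward along `p` is right adjoint to pullback along `p`: lifting `i` against the
pushforward of `q` is lifting the pullback of `i` against `q`. -/
lemma exists_lift_pushforward {S T : SSet.{u}} (i : S ⟶ T) (τ : T ⟶ B)
    (f : S ⟶ pushforward p q) (hf : f ≫ pushforwardπ p q = i ≫ τ)
    (H : HasLiftingProperty (fiberMap τ p i) q) :
    ∃ l : T ⟶ pushforward p q, i ≫ l = f ∧ l ≫ pushforwardπ p q = τ := by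
  have sq : CommSq ((Subcomplex.eqToIso (by rw [hf])).hom ≫ pushforwardTranspose f)
      (fiberMap τ p i) q (fiberSnd τ p) := ⟨by rw [Category.assoc, transpose_comp_q]; rfl⟩
  exact ⟨_, comp_pushforwardUntranspose i τ f hf sq.lift sq.fac_right sq.fac_left, rfl⟩

end pushforward

/-! ### Anodyne extensions pulled back along fibrations -/

section frobenius

/-- The retraction criterion for inclusions of subcomplexes. -/
lemma anodyne_ι_of_retract {X Y : SSet.{u}} {A : X.Subcomplex} {B : Y.Subcomplex}
    (i : X ⟶ Y) (r : Y ⟶ X) (hir : i ≫ r = 𝟙 X) (hi : A ≤ B.preimage i) (hr : B ≤ A.preimage r)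
    (hB : anodyneExtensions B.ι) : anodyneExtensions A.ι := by
  let i' : (A : SSet.{u}) ⟶ B := Subcomplex.lift (A.ι ≫ i) (by
    rintro n _ ⟨⟨x, hx⟩, rfl⟩
    exact hi n hx)
  let r' : (B : SSet.{u}) ⟶ A := Subcomplex.lift (B.ι ≫ r) (by
    rintro n _ ⟨⟨x, hx⟩, rfl⟩
    exact hr n hx)
  let e : RetractArrow A.ι B.ι :=
    { i := Arrow.homMk i' i rfl
      r := Arrow.homMk r' r rfl
      retract := by
        ext : 1
        · rw [← cancel_mono A.ι]
          change A.ι ≫ i ≫ r = _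
          rw [hir]
          rfl
        · exact hir }
  exact anodyneExtensions.of_retract e hB

lemma exists_lift_cylinder {X E Z : SSet.{u}} (p : E ⟶ Z) [Fibration p] (e : Fin 2) (f : X ⟶ E)
    (K : X ⊗ Δ[1] ⟶ Z) (h : f ≫ p = endι e X ≫ K) :
    ∃ H : X ⊗ Δ[1] ⟶ E, endι e X ≫ H = f ∧ H ≫ p = K := by
  obtain ⟨H, h₁, -, h₂⟩ := exists_homotopy_extension (⊥ : X.Subcomplex).ι p e f
      { app n := ↾fun x ↦ x.1.2.elim
        naturality _ _ _ := by ext ⟨⟨x, hx⟩, y⟩; exact hx.elim } K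
      (by ext n ⟨x, hx⟩; exact hx.elim) h (by ext n ⟨⟨x, hx⟩, y⟩; exact hx.elim)
  exact ⟨H, h₁, h₂⟩

lemma cst_mem_horn (e : Fin 2) (n : SimplexCategoryᵒᵖ) :
    (cst e n : (Δ[1] : SSet.{u}).obj n) ∈ Λ[1, e].obj n := by
  intro h
  have : 1 - e ∈ (Set.univ : Set (Fin 2)) := trivial
  erw [← h] at this
  obtain ⟨j, hj⟩ | hj := this
  · replace hj : e = 1 - e := hj
    lia
  · replace hj : 1 - e = e := hj
    lia

/-- A deformation of `B` into the subcomplex `C`, preserving `C`. -/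
structure IsDeformation {B : SSet.{u}} (C : B.Subcomplex) (H : B ⊗ Δ[1] ⟶ B) (e : Fin 2) :
    Prop where
  endι_H : endι e B ≫ H = 𝟙 B
  mem_of_mem {n} (b : B.obj n) (t : (Δ[1] : SSet.{u}).obj n) (hb : b ∈ C.obj n) :
    H.app n (b, t) ∈ C.obj n
  mem_of_end {n} (b : B.obj n) : H.app n (b, cst (1 - e) n) ∈ C.obj n

/-- Lift the deformation to `E`, starting from the identity. The lift retracts `E ⊗ Δ[1]` onto `E`
and presents the inclusion of the preimage as a retract of that of `E × {1 - e} ∪ p⁻¹C × Δ[1]`,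
which is a pushout-product and so anodyne. Taking `p` to be an identity shows that `C` itself is
anodyne. -/
lemma IsDeformation.anodyne_preimage {B : SSet.{u}} {C : B.Subcomplex} {H : B ⊗ Δ[1] ⟶ B}
    {e : Fin 2} (h : IsDeformation C H e) {E : SSet.{u}} (p : E ⟶ B) [Fibration p] :
    anodyneExtensions (C.preimage p).ι := by
  obtain ⟨H', h₁, h₂⟩ := exists_lift_cylinder p e (𝟙 E) (p ▷ _ ≫ H) (by simp [h.endι_H])
  refine anodyne_ι_of_retract (B := (C.preimage p).unionProd Λ[1, 1 - e]) (endι e E) H' h₁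
    ?_ ?_ (anodyneExtensions_unionProd_ι _ _ (anodyneExtensions.horn_ι _))
  · intro n x hx
    exact Or.inr ⟨hx, trivial⟩
  · rintro n ⟨x, t⟩ hx
    have hp : p.app n (H'.app n (x, t)) = H.app n (p.app n x, t) :=
      congr_app_apply h₂ n (x, t)
    change p.app n (H'.app n (x, t)) ∈ C.obj n
    rw [hp]
    obtain ⟨-, ht⟩ | ⟨hx, -⟩ := hx
    · obtain rfl := mem_horn_one ht
      exact h.mem_of_end _
    · exact h.mem_of_mem _ _ hx

/-- The map of standard simplices given by a monotone map from a product. -/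
def stdSimplexProdMap {a b c : ℕ} (F : Fin (a + 1) × Fin (b + 1) →o Fin (c + 1)) :
    (Δ[a] ⊗ Δ[b] : SSet.{u}) ⟶ Δ[c] where
  app n := ↾fun x ↦ stdSimplex.objMk (F.comp
    ((stdSimplex.asOrderHom x.1).prod (stdSimplex.asOrderHom x.2)))
  naturality _ _ _ := rfl

/-- The function underlying the deformation of the standard simplex into a horn. -/
def hornDeformationFun {n : ℕ} (k : Fin (n + 1)) :
    Fin (n + 1) × Fin (1 + 1) →o Fin (n + 1) where
  toFun x := if k = 0 then (if x.2 = 0 then 0 else x.1) else (if x.2 = 0 then x.1 else max x.1 k)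
  monotone' := by
    rintro ⟨a, s⟩ ⟨b, t⟩ ⟨hab, hst⟩
    dsimp at hab hst ⊢
    split_ifs <;> grind

lemma hornDeformationFun_apply {n : ℕ} (k x : Fin (n + 1)) (t : Fin 2) :
    hornDeformationFun k (x, t) =
      if k = 0 then (if t = 0 then 0 else x) else (if t = 0 then x else max x k) := rfl

lemma hornDeformationFun_ne {n : ℕ} (k x i : Fin (n + 1)) (t : Fin 2) (hi : i ≠ k) (hx : x ≠ i) :
    hornDeformationFun k (x, t) ≠ i := by
  rw [hornDeformationFun_apply]
  split_ifs <;> grind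

/-- If `k = 0`, contraction to the vertex `0` ends in the face opposite to `1`; if `k ≠ 0`, the map
`x ↦ max x k` ends in the face opposite to `0`. Throughout, a vertex `x` goes to `x` or to `k`, so
every face opposite to some `i ≠ k` is preserved. -/
lemma isDeformation_horn {n : ℕ} (k : Fin (n + 1)) (hn : n ≠ 0) :
    ∃ e, IsDeformation (Λ[n, k] : (Δ[n] : SSet.{u}).Subcomplex)
      (stdSimplexProdMap (hornDeformationFun k)) e := by
  have key {m : SimplexCategoryᵒᵖ} {x : (Δ[n] : SSet.{u}).obj m} (i : Fin (n + 1)) (hi : i ≠ k)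
      (hx : ∀ j, stdSimplex.asOrderHom x j ≠ i) : x ∈ Λ[n, k].obj m := by
    intro h
    have : i ∈ (Set.univ : Set (Fin (n + 1))) := trivial
    erw [← h] at this
    obtain ⟨j, hj⟩ | hj := this
    · exact hx j hj
    · exact hi hj
  have key' {m : SimplexCategoryᵒᵖ} {x : (Δ[n] : SSet.{u}).obj m} (hx : x ∈ Λ[n, k].obj m) :
      ∃ i ≠ k, ∀ j, stdSimplex.asOrderHom x j ≠ i := by
    by_contra! h
    apply hx
    ext i
    simp only [Set.union_singleton, Set.mem_insert_iff, Set.mem_range, Set.mem_univ, iff_true]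
    by_cases hi : i = k
    · exact Or.inl hi
    · exact Or.inr (h i hi)
  have hmem {m : SimplexCategoryᵒᵖ} (b : (Δ[n] : SSet.{u}).obj m) (t : (Δ[1] : SSet.{u}).obj m)
      (hb : b ∈ Λ[n, k].obj m) :
      (stdSimplexProdMap (hornDeformationFun k)).app m (b, t) ∈ Λ[n, k].obj m := by
    obtain ⟨i, hi, hb⟩ := key' hb
    refine key i hi (fun j h ↦ ?_)
    exact hornDeformationFun_ne k _ i _ hi (hb j) h
  by_cases hk : k = 0
  · refine ⟨1, ?_, hmem, fun {m} b ↦ key 1 ?_ (fun j h ↦ ?_)⟩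
    · ext m x
      apply stdSimplex.ext
      intro j
      exact (if_pos hk).trans (if_neg (by change (1 : Fin 2) ≠ 0; decide))
    · subst hk
      rw [Ne, Fin.ext_iff, Fin.val_one']
      simp
      lia
    · replace h : hornDeformationFun k (stdSimplex.asOrderHom b j, 0) = 1 := h
      rw [hornDeformationFun_apply, if_pos hk, if_pos rfl, Fin.ext_iff, Fin.val_one'] at h
      simp at h
      lia
  · refine ⟨0, ?_, hmem, fun {m} b ↦ key 0 (Ne.symm hk) (fun j h ↦ ?_)⟩
    · ext m x
      apply stdSimplex.ext
      intro j
      exact (if_neg hk).trans (if_pos rfl)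
    · replace h : hornDeformationFun k (stdSimplex.asOrderHom b j, 1) = 0 := h
      rw [hornDeformationFun_apply, if_neg hk, if_neg (by decide)] at h
      have := le_max_right (stdSimplex.asOrderHom b j) k
      rw [h] at this
      exact hk (le_antisymm this (Fin.zero_le _))

/-- Fibrations are exponentiable fibrations: pushforwards of fibrations along fibrations are
fibrations. -/
lemma fibration_pushforwardπ {E B Y : SSet.{u}} (p : E ⟶ B) (q : Y ⟶ E) [Fibration p]
    [Fibration q] : Fibration (pushforwardπ p q) := by
  rw [modelCategoryQuillen.fibration_iff]
  intro _ _ i hi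
  simp only [J, MorphismProperty.iSup_iff] at hi
  obtain ⟨m, ⟨k⟩⟩ := hi
  refine ⟨fun {f τ} sq ↦ ?_⟩
  -- Horns are deformation retracts, so for them the stability of anodyne maps under pullback along
  -- a fibration is already known.
  have hm : anodyneExtensions (fiberMap τ p Λ[m + 1, k].ι) := by
    obtain ⟨e, he⟩ := isDeformation_horn.{u} k (by lia)
    refine (anodyneExtensions.arrow_mk_iso_iff ?_).1 (he.anodyne_preimage (fiberFst τ p))
    refine Arrow.isoMk ?_ (Iso.refl _) ?_
    · exact
        { hom :=
            { app n := ↾fun x ↦ ⟨(⟨x.1.1.1, x.2⟩, x.1.1.2), x.1.2⟩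
              naturality _ _ _ := rfl }
          inv :=
            { app n := ↾fun x ↦ ⟨⟨(x.1.1.1, x.1.2), x.2⟩, x.1.1.2⟩
              naturality _ _ _ := rfl } }
    · rfl
  have := hm q (by rwa [← HomotopicalAlgebra.fibration_iff])
  obtain ⟨l, h₁, h₂⟩ := exists_lift_pushforward Λ[m + 1, k].ι τ f sq.w inferInstance
  exact ⟨⟨⟨l, h₁, h₂⟩⟩⟩

/-- Since the pushforward is a fibration, every anodyne `i` lifts against it; transposing back
passes from horns to arbitrary anodyne extensions. -/
lemma exists_lift_fiberMap {E B Y S T : SSet.{u}} (p : E ⟶ B) (q : Y ⟶ E) [Fibration p]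
    [Fibration q] {i : S ⟶ T} (hi : anodyneExtensions i) (τ : T ⟶ B)
    (f : (fiberProd (i ≫ τ) p : SSet.{u}) ⟶ Y) (hf : f ≫ q = fiberSnd (i ≫ τ) p) :
    ∃ l : (fiberProd τ p : SSet.{u}) ⟶ Y, fiberMap τ p i ≫ l = f ∧ l ≫ q = fiberSnd τ p := by
  have := fibration_pushforwardπ p q
  obtain ⟨L, h₁, h₂⟩ := exists_lift_of_anodyne hi (pushforwardπ p q)
    (pushforwardUntranspose (i ≫ τ) f hf) τ rfl
  refine ⟨(Subcomplex.eqToIso (by rw [h₂])).hom ≫ pushforwardTranspose L, ?_, ?_⟩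
  · ext n ⟨⟨x, e⟩, h⟩
    have h₃ (y : (pushforward p q).obj n) (hy : L.app n (i.app n x) = y) (h₄ h₅) :
        (L.app n (i.app n x)).sec n (𝟙 n) e h₄ = PushforwardSimplex.sec y n (𝟙 n) e h₅ := by
      subst hy
      rfl
    refine (h₃ _ (congr_app_apply h₁ n x) _ (by
      refine Eq.trans (Eq.symm h) ?_
      exact (ConcreteCategory.congr_hom (B.map_id n) _).symm)).trans ?_
    refine congrArg (f.app n) ?_
    apply Subtype.ext
    exact Prod.ext (ConcreteCategory.congr_hom (S.map_id n) _) rfl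
  · rw [Category.assoc, transpose_comp_q]
    rfl

/-- Anodyne extensions are stable under pullback along fibrations. -/
theorem anodyne_of_isPullback {E' E A B : SSet.{u}} {i' : E' ⟶ E} {q : E' ⟶ A} {p : E ⟶ B}
    {i : A ⟶ B} (sq : IsPullback i' q p i) [Fibration p] (hi : anodyneExtensions i) :
    anodyneExtensions i' := by
  have key : anodyneExtensions (fiberMap (𝟙 B) p i) := by
    intro Y Z r hr
    have : Fibration r := by rwa [HomotopicalAlgebra.fibration_iff]
    refine ⟨fun {f g} sq ↦ ?_⟩
    let δ : E ⟶ (fiberProd (𝟙 B) p : SSet.{u}) := (isPullback_fiberProd (𝟙 B) p).lift p (𝟙 E) (by simp)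
    have hδ : fiberSnd (𝟙 B) p ≫ δ = 𝟙 _ := by
      apply (isPullback_fiberProd (𝟙 B) p).hom_ext
      · rw [Category.assoc, IsPullback.lift_fst, ← fiberProd_condition]
        simp
      · rw [Category.assoc, IsPullback.lift_snd]
        simp
    -- Pulled back along the map to `Z`, `r` becomes a fibration over `E`, and the lifting problem
    -- becomes the extension of a partial section, which transposes along `p`.
    have : Fibration (fiberFst (δ ≫ g) r) := inferInstance
    have h₁ : fiberSnd (i ≫ 𝟙 B) p = fiberMap (𝟙 B) p i ≫ fiberSnd (𝟙 B) p := rfl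
    obtain ⟨l, h₂, h₃⟩ := exists_lift_fiberMap p (fiberFst (δ ≫ g) r) hi (𝟙 B)
      ((isPullback_fiberProd (δ ≫ g) r).lift (fiberSnd (i ≫ 𝟙 B) p) f (by
        rw [h₁, Category.assoc, reassoc_of% hδ, sq.w])) (by simp)
    refine ⟨⟨⟨l ≫ fiberSnd (δ ≫ g) r, ?_, ?_⟩⟩⟩
    · rw [reassoc_of% h₂, IsPullback.lift_snd]
    · rw [Category.assoc, ← fiberProd_condition, reassoc_of% h₃, reassoc_of% hδ]
  have sq' := (isPullback_fiberProd (i ≫ 𝟙 B) p).flip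
  refine (anodyneExtensions.arrow_mk_iso_iff ?_).1 key
  let e₁ := (isPullback_fiberProd (i ≫ 𝟙 B) p).isoIsPullback _ _ (show IsPullback q i' (i ≫ 𝟙 B) p
    by simpa using sq.flip)
  have : IsIso (fiberSnd (𝟙 B) p) := (isPullback_fiberProd (𝟙 B) p).isIso_snd_of_isIso
  refine Arrow.isoMk e₁ (asIso (fiberSnd (𝟙 B) p)) ?_
  exact IsPullback.isoIsPullback_hom_snd ..

end frobenius

/-! ### Extending fibrations along a deformation retract -/

section extension

/-- The property that fibrations over the source of `i` are pulled back from fibrations over the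
target. -/
def ExtendsFibrations {A B : SSet.{u}} (i : A ⟶ B) : Prop :=
  ∀ (E : SSet.{u}) (p : E ⟶ A) [Fibration p], ∃ (E' : SSet.{u}) (p' : E' ⟶ B) (j : E ⟶ E'),
    Fibration p' ∧ IsPullback j p p' i

/-- Extension of the total space of a deformation retract of a restriction. -/
lemma exists_fibration_of_retract {B : SSet.{u}} (C : B.Subcomplex) {W' W E : SSet.{u}}
    (π' : W' ⟶ B) [Fibration π'] {π : W ⟶ C} {j : W ⟶ W'} (sq : IsPullback j π π' C.ι)
    (ε : E ⟶ W) [Mono ε] (ρ : W ⟶ E) (k : W ⊗ Δ[1] ⟶ W)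
    (k₀ : endι 0 W ≫ k = 𝟙 W) (k₁ : endι 1 W ≫ k = ρ ≫ ε)
    (kε : ε ▷ _ ≫ k = fst _ _ ≫ ε) (kπ : k ≫ π = fst _ _ ≫ π) :
    ∃ (E' : SSet.{u}) (p' : E' ⟶ B) (j' : E ⟶ E'),
      Fibration p' ∧ IsPullback j' (ε ≫ π) p' C.ι := by
  classical
  have hj {n : SimplexCategoryᵒᵖ} {v v' : W.obj n} (h : j.app n v = j.app n v') : v = v' :=
    ext_of_isPullback sq _ _ h (Subtype.ext (by
      have h₁ := congr_app_apply sq.w n v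
      have h₂ := congr_app_apply sq.w n v'
      exact h₁.symm.trans ((congrArg (π'.app n) h).trans h₂)))
  -- `E'` is `W'` with its part over `C` cut down to `E`: a simplex is kept when each of its
  -- restrictions that lies in `W` comes from `E`.
  let E' : W'.Subcomplex :=
    { obj n := {w | ∀ m (θ : n ⟶ m) (v : W.obj m), j.app m v = W'.map θ w → ∃ e, ε.app m e = v}
      map θ := by
        intro w hw m θ' v hv
        exact hw m (θ ≫ θ') v (by simpa using hv) }
  have hE' {n : SimplexCategoryᵒᵖ} (e : E.obj n) : j.app n (ε.app n e) ∈ E'.obj n := by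
    intro m θ v hv
    refine ⟨E.map θ e, hj ?_⟩
    rw [NatTrans.naturality_apply, NatTrans.naturality_apply, hv]
  have kεapp {n : SimplexCategoryᵒᵖ} (e : E.obj n) (t : (Δ[1] : SSet.{u}).obj n) :
      k.app n (ε.app n e, t) = ε.app n e := congr_app_apply kε n (e, t)
  -- The homotopy `k` on `W` and the constant one on `E'` agree on the overlap, because `k` is
  -- constant on `E`. Extending their union to `W'` over `B`, from the identity, ends in a
  -- retraction of `W'` onto `E'` over `B`; so `E' ⟶ B` is a retract of the fibration `π'`.
  let U : W'.Subcomplex := Subcomplex.range j ⊔ E'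
  let φ (n : SimplexCategoryᵒᵖ) (x : U.obj n) (t : (Δ[1] : SSet.{u}).obj n) : W'.obj n :=
    if h : ∃ v, j.app n v = x.1 then j.app n (k.app n (h.choose, t)) else x.1
  have φ_j {n : SimplexCategoryᵒᵖ} (x : U.obj n) (v) (t) (hv : j.app n v = x.1) :
      φ n x t = j.app n (k.app n (v, t)) := by
    have h : ∃ v, j.app n v = x.1 := ⟨v, hv⟩
    have : h.choose = v := hj (h.choose_spec.trans hv.symm)
    simp only [φ]
    rw [dif_pos h, this]
  have φ_E' {n : SimplexCategoryᵒᵖ} (x : U.obj n) (t) (hx : x.1 ∈ E'.obj n) :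
      φ n x t = x.1 := by
    by_cases h : ∃ v, j.app n v = x.1
    · obtain ⟨v, hv⟩ := h
      rw [φ_j x v t hv]
      obtain ⟨e, rfl⟩ := hx n (𝟙 n) v (by simpa using hv)
      rw [kεapp, hv]
    · exact dif_neg h
  let Φ : (U : SSet.{u}) ⊗ Δ[1] ⟶ W' :=
    { app n := ↾fun x ↦ φ n x.1 x.2
      naturality n m θ := by
        ext ⟨⟨x, hx⟩, t⟩
        obtain ⟨v, rfl⟩ | hx' := id hx
        · refine (φ_j _ (W.map θ v) _ (NatTrans.naturality_apply j θ v)).trans ?_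
          have h₁ : φ n ⟨j.app n v, hx⟩ t = j.app n (k.app n (v, t)) := φ_j _ v t rfl
          refine Eq.trans ?_ (congrArg (W'.map θ) h₁.symm)
          rw [← NatTrans.naturality_apply j]
          have := NatTrans.naturality_apply k θ (show (W ⊗ Δ[1]).obj n from (v, t))
          exact congrArg (j.app m) this
        · have h₁ : φ n ⟨x, hx⟩ t = x := φ_E' _ t hx'
          refine (φ_E' ⟨W'.map θ x, U.map θ hx⟩ _ (E'.map θ hx')).trans ?_
          exact congrArg (W'.map θ) h₁.symm }
  have hΦ₀ : endι 0 _ ≫ Φ = U.ι := by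
    ext n ⟨x, hx⟩
    obtain ⟨v, rfl⟩ | hx' := id hx
    · refine (φ_j _ v _ rfl).trans (congrArg (j.app n) ?_)
      exact congr_app_apply k₀ n v
    · exact φ_E' _ _ hx'
  have hΦ : Φ ≫ π' = fst _ _ ≫ U.ι ≫ π' := by
    ext n ⟨⟨x, hx⟩, t⟩
    obtain ⟨v, rfl⟩ | hx' := id hx
    · have h₁ : φ n ⟨j.app n v, hx⟩ t = j.app n (k.app n (v, t)) := φ_j _ v t rfl
      refine (congrArg (π'.app n) h₁).trans ?_
      refine (congr_app_apply sq.w n _).trans (Eq.trans ?_ (congr_app_apply sq.w n v).symm)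
      exact congrArg (C.ι.app n) (congr_app_apply kπ n (v, t))
    · exact congrArg (π'.app n) (φ_E' ⟨x, hx⟩ t hx')
  obtain ⟨R, R₀, RU, Rπ⟩ := exists_homotopy_extension U.ι π' 0 (𝟙 W') Φ (fst _ _ ≫ π')
    (by simp [hΦ₀]) (by simp) (by simp [hΦ])
  let r : W' ⟶ W' := endι 1 W' ≫ R
  have hrπ : r ≫ π' = π' := by simp [r, Rπ]
  have hrj {n} (v : W.obj n) : r.app n (j.app n v) = j.app n (ε.app n (ρ.app n v)) := by
    refine (congr_app_apply RU n (⟨j.app n v, Or.inl ⟨v, rfl⟩⟩, cst 1 n)).trans ?_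
    refine (φ_j _ v _ rfl).trans (congrArg (j.app n) ?_)
    exact congr_app_apply k₁ n v
  have hrE' {n} (x : W'.obj n) (hx : x ∈ E'.obj n) : r.app n x = x := by
    refine (congr_app_apply RU n (⟨x, Or.inr hx⟩, cst 1 n)).trans ?_
    exact φ_E' _ _ hx
  have hr {n} (x : W'.obj n) : r.app n x ∈ E'.obj n := by
    intro m θ v hv
    rw [← NatTrans.naturality_apply] at hv
    have h₁ : π'.app m (W'.map θ x) = (π.app m v).1 := by
      refine Eq.trans ?_ (congr_app_apply sq.w m v)
      refine Eq.trans ?_ (congrArg (π'.app m) hv.symm)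
      exact (congr_app_apply hrπ m _).symm
    obtain ⟨v', hv', -⟩ := exists_of_isPullback sq (W'.map θ x) (π.app m v) h₁
    rw [← hv', hrj] at hv
    exact ⟨_, (hj hv).symm⟩
  let r' : W' ⟶ E' := Subcomplex.lift r (by
    rintro n _ ⟨x, rfl⟩
    exact hr x)
  have hr' : E'.ι ≫ r' = 𝟙 _ := by
    ext n ⟨x, hx⟩
    exact Subtype.ext (hrE' x hx)
  let j' : E ⟶ E' := Subcomplex.lift (ε ≫ j) (by
    rintro n _ ⟨e, rfl⟩
    exact hE' e)
  refine ⟨E', E'.ι ≫ π', j', ?_, ?_⟩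
  · rw [modelCategoryQuillen.fibration_iff]
    refine MorphismProperty.of_retract (P := J.rlp) (f := E'.ι ≫ π') (g := π') ?_
      (by rwa [← modelCategoryQuillen.fibration_iff])
    exact
      { i := Arrow.homMk E'.ι (𝟙 _) (by simp)
        r := Arrow.homMk r' (𝟙 _) (by
          change r' ≫ E'.ι ≫ π' = π' ≫ 𝟙 _
          have : r' ≫ E'.ι = r := rfl
          rw [reassoc_of% this, hrπ, Category.comp_id])
        retract := by
          ext : 1
          · exact hr'
          · exact Category.id_comp _ }
  · refine isPullback_of_existsUnique ?_ ?_ ?_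
    · change ε ≫ j ≫ π' = _
      rw [sq.w, Category.assoc]
    · rintro n ⟨x, hx⟩ c hxc
      obtain ⟨v, rfl, rfl⟩ := exists_of_isPullback sq x c hxc
      obtain ⟨e, rfl⟩ := hx n (𝟙 n) v (by simp)
      exact ⟨e, rfl, rfl⟩
    · intro n e e' h h'
      exact (mono_iff_injective (ε.app n)).1 inferInstance (hj (congrArg Subtype.val h))

/-- Trivial fibrations extend along monomorphisms. -/
lemma TrivialFibration.exists_extension {A B W : SSet.{u}} (μ : A ⟶ B) [Mono μ] (ω : W ⟶ A)
    (hω : TrivialFibration ω) : ∃ (W' : SSet.{u}) (ω' : W' ⟶ B) (j : W ⟶ W'),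
      TrivialFibration ω' ∧ IsPullback j ω ω' μ := by
  have hμ {n} {a a' : A.obj n} (h : μ.app n a = μ.app n a') : a = a' :=
    (mono_iff_injective (μ.app n)).1 inferInstance h
  have h₁ : fiberFst (ω ≫ μ) μ ≫ ω = fiberSnd (ω ≫ μ) μ := by
    rw [← cancel_mono μ, Category.assoc, fiberProd_condition]
  -- Pullback preserves monomorphisms, so the pushforward of a trivial fibration is one. As `μ` is a
  -- monomorphism, a simplex in its image has a single preimage, and the pushforward restricts to
  -- `W` over `A`.
  refine ⟨pushforward μ ω, pushforwardπ μ ω,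
    pushforwardUntranspose (ω ≫ μ) (fiberFst (ω ≫ μ) μ) h₁, ?_, ?_⟩
  · refine .of_exists fun {S T} i _ f g h ↦ ?_
    exact exists_lift_pushforward i g f h (hω _ (inferInstanceAs (Mono _)))
  · refine isPullback_of_existsUnique rfl ?_ ?_
    · intro n (x : PushforwardSimplex μ ω n) a hx
      replace hx : x.base = μ.app n a := hx
      have hx' : μ.app n a = B.map (𝟙 n) x.base := by simpa using hx.symm
      refine ⟨x.sec n (𝟙 n) a hx', ?_, x.q_sec _ _ _ _⟩
      refine PushforwardSimplex.ext' ?_ (fun m θ e h h' ↦ ?_)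
      · exact (congrArg (μ.app n) (x.q_sec _ _ _ _)).trans hx.symm
      · refine (x.map_sec n (𝟙 n) a hx' m θ).trans (x.sec_congr (by simp) (hμ ?_) _ _)
        rw [h', hx, NatTrans.naturality_apply]
    · intro n w w' h h'
      have h₂ (w : W.obj n) : W.map (𝟙 n) w = w := by simp
      rw [← h₂ w, ← h₂ w']
      have aux (x y : PushforwardSimplex μ ω n) (hxy : x = y) (a b : A.obj n) (hab : a = b) (h h') :
          x.sec n (𝟙 n) a h = y.sec n (𝟙 n) b h' := by
        subst hxy hab
        rfl
      exact aux _ _ h (ω.app n w) (ω.app n w') h'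
        (ConcreteCategory.congr_hom (B.map_id n) _).symm
        (ConcreteCategory.congr_hom (B.map_id n) _).symm

instance {X Y Z : SSet.{u}} (f : X ⟶ Y) (g : Y ⟶ Z) [Fibration f] [Fibration g] :
    Fibration (f ≫ g) := by
  rw [modelCategoryQuillen.fibration_iff]
  exact MorphismProperty.comp_mem _ _ _ (by rwa [← modelCategoryQuillen.fibration_iff])
    (by rwa [← modelCategoryQuillen.fibration_iff])

lemma exists_anodyne_fibration_factorization {X Y : SSet.{u}} (f : X ⟶ Y) :
    ∃ (Z : SSet.{u}) (i : X ⟶ Z) (p : Z ⟶ Y), anodyneExtensions i ∧ Fibration p ∧ i ≫ p = f := by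
  let d := MorphismProperty.factorizationData J.{u}.rlp.llp J.{u}.rlp f
  exact ⟨d.Z, d.i, d.p, d.hi, by rw [modelCategoryQuillen.fibration_iff]; exact d.hp, d.fac⟩

lemma anodyne_endι (e : Fin 2) (X : SSet.{u}) : anodyneExtensions (endι e X) := by
  refine (anodyneExtensions.arrow_mk_iso_iff ?_).1
    ((anodyneExtensions.horn_ι e).whiskerLeft X)
  refine Arrow.isoMk ?_ (Iso.refl _) ?_
  · exact
      { hom := fst _ _
        inv :=
          { app n := ↾fun x ↦ (x, ⟨cst e n, cst_mem_horn e n⟩)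
            naturality _ _ _ := rfl }
        hom_inv_id := by
          ext n ⟨x, ⟨t, ht⟩⟩
          obtain rfl := mem_horn_one ht
          rfl }
  · ext n ⟨x, ⟨t, ht⟩⟩
    obtain rfl := mem_horn_one ht
    rfl

/-- The obvious candidate, the pullback of `p` along the retraction `r`, restricts over `C` to a
fibration `Y₀` that is only homotopy equivalent to `E`. Both are the ends of a fibration `G` over
the cylinder of `C`, included in it by anodyne maps. A retraction `G ⟶ Y₀` over `C` factors as an
anodyne map to some `W` followed by a trivial fibration, which extends over the pullback along `r`.
Now `E` is a fibrewise deformation retract of `W`, and `exists_fibration_of_retract` cuts the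
extension of `W` down to one of `E`. -/
lemma IsDeformation.extendsFibrations {B : SSet.{u}} {C : B.Subcomplex} {H : B ⊗ Δ[1] ⟶ B}
    {e : Fin 2} (h : IsDeformation C H e) : ExtendsFibrations C.ι := by
  intro E p _
  let r : B ⟶ C := Subcomplex.lift (endι (1 - e) B ≫ H) (by
    rintro n _ ⟨b, rfl⟩
    exact h.mem_of_end b)
  let HC : (C : SSet.{u}) ⊗ Δ[1] ⟶ C := Subcomplex.lift (C.ι ▷ _ ≫ H) (by
    rintro n _ ⟨⟨⟨b, hb⟩, t⟩, rfl⟩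
    exact h.mem_of_mem b t hb)
  have hHC : endι e C ≫ HC = 𝟙 _ := by
    rw [← cancel_mono C.ι]
    change C.ι ≫ endι e B ≫ H = _
    simp [h.endι_H]
  have hHC' : endι (1 - e) C ≫ HC = C.ι ≫ r := rfl
  -- the total space over the cylinder, and its two ends
  let G : SSet.{u} := fiberProd HC p
  let γ : G ⟶ (C : SSet.{u}) ⊗ Δ[1] := fiberFst HC p
  let a : E ⟶ G := (isPullback_fiberProd HC p).lift (p ≫ endι e _) (𝟙 E)
    (by rw [Category.assoc, hHC]; simp)
  have ha₁ : a ≫ γ = p ≫ endι e _ := IsPullback.lift_fst ..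
  have ha₂ : a ≫ fiberSnd HC p = 𝟙 E := IsPullback.lift_snd ..
  have ha : anodyneExtensions a := by
    refine anodyne_of_isPullback (q := p) (p := γ) ?_ (anodyne_endι e C)
    refine IsPullback.of_right ?_ ha₁ (isPullback_fiberProd HC p).flip
    rw [ha₂, hHC]
    exact IsPullback.of_horiz_isIso ⟨by simp⟩
  let Y₀ : SSet.{u} := fiberProd (C.ι ≫ r) p
  let b : Y₀ ⟶ G := fiberMap HC p (endι (1 - e) _)
  have hb₁ : b ≫ γ = fiberFst (C.ι ≫ r) p ≫ endι (1 - e) _ := rfl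
  have hb : anodyneExtensions b := by
    refine anodyne_of_isPullback (q := fiberFst (C.ι ≫ r) p) (p := γ) ?_ (anodyne_endι (1 - e) C)
    exact IsPullback.of_right (isPullback_fiberProd (C.ι ≫ r) p).flip hb₁
      (isPullback_fiberProd HC p).flip
  obtain ⟨σ, hσ₁, hσ₂⟩ := exists_lift_of_anodyne hb (fiberFst (C.ι ≫ r) p) (𝟙 _) (γ ≫ fst _ _)
    (by rw [reassoc_of% hb₁]; simp)
  obtain ⟨W, c, ω, hc, _, hω⟩ := exists_anodyne_fibration_factorization σ
  have hωt : TrivialFibration ω := .of_anodyne_section ω (MorphismProperty.comp_mem _ _ _ hb hc)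
    (by rw [Category.assoc, hω, hσ₁])
  obtain ⟨W', ω', j, hω't, sq⟩ := hωt.exists_extension (fiberMap r p C.ι)
  have := hω't.fibration
  have sq' : IsPullback (fiberMap r p C.ι) (fiberFst (C.ι ≫ r) p) (fiberFst r p) C.ι :=
    (IsPullback.of_right (isPullback_fiberProd (C.ι ≫ r) p).flip rfl
      (isPullback_fiberProd r p).flip)
  have hε : anodyneExtensions (a ≫ c) := MorphismProperty.comp_mem _ _ _ ha hc
  have hp : (a ≫ c) ≫ ω ≫ fiberFst (C.ι ≫ r) p = p := by
    simp only [Category.assoc, reassoc_of% hω, hσ₂, reassoc_of% ha₁]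
    simp
  obtain ⟨ρ, hρ₁, hρ₂⟩ := exists_lift_of_anodyne hε p (𝟙 E) (ω ≫ fiberFst (C.ι ≫ r) p) (by simp [hp])
  have hρ' : a ≫ c ≫ ρ = 𝟙 E := by simpa using hρ₁
  obtain ⟨k, k₀, k₁, k₂, k₃⟩ := exists_homotopy_of_anodyne hε (ω ≫ fiberFst (C.ι ≫ r) p) (𝟙 W)
    (ρ ≫ a ≫ c) (fst _ _ ≫ a ≫ c) (fst _ _ ≫ ω ≫ fiberFst (C.ι ≫ r) p)
    (by simp) (by rw [Category.assoc, reassoc_of% hρ', endι_fst_assoc]) (by simp)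
    (by rw [Category.assoc, hp, hρ₂]; simp) (by simp)
  have := mono_of_anodyne hε
  have := exists_fibration_of_retract C (ω' ≫ fiberFst r p) (sq.paste_vert sq') (a ≫ c) ρ k k₀ k₁ k₂ k₃
  rwa [hp] at this

end extension

/-! ### Extending fibrations along anodyne maps -/

section closure

/-- A horn filling problem lies over one simplex of the base, and can be solved after pullback to
any `B'` through which that simplex factors. -/
lemma fibration_of_locally {E B : SSet.{u}} (p : E ⟶ B)
    (h : ∀ (n : ℕ) (b : Δ[n] ⟶ B), ∃ (B' E' : SSet.{u}) (g : B' ⟶ B) (g' : E' ⟶ E) (p' : E' ⟶ B')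
      (b' : Δ[n] ⟶ B'), Fibration p' ∧ IsPullback g' p' p g ∧ b' ≫ g = b) : Fibration p := by
  rw [modelCategoryQuillen.fibration_iff]
  intro _ _ i hi
  simp only [J, MorphismProperty.iSup_iff] at hi
  obtain ⟨m, ⟨k⟩⟩ := hi
  refine ⟨fun {f τ} sq ↦ ?_⟩
  obtain ⟨B', E', g, g', p', b', _, sq', hb⟩ := h _ τ
  obtain ⟨l, h₁, h₂⟩ := exists_lift_of_anodyne (anodyneExtensions.horn_ι k) p'
    (sq'.lift f (Λ[m + 1, k].ι ≫ b') (by rw [Category.assoc, hb, sq.w])) b' (by simp)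
  refine ⟨⟨⟨l ≫ g', ?_, ?_⟩⟩⟩
  · rw [reassoc_of% h₁, sq'.lift_fst]
  · rw [Category.assoc, sq'.w, reassoc_of% h₂, hb]

/-- Descent for filtered colimits: two simplices with the same image are compared at a common later
stage, where the given square is Cartesian. -/
lemma isPullback_of_isColimit {K : Type*} [Category K] [Quiver.IsThin K] {F G : K ⥤ SSet.{u}}
    (α : G ⟶ F) (hα : ∀ {k l : K} (f : k ⟶ l), IsPullback (G.map f) (α.app k) (α.app l) (F.map f))
    (c : Cocone F) (d : Cocone G) (π : d.pt ⟶ c.pt)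
    (hπ : ∀ k, d.ι.app k ≫ π = α.app k ≫ c.ι.app k)
    (hd : ∀ n (e : d.pt.obj n), ∃ k g, (d.ι.app k).app n g = e)
    (hc' : ∀ n k l (x : (F.obj k).obj n) (y : (F.obj l).obj n),
      (c.ι.app k).app n x = (c.ι.app l).app n y →
        ∃ m f g, (F.map (Y := m) f).app n x = (F.map g).app n y)
    (hd' : ∀ n k l (x : (G.obj k).obj n) (y : (G.obj l).obj n),
      (d.ι.app k).app n x = (d.ι.app l).app n y →
        ∃ m f g, (G.map (Y := m) f).app n x = (G.map g).app n y) (k : K) :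
    IsPullback (d.ι.app k) (α.app k) π (c.ι.app k) := by
  refine isPullback_of_existsUnique (hπ k) ?_ ?_
  · intro n e x hex
    obtain ⟨l, g₀, rfl⟩ := hd n e
    have h₁ := (congr_app_apply (hπ l) n g₀).symm.trans hex
    obtain ⟨m, f, g, h₂⟩ := hc' n _ _ _ _ h₁
    have h₃ : (α.app m).app n ((G.map f).app n g₀) = (F.map g).app n x := by
      rw [← h₂]
      exact congr_app_apply (α.naturality f) n g₀
    obtain ⟨y, h₄, h₅⟩ := exists_of_isPullback (hα g) _ _ h₃
    refine ⟨y, ?_, h₅⟩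
    rw [← d.w g, ← d.w f]
    exact congrArg ((d.ι.app m).app n) h₄
  · intro n y y' h h'
    obtain ⟨m, f, g, h₁⟩ := hd' n _ _ _ _ h
    obtain rfl := Subsingleton.elim f g
    exact ext_of_isPullback (hα f) _ _ h₁ h'

namespace ExtendsFibrations

/-- Pull `p` back along the retraction `A' ⟶ A`, extend it over `B'`, and restrict to `B`. -/
lemma of_retractArrow {A B A' B' : SSet.{u}} {i : A ⟶ B} {i' : A' ⟶ B'} (r : RetractArrow i i')
    (h : ExtendsFibrations i') : ExtendsFibrations i := by
  intro E p _
  obtain ⟨E', p', j, _, sq⟩ := h _ (fiberFst r.r.left p)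
  refine ⟨_, fiberFst r.i.right p', ?_⟩
  have sq₁ : IsPullback (fiberSnd r.r.left p ) (fiberFst r.r.left p) p r.r.left :=
    (isPullback_fiberProd _ _).flip
  let a : E ⟶ fiberProd r.r.left p := sq₁.lift (𝟙 E) (p ≫ r.i.left) (by
    rw [Category.assoc, ← Arrow.comp_left, r.retract]
    simp)
  have sq₂ : IsPullback a p (fiberFst r.r.left p) r.i.left := by
    refine IsPullback.of_right ?_ (sq₁.lift_snd _ _ _) sq₁
    rw [sq₁.lift_fst, ← Arrow.comp_left, r.retract]
    exact IsPullback.of_horiz_isIso ⟨by simp⟩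
  have sq₃ := sq₂.paste_horiz sq
  have w : r.i.left ≫ i' = i ≫ r.i.right := Arrow.w r.i
  have sq₄ : IsPullback (fiberSnd r.i.right p') (fiberFst r.i.right p') p' r.i.right :=
    (isPullback_fiberProd _ _).flip
  let b : E ⟶ fiberProd r.i.right p' := sq₄.lift (a ≫ j) (p ≫ i) (by
    rw [sq₃.w, w, Category.assoc])
  refine ⟨b, inferInstance, IsPullback.of_right ?_ (sq₄.lift_snd _ _ _) sq₄⟩
  rw [sq₄.lift_fst, ← w]
  exact sq₃

lemma of_arrow_iso {A B A' B' : SSet.{u}} {i : A ⟶ B} {i' : A' ⟶ B'} (e : Arrow.mk i ≅ Arrow.mk i')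
    (h : ExtendsFibrations i') : ExtendsFibrations i :=
  of_retractArrow (Retract.ofIso e) h

/-- Extend the pullback of `p` from `A` to `B` and glue it with `p`. Pushouts along monomorphisms
are van Kampen, so the glued object restricts to both pieces; it is a fibration since each simplex
of `B'` comes from `A'` or from `B`. -/
lemma of_isPushout {A B A' B' : SSet.{u}} {f : A ⟶ A'} {i : A ⟶ B} {i' : A' ⟶ B'} {g : B ⟶ B'}
    (sq : IsPushout f i i' g) [Mono i] (h : ExtendsFibrations i) : ExtendsFibrations i' := by
  intro E p _
  obtain ⟨E₁, p₁, j, _, sq₁⟩ := h _ (fiberFst f p)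
  have sq₂ : IsPullback (fiberSnd f p) (fiberFst f p) p f := (isPullback_fiberProd _ _).flip
  have : Mono j := MorphismProperty.of_isPullback (P := MorphismProperty.monomorphisms _) sq₁.flip
    (inferInstanceAs (Mono i))
  let E' := pushout (fiberSnd f p) j
  have po : IsPushout (fiberSnd f p) j (pushout.inl _ _) (pushout.inr _ _) :=
    IsPushout.of_hasPushout (fiberSnd f p) j
  let p' : E' ⟶ B' := po.desc (p ≫ i') (p₁ ≫ g) (by
    rw [← Category.assoc, ← Category.assoc, sq₂.w, sq₁.w, Category.assoc, Category.assoc, sq.w])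
  have hl : pushout.inl (fiberSnd f p) j ≫ p' = p ≫ i' := po.inl_desc ..
  have hr : pushout.inr (fiberSnd f p) j ≫ p' = p₁ ≫ g := po.inr_desc ..
  have vk := (Adhesive.van_kampen' sq) (fiberSnd f p) j (pushout.inl _ _) (pushout.inr _ _)
    (fiberFst f p) p p₁ p' sq₂ sq₁ ⟨hl⟩ ⟨hr⟩ po.toCommSq
  obtain ⟨sq₃, sq₄⟩ := vk.1 po
  refine ⟨E', p', _, ?_, sq₃⟩
  refine fibration_of_locally p' fun n b ↦ ?_
  obtain ⟨x, hx⟩ | ⟨x, hx⟩ := Types.eq_or_eq_of_isPushout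
    (sq.map ((evaluation _ _).obj (op ⦋n⦌))) (yonedaEquiv b)
  · refine ⟨_, _, _, _, _, yonedaEquiv.symm x, ‹Fibration p›, sq₃, ?_⟩
    apply yonedaEquiv.injective
    rw [← hx, yonedaEquiv_comp, Equiv.apply_symm_apply]
    rfl
  · refine ⟨_, _, _, _, _, yonedaEquiv.symm x, ‹Fibration p₁›, sq₄, ?_⟩
    apply yonedaEquiv.injective
    rw [← hx, yonedaEquiv_comp, Equiv.apply_symm_apply]
    rfl

/-- Extend step by step and pass to the colimit. Descent keeps the squares Cartesian, and each
simplex of the base already occurs at a finite stage. -/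
lemma of_sequence (F : ℕ ⥤ SSet.{u}) (c : Cocone F) (hc : IsColimit c)
    (h : ∀ n : ℕ, ExtendsFibrations (F.map (homOfLE n.le_succ))) :
    ExtendsFibrations (c.ι.app 0) := by
  intro E p hp
  let T (n : ℕ) := Σ (E : SSet.{u}), { p : E ⟶ F.obj n // Fibration p }
  have step (n : ℕ) (t : T n) : ∃ (t' : T (n + 1)) (j : t.1 ⟶ t'.1),
      IsPullback j t.2.1 t'.2.1 (F.map (homOfLE n.le_succ)) := by
    have := t.2.2
    obtain ⟨E', p', j, h₁, h₂⟩ := h n _ t.2.1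
    exact ⟨⟨E', p', h₁⟩, j, h₂⟩
  choose next j hj using step
  let t (n : ℕ) : T n := Nat.rec ⟨E, p, hp⟩ (fun n t ↦ next n t) n
  let G : ℕ ⥤ SSet.{u} := Functor.ofSequence (X := fun n ↦ (t n).1) (fun n ↦ j n (t n))
  have hG (n : ℕ) : G.map (homOfLE n.le_succ) = j n (t n) := Functor.ofSequence_map_homOfLE_succ _ _
  let α : G ⟶ F := NatTrans.ofSequence (fun n ↦ (t n).2.1) (fun n ↦ by
    erw [hG]
    exact (hj n (t n)).w)
  have hα (k d : ℕ) : IsPullback (G.map (homOfLE (Nat.le_add_right k d))) (α.app k) (α.app (k + d))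
      (F.map (homOfLE (Nat.le_add_right k d))) := by
    induction d with
    | zero =>
      have (H : ℕ ⥤ SSet.{u}) : H.map (homOfLE (Nat.le_add_right k 0)) = 𝟙 _ := H.map_id k
      rw [this, this]
      exact IsPullback.of_horiz_isIso ⟨by simp⟩
    | succ d hd =>
      have (H : ℕ ⥤ SSet.{u}) : H.map (homOfLE (Nat.le_add_right k (d + 1))) =
          H.map (homOfLE (Nat.le_add_right k d)) ≫ H.map (homOfLE (k + d).le_succ) := by
        rw [← H.map_comp]
        rfl
      rw [this, this]
      refine hd.paste_horiz ?_
      rw [hG]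
      exact hj (k + d) (t (k + d))
  have hα' {k l : ℕ} (f : k ⟶ l) : IsPullback (G.map f) (α.app k) (α.app l) (F.map f) := by
    obtain ⟨d, rfl⟩ := Nat.exists_eq_add_of_le (leOfHom f)
    exact hα k d
  have key (H : ℕ ⥤ SSet.{u}) (c : Cocone H) (hc : IsColimit c) (n k l)
      (x : (H.obj k).obj n) (y : (H.obj l).obj n)
      (hxy : (c.ι.app k).app n x = (c.ι.app l).app n y) :
        ∃ m f g, (H.map (Y := m) f).app n x = (H.map g).app n y :=
    (Types.FilteredColimit.isColimit_eq_iff _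
      (isColimitOfPreserves ((evaluation _ _).obj n) hc)).1 hxy
  have key' (H : ℕ ⥤ SSet.{u}) (c : Cocone H) (hc : IsColimit c) (n)
      (e : c.pt.obj n) : ∃ k g, (c.ι.app k).app n g = e :=
    Types.jointly_surjective _ (isColimitOfPreserves ((evaluation _ _).obj n) hc) e
  let d := colimit.cocone G
  have hd := colimit.isColimit G
  let π : d.pt ⟶ c.pt := hd.desc ((Cocone.precompose α).obj c)
  have sq := isPullback_of_isColimit α hα' c d π (fun k ↦ hd.fac _ k) (key' G d hd) (key F c hc)
    (key G d hd)
  refine ⟨_, π, _, fibration_of_locally π fun n b ↦ ?_, sq 0⟩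
  obtain ⟨k, x, hx⟩ := key' F c hc _ (yonedaEquiv b)
  refine ⟨_, _, _, _, _, yonedaEquiv.symm x, (t k).2.2, sq k, ?_⟩
  apply yonedaEquiv.injective
  rw [← hx, yonedaEquiv_comp, Equiv.apply_symm_apply]

end ExtendsFibrations

/-- The disjoint union of a family of simplicial sets. -/
def sigma {ι : Type u} (X : ι → SSet.{u}) : SSet.{u} where
  obj n := Σ i, (X i).obj n
  map θ := ↾fun x ↦ ⟨x.1, (X x.1).map θ x.2⟩

/-- The inclusion of a member in a disjoint union. -/
def sigmaι {ι : Type u} (X : ι → SSet.{u}) (i : ι) : X i ⟶ sigma X where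
  app n := ↾fun x ↦ ⟨i, x⟩

/-- The universal property of the disjoint union. -/
def sigmaDesc {ι : Type u} {X : ι → SSet.{u}} {Y : SSet.{u}} (f : ∀ i, X i ⟶ Y) : sigma X ⟶ Y where
  app n := ↾fun x ↦ (f x.1).app n x.2
  naturality n m θ := by
    ext x
    exact NatTrans.naturality_apply (f x.1) θ x.2

/-- The disjoint union is a coproduct. -/
def isColimitSigma {ι : Type u} (X : Discrete ι ⥤ SSet.{u}) :
    IsColimit (Cocone.mk (sigma fun i ↦ X.obj ⟨i⟩)
      (Discrete.natTrans fun i ↦ sigmaι (fun i ↦ X.obj ⟨i⟩) i.as)) where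
  desc s := sigmaDesc fun i ↦ s.ι.app ⟨i⟩
  fac s i := rfl
  uniq s m hm := by
    ext n ⟨i, x⟩
    exact congr_app_apply (hm ⟨i⟩) n x

/-- A map to a disjoint union splits into maps to its members, each of which is extended separately.
-/
lemma ExtendsFibrations.sigma {ι : Type u} {A B : ι → SSet.{u}} (f : ∀ i, A i ⟶ B i)
    (hf : ∀ i, ExtendsFibrations (f i)) :
    ExtendsFibrations (sigmaDesc fun i ↦ f i ≫ sigmaι B i) := by
  intro E p _
  choose E' p' j hp' sq using fun i ↦ hf i _ (fiberFst (sigmaι A i) p)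
  let J : E ⟶ SSet.sigma E' :=
    { app n := ↾fun e ↦ ⟨(p.app n e).1, (j _).app n ⟨((p.app n e).2, e), rfl⟩⟩
      naturality n m θ := by
        ext e
        have aux (y : (SSet.sigma A).obj m) (e' : E.obj m) (hy : p.app m e' = y) (z)
            (hz : z = y) (h) :
            (⟨(p.app m e').1, (j _).app m ⟨((p.app m e').2, e'), rfl⟩⟩ : Σ i, (E' i).obj m) =
              ⟨z.1, (j _).app m ⟨(z.2, e'), h⟩⟩ := by
          subst hy hz
          rfl
        have hθ := NatTrans.naturality_apply p θ e
        refine (aux _ (E.map θ e) hθ ((SSet.sigma A).map θ (p.app n e)) rfl hθ.symm).trans ?_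
        exact congrArg (Sigma.mk (p.app n e).1) (NatTrans.naturality_apply (j _) θ
          (show (fiberProd (sigmaι A (p.app n e).1) p).toSSet.obj n from ⟨((p.app n e).2, e), rfl⟩)) }
  have hJ {n} (e : E.obj n) (i) (a : (A i).obj n) (h : ⟨i, a⟩ = p.app n e) :
      J.app n e = ⟨i, (j i).app n ⟨(a, e), h⟩⟩ := by
    have aux (y : (SSet.sigma A).obj n) (hy : y = p.app n e) :
        J.app n e = ⟨y.1, (j y.1).app n ⟨(y.2, e), hy⟩⟩ := by
      subst hy
      rfl
    exact aux ⟨i, a⟩ h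
  let π : SSet.sigma E' ⟶ SSet.sigma B := sigmaDesc fun i ↦ p' i ≫ sigmaι B i
  refine ⟨_, π, J, ?_, ?_⟩
  · refine fibration_of_locally π fun n b ↦ ?_
    obtain ⟨i, x, hx⟩ : ∃ i x, yonedaEquiv b = ⟨i, x⟩ := ⟨_, _, rfl⟩
    refine ⟨B i, E' i, sigmaι B i, sigmaι E' i, p' i, yonedaEquiv.symm x, hp' i, ?_, ?_⟩
    · refine isPullback_of_existsUnique rfl ?_ ?_
      · rintro m ⟨i', e⟩ b h
        obtain ⟨rfl, h⟩ := Sigma.mk.inj h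
        exact ⟨e, rfl, eq_of_heq h⟩
      · intro m e e' h h'
        exact eq_of_heq (Sigma.mk.inj h).2
    · apply yonedaEquiv.injective
      rw [hx, yonedaEquiv_comp, Equiv.apply_symm_apply]
      rfl
  · refine isPullback_of_existsUnique ?_ ?_ ?_
    · ext n e
      exact congrArg (Sigma.mk (p.app n e).1) (congr_app_apply (sq (p.app n e).1).w n
        ⟨((p.app n e).2, e), rfl⟩)
    · rintro n ⟨i, e'⟩ ⟨i', a⟩ h
      obtain ⟨rfl, h⟩ := Sigma.mk.inj h
      obtain ⟨⟨⟨a', e⟩, h'⟩, rfl, rfl⟩ := exists_of_isPullback (sq i) e' a (eq_of_heq h)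
      exact ⟨e, hJ e i a' h', Eq.symm h'⟩
    · intro n e e' h h'
      rw [hJ e _ _ rfl, hJ e' (p.app n e).1 (p.app n e).2 h'] at h
      have := ext_of_isPullback (sq _) _ _ (eq_of_heq (Sigma.mk.inj h).2) rfl
      exact congrArg (fun x ↦ x.1.2) this

/-- Fibrations extend along anodyne extensions. -/
theorem extendsFibrations_of_anodyne {A B : SSet.{u}} {i : A ⟶ B} (hi : anodyneExtensions i) :
    ExtendsFibrations i := by
  -- Anodyne maps are retracts of countable compositions of pushouts of coproducts of horn
  -- inclusions, and each of these operations preserves the extension property.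
  rw [anodyneExtensions_eq_retracts_transfiniteCompositionsOfShape] at hi
  obtain ⟨A', B', i', r, hi'⟩ := hi
  refine ExtendsFibrations.of_retractArrow r ?_
  obtain ⟨h⟩ := hi'
  have h₁ : h.isoBot.inv ≫ h.incl.app 0 = i' := h.fac
  have h₂ := ExtendsFibrations.of_sequence h.F _ h.isColimit (fun n ↦ by
    obtain ⟨X, Y, f, g₁, g₂, hf, sq⟩ := h.map_mem n (not_isMax n)
    have hf' : anodyneExtensions f := by
      rw [anodyneExtensions_eq_llp_rlp]
      exact MorphismProperty.coproducts_le_llp_rlp _ _ hf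
    have := mono_of_anodyne hf'
    refine ExtendsFibrations.of_isPushout sq ?_
    rw [MorphismProperty.coproducts_iff] at hf
    obtain ⟨ι, ⟨X₁, X₂, c₁, c₂, hc₁, hc₂, f, hf⟩⟩ := hf
    let e₁ := hc₁.coconePointUniqueUpToIso (isColimitSigma X₁)
    let e₂ := hc₂.coconePointUniqueUpToIso (isColimitSigma X₂)
    refine ExtendsFibrations.of_arrow_iso ?_ (ExtendsFibrations.sigma (fun i ↦ f.app ⟨i⟩) (fun i ↦ ?_))
    · refine Arrow.isoMk e₁ e₂ (hc₁.hom_ext fun ⟨i⟩ ↦ ?_)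
      have h₁ : c₁.ι.app ⟨i⟩ ≫ e₁.hom = sigmaι (fun i ↦ X₁.obj ⟨i⟩) i := hc₁.fac _ _
      have h₂ : c₂.ι.app ⟨i⟩ ≫ e₂.hom = sigmaι (fun i ↦ X₂.obj ⟨i⟩) i := hc₂.fac _ _
      have h₃ : c₁.ι.app ⟨i⟩ ≫ hc₁.desc (Cocone.mk _ (f ≫ c₂.ι)) =
        f.app ⟨i⟩ ≫ c₂.ι.app ⟨i⟩ := hc₁.fac _ _
      rw [reassoc_of% h₁]
      change _ = c₁.ι.app ⟨i⟩ ≫ hc₁.desc (Cocone.mk _ (f ≫ c₂.ι)) ≫ e₂.hom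
      rw [reassoc_of% h₃, h₂]
      rfl
    · have := hf ⟨i⟩
      simp only [modelCategoryQuillen.J, MorphismProperty.iSup_iff] at this
      obtain ⟨m, hm⟩ := this
      generalize f.app ⟨i⟩ = φ at hm
      generalize X₁.obj ⟨i⟩ = Y₁ at φ hm
      generalize X₂.obj ⟨i⟩ = Y₂ at φ hm
      obtain ⟨k⟩ := hm
      obtain ⟨e, he⟩ := isDeformation_horn.{u} k (by lia)
      exact he.extendsFibrations)
  rw [← h₁]
  refine ExtendsFibrations.of_arrow_iso (Arrow.isoMk h.isoBot.symm (Iso.refl _) ?_) h₂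
  simp

end closure

/-! ### Acyclic fibrations and homotopy Cartesian squares -/

section proper

lemma exists_anodyne_kanComplex (B : SSet.{u}) :
    ∃ (B' : SSet.{u}) (i : B ⟶ B'), anodyneExtensions i ∧ KanComplex B' := by
  obtain ⟨B', i, p, hi, hp, -⟩ := exists_anodyne_fibration_factorization (terminal.from B)
  refine ⟨B', i, hi, ?_⟩
  obtain rfl := Subsingleton.elim p (terminal.from B')
  exact hp

lemma kanComplex_of_fibration {X Y : SSet.{u}} (p : X ⟶ Y) [Fibration p] [h : KanComplex Y] :
    KanComplex X := by
  have : Fibration (terminal.from Y) := h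
  have h' : Fibration (p ≫ terminal.from Y) := inferInstance
  obtain h'' := Subsingleton.elim (p ≫ terminal.from Y) (terminal.from X)
  rw [h''] at h'
  exact h'

/-- A fibration which is a weak equivalence is a trivial fibration. -/
theorem TrivialFibration.of_isWeakEquivalence {E B : SSet.{u}} (p : E ⟶ B) [Fibration p]
    (hp : IsWeakEquivalence p) : TrivialFibration p := by
  obtain ⟨B', i, hi, _⟩ := exists_anodyne_kanComplex B
  -- `j` is anodyne as the pullback of `i` along the fibration `p'`. By two-out-of-three `p'` is a
  -- weak equivalence between Kan complexes, hence a trivial fibration, and so is its pullback `p`.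
  obtain ⟨E', p', j, _, sq⟩ := extendsFibrations_of_anodyne hi _ p
  have hj : anodyneExtensions j := anodyne_of_isPullback sq hi
  have := kanComplex_of_fibration p'
  have hp' : IsWeakEquivalence p' := (isWeakEquivalence_of_anodyne hj).of_precomp (by
    rw [sq.w]
    exact hp.comp (isWeakEquivalence_of_anodyne hi))
  exact TrivialFibration.of_isPullback sq.flip (.of_kanComplex p' hp')

/-- The comparison map to the homotopy pullback does not depend on the factorization. -/
lemma isWeakEquivalence_lift_iff {X₁ X₂ X₃ X₄ E P E' P' : SSet.{u}} {f₁₂ : X₁ ⟶ X₂}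
    {f₁₃ : X₁ ⟶ X₃} {f₂₄ : X₂ ⟶ X₄} {f₃₄ : X₃ ⟶ X₄} {i : X₂ ⟶ E} {p : E ⟶ X₄} [Fibration p]
    {i' : X₂ ⟶ E'} {p' : E' ⟶ X₄} [Fibration p'] (hi : IsWeakEquivalence i)
    (hi' : IsWeakEquivalence i') (fac : i ≫ p = f₂₄) (fac' : i' ≫ p' = f₂₄)
    {a : P ⟶ X₃} {b : P ⟶ E} (sq : IsPullback a b f₃₄ p)
    {a' : P' ⟶ X₃} {b' : P' ⟶ E'} (sq' : IsPullback a' b' f₃₄ p')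
    {l : X₁ ⟶ P} (hl : l ≫ a = f₁₃) (hl' : l ≫ b = f₁₂ ≫ i)
    {l' : X₁ ⟶ P'} (hla : l' ≫ a' = f₁₃) (hlb : l' ≫ b' = f₁₂ ≫ i') :
    IsWeakEquivalence l → IsWeakEquivalence l' := by
  intro h
  -- A third factorization through `W` dominates both: `W` maps to `E` and to `E'` by trivial
  -- fibrations over `X₄`. Pulled back to `X₃`, these give trivial fibrations `Q ⟶ P` and `Q ⟶ P'`,
  -- so all comparison maps are weak equivalences together.
  have sqE := isPullback_fiberProd p p'
  obtain ⟨W, j, q, hj, _, hjq⟩ := exists_anodyne_fibration_factorization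
    (sqE.lift i i' (by rw [fac, fac']))
  have : Fibration (fiberSnd p p') := fibration_of_isPullback sqE.flip
  have hq₁ : TrivialFibration (q ≫ fiberFst p p') := .of_isWeakEquivalence _
    ((isWeakEquivalence_of_anodyne hj).of_precomp (by
      rw [reassoc_of% hjq, sqE.lift_fst]; exact hi))
  have hq₂ : TrivialFibration (q ≫ fiberSnd p p') := .of_isWeakEquivalence _
    ((isWeakEquivalence_of_anodyne hj).of_precomp (by
      rw [reassoc_of% hjq, sqE.lift_snd]; exact hi'))
  obtain ⟨w, hw, hw'⟩ : ∃ w, w = (q ≫ fiberFst p p') ≫ p ∧ w = (q ≫ fiberSnd p p') ≫ p' :=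
    ⟨_, rfl, by simp [sqE.w]⟩
  obtain ⟨Q, x, y, sqW⟩ : ∃ (Q : SSet.{u}) (x : Q ⟶ X₃) (y : Q ⟶ W), IsPullback x y f₃₄ w :=
    ⟨_, _, _, isPullback_fiberProd f₃₄ w⟩
  let t : Q ⟶ P := sq.lift x (y ≫ q ≫ fiberFst p p')
    (by rw [sqW.w, hw]; simp)
  let t' : Q ⟶ P' := sq'.lift x (y ≫ q ≫ fiberSnd p p')
    (by rw [sqW.w, hw']; simp)
  have ht : TrivialFibration t := by
    refine TrivialFibration.of_isPullback (b := y) (f := b) ?_ hq₁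
    exact (IsPullback.of_bot (by rw [sq.lift_fst, ← hw]; exact sqW.flip) (by simp [t]) sq.flip).flip
  have ht' : TrivialFibration t' := by
    refine TrivialFibration.of_isPullback (b := y) (f := b') ?_ hq₂
    exact (IsPullback.of_bot (by rw [sq'.lift_fst, ← hw']; exact sqW.flip) (by simp [t'])
      sq'.flip).flip
  let m : X₁ ⟶ Q := sqW.lift f₁₃ (f₁₂ ≫ j) (by
    rw [hw, Category.assoc, Category.assoc, reassoc_of% hjq, sqE.lift_fst_assoc, ← hl,
      Category.assoc, sq.w, reassoc_of% hl'])
  have hm : m ≫ t = l := by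
    apply sq.hom_ext
    · simp [m, t, hl]
    · simp [m, t, hl', reassoc_of% hjq]
  have hm' : m ≫ t' = l' := by
    apply sq'.hom_ext
    · simp [m, t', hla]
    · simp [m, t', hlb, reassoc_of% hjq]
  rw [← hm']
  refine IsWeakEquivalence.comp ?_ ht'.isWeakEquivalence
  exact ht.isWeakEquivalence.of_postcomp (by rwa [hm])

lemma IsHomotopyCartesian.isWeakEquivalence_lift {sq : Square SSet.{u}}
    (h : IsHomotopyCartesian sq) {E P : SSet.{u}} {i : sq.X₂ ⟶ E} {p : E ⟶ sq.X₄} [Fibration p]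
    (hi : IsWeakEquivalence i) (fac : i ≫ p = sq.f₂₄)
    {a : P ⟶ sq.X₃} {b : P ⟶ E} (sq' : IsPullback a b sq.f₃₄ p)
    {l : sq.X₁ ⟶ P} (hla : l ≫ a = sq.f₁₃) (hlb : l ≫ b = sq.f₁₂ ≫ i) :
    IsWeakEquivalence l := by
  obtain ⟨E₀, i₀, p₀, fac₀, hi₀, hp₀, h⟩ := h
  exact isWeakEquivalence_lift_iff hi₀ hi fac₀ fac (IsPullback.of_hasPullback _ _) sq'
    (pullback.lift_fst _ _ _) (pullback.lift_snd _ _ _) hla hlb h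

lemma IsHomotopyCartesian.mk' {sq : Square SSet.{u}} {E P : SSet.{u}} {i : sq.X₂ ⟶ E}
    {p : E ⟶ sq.X₄} (hp : Fibration p)
    (hi : IsWeakEquivalence i) (fac : i ≫ p = sq.f₂₄)
    {a : P ⟶ sq.X₃} {b : P ⟶ E} (sq' : IsPullback a b sq.f₃₄ p)
    {l : sq.X₁ ⟶ P} (hla : l ≫ a = sq.f₁₃) (hlb : l ≫ b = sq.f₁₂ ≫ i)
    (hl : IsWeakEquivalence l) : IsHomotopyCartesian sq :=
  ⟨E, i, p, fac, hi, hp, isWeakEquivalence_lift_iff hi hi fac fac sq'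
    (IsPullback.of_hasPullback _ _) hla hlb (pullback.lift_fst _ _ _) (pullback.lift_snd _ _ _) hl⟩

lemma IsHomotopyCartesian.of_iso {sq sq' : Square SSet.{u}} (h : IsHomotopyCartesian sq)
    (e : sq ≅ sq') : IsHomotopyCartesian sq' := by
  obtain ⟨E, i, p, fac, hi, hp, h⟩ := h
  have e₁ : e.inv.τ₁ ≫ e.hom.τ₁ = 𝟙 _ := (Square.evaluation₁.mapIso e).inv_hom_id
  have e₂ : e.inv.τ₂ ≫ e.hom.τ₂ = 𝟙 _ := (Square.evaluation₂.mapIso e).inv_hom_id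
  have i₁ : IsIso e.inv.τ₁ := (Square.evaluation₁.mapIso e.symm).isIso_hom
  have i₂ : IsIso e.inv.τ₂ := (Square.evaluation₂.mapIso e.symm).isIso_hom
  have : Fibration (p ≫ e.hom.τ₄) := by
    rw [modelCategoryQuillen.fibration_iff]
    refine (MorphismProperty.arrow_mk_iso_iff J.{u}.rlp ?_).1
      ((modelCategoryQuillen.fibration_iff p).1 hp)
    exact Arrow.isoMk (Iso.refl _) (Square.evaluation₄.mapIso e) (by simp)
  have sq₂ : IsPullback (pullback.fst sq.f₃₄ p ≫ e.hom.τ₃) (pullback.snd sq.f₃₄ p) sq'.f₃₄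
      (p ≫ e.hom.τ₄) :=
    IsPullback.of_iso (IsPullback.of_hasPullback sq.f₃₄ p) (Iso.refl _)
      (Square.evaluation₃.mapIso e) (Iso.refl _) (Square.evaluation₄.mapIso e)
      (by simp) (by simp) (by simpa using e.hom.comm₃₄) (by simp)
  refine .mk' (i := e.inv.τ₂ ≫ i) this ((isWeakEquivalence_of_isIso _).comp hi) ?_ sq₂
    (l := e.inv.τ₁ ≫ pullback.lift sq.f₁₃ (sq.f₁₂ ≫ i) (by rw [Category.assoc, fac, sq.fac]))
    ?_ ?_ ((isWeakEquivalence_of_isIso _).comp h)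
  · rw [Category.assoc, reassoc_of% fac, e.hom.comm₂₄, reassoc_of% e₂]
  · rw [Category.assoc, pullback.lift_fst_assoc, e.hom.comm₁₃, reassoc_of% e₁]
  · rw [Category.assoc, pullback.lift_snd, ← e.inv.comm₁₂_assoc]

end proper

/-- Bisimplicial sets. -/
abbrev Bisimplicial := SimplexCategoryᵒᵖ × SimplexCategoryᵒᵖ ⥤ Type u

/-! ### External products of simplicial sets and their right adjoints -/

namespace Bisimplicial

/-- The `n`-th row `q ↦ X(n, q)`. -/
abbrev row (n : SimplexCategoryᵒᵖ) : Bisimplicial.{u} ⥤ SSet.{u} :=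
  (Functor.whiskeringLeft _ _ _).obj (Prod.sectR n SimplexCategoryᵒᵖ)

/-- The `q`-th column `n ↦ X(n, q)`. -/
abbrev col (q : SimplexCategoryᵒᵖ) : Bisimplicial.{u} ⥤ SSet.{u} :=
  (Functor.whiskeringLeft _ _ _).obj (Prod.sectL SimplexCategoryᵒᵖ q)

/-- The diagonal `n ↦ X(n, n)`. -/
abbrev diagonal : Bisimplicial.{u} ⥤ SSet.{u} :=
  (Functor.whiskeringLeft _ _ _).obj (Functor.diag _)

lemma map_map (X : Bisimplicial.{u}) {p q r : SimplexCategoryᵒᵖ × SimplexCategoryᵒᵖ} (f : p ⟶ q)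
    (g : q ⟶ r) (x : X.obj p) : X.map g (X.map f x) = X.map (f ≫ g) x :=
  (congrArg (fun t ↦ t x) (congrArg ConcreteCategory.hom (X.map_comp f g))).symm

lemma map_id_apply (X : Bisimplicial.{u}) {p : SimplexCategoryᵒᵖ × SimplexCategoryᵒᵖ}
    (x : X.obj p) : X.map (𝟙 p) x = x :=
  (congrArg (fun t ↦ t x) (congrArg ConcreteCategory.hom (X.map_id p)))

/-- The external product `(m, n) ↦ K_m × L_n`. -/
def box : SSet.{u} ⥤ SSet.{u} ⥤ Bisimplicial.{u} where
  obj K :=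
    { obj L :=
        { obj p := K.obj p.1 × L.obj p.2
          map f := ↾fun x ↦ (K.map f.1 x.1, L.map f.2 x.2) }
      map g := { app p := ↾fun x ↦ (x.1, g.app _ x.2)
                 naturality _ _ f := by
                  ext x
                  · rfl
                  · exact NatTrans.naturality_apply g f.2 x.2 } }
  map f := { app L := { app p := ↾fun x ↦ (f.app _ x.1, x.2)
                        naturality _ _ g := by
                          ext x
                          · exact NatTrans.naturality_apply f g.1 x.1
                          · rfl } }

/-- The element of `K ⊠ L` given by elements of `K` and `L`. -/
abbrev pair {K L : SSet.{u}} {m q : SimplexCategoryᵒᵖ} (k : K.obj m) (l : L.obj q) :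
    ((box.obj K).obj L).obj (m, q) := (k, l)

/-- The right adjoint of `K ⊠ -`: the simplicial set `q ↦ Hom(K, X(-, q))`. -/
def power : SSet.{u}ᵒᵖ ⥤ Bisimplicial.{u} ⥤ SSet.{u} :=
  coyoneda ⋙ Functor.whiskeringRight _ _ _ ⋙
    (Functor.whiskeringLeft _ _ _).obj (Functor.curry ⋙ flipFunctor _ _ _)

/-- The right adjoint of `- ⊠ L`: the simplicial set `n ↦ Hom(L, X(n, -))`. -/
def rowPower : SSet.{u}ᵒᵖ ⥤ Bisimplicial.{u} ⥤ SSet.{u} :=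
  coyoneda ⋙ Functor.whiskeringRight _ _ _ ⋙ (Functor.whiskeringLeft _ _ _).obj Functor.curry

/-- The bijection between maps `K ⊠ L ⟶ X` and `L ⟶ X^K`. -/
def powerEquiv (K L : SSet.{u}) (X : Bisimplicial.{u}) :
    ((box.obj K).obj L ⟶ X) ≃ (L ⟶ (power.obj (op K)).obj X) where
  toFun f :=
    { app q := ↾fun l ↦
        { app n := ↾fun k ↦ f.app (n, q) (pair k l)
          naturality m n g := by
            ext k
            have := NatTrans.naturality_apply f (show (m, q) ⟶ (n, q) from (g, 𝟙 q)) (pair k l)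
            refine Eq.trans ?_ this
            exact congrArg (fun t ↦ f.app (n, q) (pair (K.map g k) t)) (by simp) }
      naturality q r g := by
        ext l
        refine NatTrans.ext (funext fun n ↦ ?_)
        ext k
        have := NatTrans.naturality_apply f (show (n, q) ⟶ (n, r) from (𝟙 n, g)) (pair k l)
        refine Eq.trans ?_ this
        exact congrArg (fun t ↦ f.app (n, r) (pair t (L.map g l))) (by simp) }
  invFun f :=
    { app p := ↾fun x ↦ (f.app p.2 x.2 : K ⟶ _).app p.1 x.1
      naturality p q g := by
        ext ⟨k, l⟩
        have h₁ := congr_app_apply (NatTrans.naturality_apply f g.2 l) q.1 (K.map g.1 k)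
        have h₂ := NatTrans.naturality_apply (f.app p.2 l : K ⟶ _) g.1 k
        refine h₁.trans ?_
        refine (congrArg (X.map (show (q.1, p.2) ⟶ q from (𝟙 _, g.2))) h₂).trans ?_
        refine (X.map_map _ _ _).trans ?_
        exact congrArg (fun (t : p ⟶ q) ↦ X.map t ((f.app p.2 l : K ⟶ _).app p.1 k))
          (Prod.ext (Category.comp_id _) (Category.id_comp _)) }
  left_inv f := rfl
  right_inv f := rfl

/-- The bijection between maps `K ⊠ L ⟶ X` and `K ⟶ Hom(L, X)`. -/
def rowPowerEquiv (K L : SSet.{u}) (X : Bisimplicial.{u}) :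
    ((box.obj K).obj L ⟶ X) ≃ (K ⟶ (rowPower.obj (op L)).obj X) where
  toFun f :=
    { app n := ↾fun k ↦
        { app q := ↾fun l ↦ f.app (n, q) (pair k l)
          naturality q r g := by
            ext l
            have := NatTrans.naturality_apply f (show (n, q) ⟶ (n, r) from (𝟙 n, g)) (pair k l)
            refine Eq.trans ?_ this
            exact congrArg (fun t ↦ f.app (n, r) (pair t (L.map g l))) (by simp) }
      naturality m n g := by
        ext k
        refine NatTrans.ext (funext fun q ↦ ?_)
        ext l
        have := NatTrans.naturality_apply f (show (m, q) ⟶ (n, q) from (g, 𝟙 q)) (pair k l)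
        refine Eq.trans ?_ this
        exact congrArg (fun t ↦ f.app (n, q) (pair (K.map g k) t)) (by simp) }
  invFun f :=
    { app p := ↾fun x ↦ (f.app p.1 x.1 : L ⟶ _).app p.2 x.2
      naturality p q g := by
        ext ⟨k, l⟩
        have h₁ := congr_app_apply (NatTrans.naturality_apply f g.1 k) q.2 (L.map g.2 l)
        have h₂ := NatTrans.naturality_apply (f.app p.1 k : L ⟶ _) g.2 l
        refine h₁.trans ?_
        refine (congrArg (X.map (show (p.1, q.2) ⟶ q from (g.1, 𝟙 _))) h₂).trans ?_
        refine (X.map_map _ _ _).trans ?_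
        exact congrArg (fun (t : p ⟶ q) ↦ X.map t ((f.app p.1 k : L ⟶ _).app p.2 l))
          (Prod.ext (Category.id_comp _) (Category.comp_id _)) }
  left_inv f := rfl
  right_inv f := rfl

/-- The parametrized adjunction between `K ⊠ -` and `X ↦ X^K`. -/
def powerAdjunction : box.{u} ⊣₂ power.{u} :=
  ParametrizedAdjunction.mk' (fun K ↦ Adjunction.mkOfHomEquiv
    { homEquiv L X := powerEquiv K L X
      homEquiv_naturality_left_symm := fun _ _ ↦ rfl
      homEquiv_naturality_right := fun _ _ ↦ rfl }) (fun _ _ _ _ ↦ by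
        simp only [Adjunction.mkOfHomEquiv_homEquiv]; rfl)

/-- The parametrized adjunction between `- ⊠ L` and `X ↦ Hom(L, X)`. -/
def rowPowerAdjunction : box.{u}.flip ⊣₂ rowPower.{u} :=
  ParametrizedAdjunction.mk' (fun L ↦ Adjunction.mkOfHomEquiv
    { homEquiv K X := rowPowerEquiv K L X
      homEquiv_naturality_left_symm := fun _ _ ↦ rfl
      homEquiv_naturality_right := fun _ _ ↦ rfl }) (fun _ _ _ _ ↦ by
        simp only [Adjunction.mkOfHomEquiv_homEquiv]; rfl)

end Bisimplicial
-- Reedy fibrations and Reedy factorizations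
namespace Bisimplicial

/-- The image of a Leibniz pushout under a functor which preserves pushouts. -/
def _root_.CategoryTheory.Functor.PushoutObjObj.mapFunctor {C₁ C₂ C₃ C₄ : Type*} [Category C₁]
    [Category C₂] [Category C₃] [Category C₄] {F : C₁ ⥤ C₂ ⥤ C₃} {X₁ Y₁ : C₁} {f₁ : X₁ ⟶ Y₁}
    {X₂ Y₂ : C₂} {f₂ : X₂ ⟶ Y₂} (sq : F.PushoutObjObj f₁ f₂) (G : C₃ ⥤ C₄)
    [PreservesColimitsOfShape WalkingSpan G] :
    (F ⋙ (Functor.whiskeringRight _ _ _).obj G).PushoutObjObj f₁ f₂ where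
  pt := G.obj sq.pt
  inl := G.map sq.inl
  inr := G.map sq.inr
  isPushout := sq.isPushout.map G
  ι := G.map sq.ι
  inl_ι := by simp [← Functor.map_comp]
  inr_ι := by simp [← Functor.map_comp]

/-- The constant simplicial set on `K_n`. -/
abbrev constEval (n : SimplexCategoryᵒᵖ) : SSet.{u} ⥤ SSet.{u} :=
  (evaluation _ _).obj n ⋙ Functor.const _

/-- Rows of external products are copowers. -/
def rowBoxIso (n : SimplexCategoryᵒᵖ) :
    box.{u} ⋙ (Functor.whiskeringRight _ _ _).obj (row n) ≅ constEval n ⋙ curriedTensor _ :=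
  NatIso.ofComponents (fun K ↦ NatIso.ofComponents (fun L ↦ NatIso.ofComponents
    (fun q ↦ Iso.refl _) (fun g ↦ by
      ext x
      refine Prod.ext ?_ rfl
      exact congrArg (fun t ↦ t x.1) (congrArg ConcreteCategory.hom (K.map_id n)))))

/-- The diagonal of an external product is the product. -/
def diagonalBoxIso :
    box.{u} ⋙ (Functor.whiskeringRight _ _ _).obj diagonal ≅ curriedTensor _ :=
  NatIso.ofComponents (fun K ↦ NatIso.ofComponents (fun L ↦ NatIso.ofComponents
    (fun q ↦ Iso.refl _)))

variable {K K' L L' : SSet.{u}} {i : K ⟶ K'} {j : L ⟶ L'}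

/-- The `n`-th row of `K ⊠ L` is the product of the constant simplicial set on `K_n` with `L`, so
the row of a pushout-product is a pushout-product of a monomorphism with `j`. -/
lemma anodyne_row_pushoutObjObj (sq : box.PushoutObjObj i j) [Mono i] (hj : anodyneExtensions j)
    (n : SimplexCategoryᵒᵖ) : anodyneExtensions ((row n).map sq.ι) := by
  let sq' := (sq.mapFunctor (row n)).ofNatIso (rowBoxIso n)
  have : Mono ((constEval n).map i) := by
    rw [NatTrans.mono_iff_mono_app]
    intro q
    exact (NatTrans.mono_iff_mono_app i).1 inferInstance n
  let sq'' : (curriedTensor SSet.{u}).PushoutObjObj ((constEval n).map i) j :=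
    { pt := sq'.pt, inl := sq'.inl, inr := sq'.inr, isPushout := sq'.isPushout, ι := sq'.ι
      inl_ι := sq'.inl_ι, inr_ι := sq'.inr_ι }
  have h := anodyneExtensions_pushoutObjObjι sq'' hj
  exact (anodyneExtensions.cancel_right_of_respectsIso _ (((rowBoxIso n).hom.app _).app _)).1 h

lemma anodyne_diagonal_pushoutObjObj (sq : box.PushoutObjObj i j) [Mono i]
    (hj : anodyneExtensions j) : anodyneExtensions (diagonal.map sq.ι) :=
  (anodyneExtensions.cancel_right_of_respectsIso _ ((diagonalBoxIso.hom.app _).app _)).1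
    (anodyneExtensions_pushoutObjObjι ((sq.mapFunctor diagonal).ofNatIso diagonalBoxIso) hj)

instance : HasPushouts Bisimplicial.{u} := inferInstance

/-- The chosen pushout-product for external products. -/
noncomputable def boxPushout {K K' L L' : SSet.{u}} (i : K ⟶ K') (j : L ⟶ L') : box.PushoutObjObj i j :=
  have : HasPushout ((box.map i).app L) ((box.obj K).map j) :=
    inferInstanceAs (HasColimit (span (C := Bisimplicial.{u}) _ _))
  .ofHasPushout _ _ _

/-- The generating trivial cofibrations of the Reedy model structure on bisimplicial sets. -/
def reedyJ : MorphismProperty Bisimplicial.{u} :=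
  .ofHoms (fun x : Σ (_ : ℕ) (q : ℕ), Fin (q + 2) ↦
    (boxPushout ∂Δ[x.1].ι Λ[x.2.1 + 1, x.2.2].ι).ι)

/-- Reedy fibrations of bisimplicial sets. -/
abbrev ReedyFibration {X Y : Bisimplicial.{u}} (p : X ⟶ Y) : Prop := reedyJ.rlp p

/-- Maps with the left lifting property with respect to Reedy fibrations. -/
abbrev reedyAnodyne : MorphismProperty Bisimplicial.{u} := reedyJ.rlp.llp

/-- For a left adjoint it is enough to test the generators: the right adjoint then takes fibrations
to Reedy fibrations. -/
lemma le_inverseImage_of_adjunction (G : Bisimplicial.{u} ⥤ SSet.{u}) {R} (adj : G ⊣ R)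
    (h : ∀ ⦃X Y : Bisimplicial.{u}⦄ (f : X ⟶ Y), reedyJ f → anodyneExtensions (G.map f)) :
    ∀ ⦃X Y : Bisimplicial.{u}⦄ (f : X ⟶ Y), reedyAnodyne f → anodyneExtensions (G.map f) := by
  intro X Y f hf E B p hp
  rw [adj.hasLiftingProperty_iff]
  refine hf _ fun A A' g hg ↦ ?_
  rw [← adj.hasLiftingProperty_iff]
  exact h g hg p hp

lemma anodyne_row {X Y : Bisimplicial.{u}} {f : X ⟶ Y} (hf : reedyAnodyne f)
    (n : SimplexCategoryᵒᵖ) : anodyneExtensions ((row n).map f) := by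
  refine le_inverseImage_of_adjunction _ (Functor.ranAdjunction _ (Type u)) ?_ f hf
  rintro _ _ _ ⟨x⟩
  exact anodyne_row_pushoutObjObj _ (.horn_ι _) n

lemma anodyne_diagonal {X Y : Bisimplicial.{u}} {f : X ⟶ Y} (hf : reedyAnodyne f) :
    anodyneExtensions (diagonal.map f) := by
  refine le_inverseImage_of_adjunction _ (Functor.ranAdjunction _ (Type u)) ?_ f hf
  rintro _ _ _ ⟨x⟩
  exact anodyne_diagonal_pushoutObjObj _ (.horn_ι _)

variable {X Y : Bisimplicial.{u}} {p : X ⟶ Y}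

/-- The definition only tests boundary inclusions against horns. For a fixed horn, the adjunction in
the first variable passes to all monomorphisms `i`; for a fixed `i`, the one in the second variable
then passes to all anodyne `j`. -/
lemma ReedyFibration.hasLiftingProperty (hp : ReedyFibration p) (sq : box.PushoutObjObj i j)
    [Mono i] (hj : anodyneExtensions j) : HasLiftingProperty sq.ι p := by
  let sq₁ := Functor.PullbackObjObj.ofHasPullback power i p
  rw [powerAdjunction.hasLiftingProperty_iff sq sq₁]
  refine hj _ ?_
  intro _ _ _ h
  simp only [J, MorphismProperty.iSup_iff] at h
  obtain ⟨m, ⟨k⟩⟩ := h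
  let sq₂ := boxPushout i Λ[m + 1, k].ι
  refine (powerAdjunction.hasLiftingProperty_iff sq₂ sq₁).1 ?_
  let sq₃ := Functor.PullbackObjObj.ofHasPullback rowPower Λ[m + 1, k].ι p
  refine (rowPowerAdjunction.hasLiftingProperty_iff sq₂.flip sq₃).2 ?_
  suffices (MorphismProperty.monomorphisms _).rlp sq₃.π from this _ inferInstance
  rw [rlp_monomorphisms]
  rintro _ _ _ ⟨n⟩
  let sq₄ := boxPushout ∂Δ[n].ι Λ[m + 1, k].ι
  refine (rowPowerAdjunction.hasLiftingProperty_iff sq₄.flip sq₃).1 ?_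
  exact hp _ ⟨(⟨n, m, k⟩ : Σ (_ : ℕ) (q : ℕ), Fin (q + 2))⟩

lemma ReedyFibration.fibration_power (hp : ReedyFibration p) [Mono i]
    (sq : power.PullbackObjObj i p) : Fibration sq.π := by
  rw [fibration_iff]
  intro _ _ f h
  rw [← powerAdjunction.hasLiftingProperty_iff (boxPushout i f)]
  exact hp.hasLiftingProperty _ (MorphismProperty.le_llp_rlp _ _ h)

attribute [local instance] Cardinal.fact_isRegular_aleph0
  Cardinal.orderBotAleph0OrdToType

instance isFinitelyPresentable_box (K L : SSet.{u}) [IsFinitelyPresentable.{u} K]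
    [IsFinitelyPresentable.{u} L] : IsFinitelyPresentable.{u} ((box.obj K).obj L) := by
  have : (power.{u}.obj (op K)).IsCardinalAccessible Cardinal.aleph0.{u} := by
    constructor
    intro J _ _
    have := preservesColimitsOfShape_of_isCardinalPresentable K Cardinal.aleph0.{u} J
    refine preservesColimitsOfShape_of_evaluation _ _ fun q ↦ ?_
    exact inferInstanceAs (PreservesColimitsOfShape J (col q ⋙ coyoneda.obj (op K)))
  exact Adjunction.isCardinalPresentable_leftAdjoint_obj (powerAdjunction.adj K) _ L

lemma isFinitelyPresentable_of_isPushout {A B C D : Bisimplicial.{u}} {f : A ⟶ B} {g : A ⟶ C}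
    {h : B ⟶ D} {k : C ⟶ D} (sq : IsPushout f g h k) (_ : IsFinitelyPresentable.{u} A)
    (_ : IsFinitelyPresentable.{u} B) (_ : IsFinitelyPresentable.{u} C) :
    IsFinitelyPresentable.{u} D := by
  have (k : WalkingSpan) : IsCardinalPresentable ((span f g).obj k) Cardinal.aleph0.{u} := by
    obtain (_ | _ | _) := k <;> assumption
  exact isCardinalPresentable_of_isColimit' _ sq.isColimit _ (hasCardinalLT_of_finite _ _ le_rfl)

instance : MorphismProperty.IsSmall.{u} reedyJ.{u} :=
  MorphismProperty.isSmall_ofHoms.{u} _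

instance : MorphismProperty.IsCardinalForSmallObjectArgument reedyJ.{u} Cardinal.aleph0.{u} where
  preservesColimit {A B X Y} i hi f hf := by
    have : IsFinitelyPresentable.{u} A := by
      obtain ⟨x⟩ := hi
      exact isFinitelyPresentable_of_isPushout
        (boxPushout ∂Δ[x.1].ι Λ[x.2.1 + 1, x.2.2].ι).isPushout (isFinitelyPresentable_box _ _)
        (isFinitelyPresentable_box _ _) (isFinitelyPresentable_box _ _)
    infer_instance

instance : MorphismProperty.HasSmallObjectArgument.{u} reedyJ.{u} :=
  ⟨.aleph0, inferInstance, inferInstance, inferInstance⟩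

lemma exists_reedy_factorization (f : X ⟶ Y) :
    ∃ (Z : Bisimplicial.{u}) (g : X ⟶ Z) (h : Z ⟶ Y),
      reedyAnodyne g ∧ ReedyFibration h ∧ g ≫ h = f :=
  let d := MorphismProperty.factorizationData reedyAnodyne reedyJ.rlp f
  ⟨d.Z, d.i, d.p, d.hi, d.hp, d.fac⟩

end Bisimplicial
-- Unions of faces of a simplex
section faceUnion

variable {n : ℕ}

/-- The union of the faces of the standard simplex opposite to the vertices in `S`. -/
@[simps]
def faceUnion (S : Set (Fin (n + 1))) : (Δ[n] : SSet.{u}).Subcomplex where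
  obj m := {x | ∃ i ∈ S, ∀ j, stdSimplex.asOrderHom x j ≠ i}
  map := by
    rintro _ _ f x ⟨i, hi, hx⟩
    exact ⟨i, hi, fun j ↦ hx _⟩

lemma faceUnion_mono {S T : Set (Fin (n + 1))} (h : S ⊆ T) :
    (faceUnion S : (Δ[n] : SSet.{u}).Subcomplex) ≤ faceUnion T := by
  rintro m x ⟨i, hi, hx⟩
  exact ⟨i, h hi, hx⟩

lemma faceUnion_union (S T : Set (Fin (n + 1))) :
    (faceUnion (S ∪ T) : (Δ[n] : SSet.{u}).Subcomplex) = faceUnion S ⊔ faceUnion T := by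
  ext m x
  constructor
  · rintro ⟨i, hi | hi, hx⟩
    exacts [Or.inl ⟨i, hi, hx⟩, Or.inr ⟨i, hi, hx⟩]
  · rintro (⟨i, hi, hx⟩ | ⟨i, hi, hx⟩)
    exacts [⟨i, Or.inl hi, hx⟩, ⟨i, Or.inr hi, hx⟩]

lemma faceUnion_compl (k : Fin (n + 1)) :
    faceUnion {k}ᶜ = (Λ[n, k] : (Δ[n] : SSet.{u}).Subcomplex) := by
  ext m x
  constructor
  · rintro ⟨i, hi, hx⟩ h
    have : i ∈ (Set.univ : Set (Fin (n + 1))) := trivial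
    erw [← h] at this
    obtain ⟨j, hj⟩ | hj := this
    · exact hx j hj
    · exact hi hj
  · intro hx
    by_contra h
    simp only [faceUnion_obj, Set.mem_ofPred_eq, not_exists, not_and, not_forall] at h
    apply hx
    ext i
    simp only [Set.union_singleton, Set.mem_insert_iff, Set.mem_range, Set.mem_univ, iff_true]
    by_cases hi : i = k
    · exact Or.inl hi
    · obtain ⟨j, hj⟩ := h i hi
      exact Or.inr ⟨j, not_not.1 hj⟩

lemma faceUnion_univ : faceUnion Set.univ = (∂Δ[n] : (Δ[n] : SSet.{u}).Subcomplex) := by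
  ext m x
  constructor
  · rintro ⟨i, -, hx⟩ h
    obtain ⟨j, hj⟩ := h i
    exact hx j hj
  · intro hx
    by_contra h
    simp only [faceUnion_obj, Set.mem_ofPred_eq, not_exists, not_and, not_forall] at h
    apply hx
    intro i
    obtain ⟨j, hj⟩ := h i trivial
    exact ⟨j, not_not.1 hj⟩

lemma isDeformation_faceUnion {S : Set (Fin (n + 1))} {e : Fin 2}
    (F : Fin (n + 1) × Fin (1 + 1) →o Fin (n + 1)) (h₁ : ∀ x, F (x, e) = x)
    (h₂ : ∀ i ∈ S, ∀ x t, x ≠ i → F (x, t) ≠ i) {i : Fin (n + 1)} (hi : i ∈ S)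
    (h₃ : ∀ x, F (x, 1 - e) ≠ i) :
    IsDeformation (faceUnion S : (Δ[n] : SSet.{u}).Subcomplex) (stdSimplexProdMap F) e where
  endι_H := by
    ext m x
    apply stdSimplex.ext
    intro j
    exact h₁ _
  mem_of_mem := by
    rintro m b t ⟨i, hi, hb⟩
    exact ⟨i, hi, fun j ↦ h₂ i hi _ _ (hb j)⟩
  mem_of_end b := ⟨i, hi, fun j ↦ h₃ _⟩

/-- Push every vertex towards the omitted `k`, upwards by `max x k` if `i < k` and downwards by `min
x k` if `i > k`. The result misses `i`, and since vertices only stay or move to `k ∉ S`, each face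
in the union is preserved. -/
lemma anodyne_faceUnion {S : Set (Fin (n + 1))} {i k : Fin (n + 1)} (hi : i ∈ S) (hk : k ∉ S) :
    anodyneExtensions (faceUnion S : (Δ[n] : SSet.{u}).Subcomplex).ι := by
  have hik : i ≠ k := by rintro rfl; exact hk hi
  obtain h | h := lt_or_gt_of_ne hik
  · let F : Fin (n + 1) × Fin (1 + 1) →o Fin (n + 1) :=
      { toFun x := if x.2 = 0 then x.1 else max x.1 k
        monotone' := by
          rintro ⟨a, s⟩ ⟨b, t⟩ ⟨hab, hst⟩
          dsimp at hab hst ⊢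
          split_ifs <;> grind }
    refine (isDeformation_faceUnion (e := 0) F (fun _ ↦ rfl) (fun j hj x t hx ↦ ?_) hi
      (fun x ↦ ?_)).anodyne_preimage (𝟙 _)
    · change ite _ _ _ ≠ j
      split_ifs <;> grind
    · change max x k ≠ i
      grind
  · let F : Fin (n + 1) × Fin (1 + 1) →o Fin (n + 1) :=
      { toFun x := if x.2 = 0 then min x.1 k else x.1
        monotone' := by
          rintro ⟨a, s⟩ ⟨b, t⟩ ⟨hab, hst⟩
          dsimp at hab hst ⊢
          split_ifs <;> grind }
    refine (isDeformation_faceUnion (e := 1) F (fun _ ↦ rfl)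
      (fun j hj x t hx ↦ ?_) hi (fun x ↦ ?_)).anodyne_preimage (𝟙 _)
    · change ite _ _ _ ≠ j
      split_ifs <;> grind
    · change min x k ≠ i
      grind

/-- A retraction of `[n]` onto a nonempty subset. -/
lemma exists_monotone_retraction (V : Finset (Fin (n + 1))) (hV : V.Nonempty) :
    ∃ τ : Fin (n + 1) →o Fin (n + 1), (∀ x, τ x ∈ V) ∧ ∀ x ∈ V, τ x = x := by
  -- `x` goes to the greatest element of `V` below it. If there is none, the empty supremum is `0`
  -- and the outer `max` gives the least element of `V`.
  refine ⟨⟨fun x ↦ max ((V.filter (· ≤ x)).sup id) (V.min' hV), ?_⟩, fun x ↦ ?_, fun x hx ↦ ?_⟩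
  · intro x y hxy
    refine max_le_max (Finset.sup_mono fun z hz ↦ ?_) le_rfl
    grind
  · change max _ _ ∈ V
    obtain h | h := (V.filter (· ≤ x)).eq_empty_or_nonempty
    · rw [h, Finset.sup_empty]
      simpa using V.min'_mem hV
    · obtain ⟨z, hz, hz'⟩ := Finset.exists_mem_eq_sup _ h id
      rw [hz', max_eq_left (V.min'_le _ (by grind))]
      grind
  · change max _ _ = x
    rw [max_eq_left ((V.min'_le x hx).trans (Finset.le_sup (f := id) (by grind)))]
    refine le_antisymm (Finset.sup_le fun z hz ↦ ?_) (Finset.le_sup (f := id) (by grind))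
    grind

end faceUnion

namespace Bisimplicial

/-! ### Lifting along inclusions of subfunctors and rectangles -/

section liftsAlong

variable {D : Type*} [Category* D] {U E B : D ⥤ Type u} (p : E ⟶ B)

/-- The inclusion of the subfunctor `S` in `T` has the left lifting property with respect to `p`:
partial lifts defined on `S` extend to `T`. -/
def LiftsAlong (S T : Subfunctor U) : Prop :=
  ∀ (f : S.toFunctor ⟶ E) (g : T.toFunctor ⟶ B),
    (∀ d (x : U.obj d) (hx : x ∈ S.obj d) (hx' : x ∈ T.obj d),
      p.app d (f.app d ⟨x, hx⟩) = g.app d ⟨x, hx'⟩) →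
    ∃ l : T.toFunctor ⟶ E, l ≫ p = g ∧
      ∀ d (x : U.obj d) (hx : x ∈ S.obj d) (hx' : x ∈ T.obj d), l.app d ⟨x, hx'⟩ = f.app d ⟨x, hx⟩

variable {p}

lemma LiftsAlong.trans {R S T : Subfunctor U} (h : LiftsAlong p R S) (h' : LiftsAlong p S T)
    (hRS : R ≤ S) (hST : S ≤ T) : LiftsAlong p R T := by
  intro f g hfg
  obtain ⟨l, hl, hl'⟩ := h f (Subfunctor.homOfLe hST ≫ g)
    (fun d x hx hx' ↦ hfg d x hx (hST d hx'))
  obtain ⟨l', h₁, h₂⟩ := h' l g (fun d x hx hx' ↦ congrArg (fun t ↦ t.app d ⟨x, hx⟩) hl)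
  exact ⟨l', h₁, fun d x hx hx' ↦ (h₂ d x (hRS d hx) hx').trans (hl' d x hx _)⟩

lemma mem_sup {S T : Subfunctor U} {d : D} {x : U.obj d} :
    x ∈ (S ⊔ T).obj d ↔ x ∈ S.obj d ∨ x ∈ T.obj d := Iff.rfl

lemma mem_inf {S T : Subfunctor U} {d : D} {x : U.obj d} :
    x ∈ (S ⊓ T).obj d ↔ x ∈ S.obj d ∧ x ∈ T.obj d := Iff.rfl

lemma mem_biSup {ι : Type*} {A : Finset ι} {S : ι → Subfunctor U} {d : D} {x : U.obj d} :
    x ∈ (⨆ i ∈ A, S i).obj d ↔ ∃ i ∈ A, x ∈ (S i).obj d := by simp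

open Classical in
/-- Maps out of two subfunctors which agree on the intersection glue. -/
lemma exists_glue {S T : Subfunctor U} (f : S.toFunctor ⟶ E) (g : T.toFunctor ⟶ E)
    (h : ∀ d (x : U.obj d) (hx : x ∈ S.obj d) (hx' : x ∈ T.obj d),
      f.app d ⟨x, hx⟩ = g.app d ⟨x, hx'⟩) :
    ∃ l : (S ⊔ T).toFunctor ⟶ E,
      (∀ d (x : U.obj d) (hx : x ∈ S.obj d) hx', l.app d ⟨x, hx'⟩ = f.app d ⟨x, hx⟩) ∧
      (∀ d (x : U.obj d) (hx : x ∈ T.obj d) hx', l.app d ⟨x, hx'⟩ = g.app d ⟨x, hx⟩) := by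
  have key (d) (x : (S ⊔ T).toFunctor.obj d) (hx : x.1 ∉ S.obj d) : x.1 ∈ T.obj d :=
    x.2.resolve_left hx
  let φ (d) (x : (S ⊔ T).toFunctor.obj d) : E.obj d :=
    if hx : x.1 ∈ S.obj d then f.app d ⟨x.1, hx⟩ else g.app d ⟨x.1, key d x hx⟩
  have h₁ (d) (x : (S ⊔ T).toFunctor.obj d) (hx : x.1 ∈ S.obj d) : φ d x = f.app d ⟨x.1, hx⟩ :=
    dif_pos hx
  have h₂ (d) (x : (S ⊔ T).toFunctor.obj d) (hx : x.1 ∈ T.obj d) : φ d x = g.app d ⟨x.1, hx⟩ := by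
    by_cases hx' : x.1 ∈ S.obj d
    · exact (h₁ d x hx').trans (h d _ hx' hx)
    · exact dif_neg hx'
  refine ⟨{ app d := ↾φ d, naturality d d' θ := ?_ }, fun d x hx hx' ↦ h₁ d _ hx,
    fun d x hx hx' ↦ h₂ d _ hx⟩
  ext x
  change φ d' _ = E.map θ (φ d x)
  by_cases hx : x.1 ∈ S.obj d
  · rw [h₁ d x hx]
    exact (h₁ d' ((S ⊔ T).toFunctor.map θ x) (S.map θ hx)).trans
      (NatTrans.naturality_apply f θ ⟨x.1, hx⟩)
  · rw [h₂ d x (key d x hx)]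
    exact (h₂ d' ((S ⊔ T).toFunctor.map θ x) (T.map θ (key d x hx))).trans
      (NatTrans.naturality_apply g θ ⟨x.1, key d x hx⟩)

/-- The inclusion of `S` in `S ⊔ T` is a pushout of that of `S ⊓ T` in `T`. -/
lemma LiftsAlong.sup {R S T : Subfunctor U} (h : LiftsAlong p (S ⊓ T) T) (hR : S ⊔ T = R) :
    LiftsAlong p S R := by
  subst hR
  intro f g hfg
  obtain ⟨l, h₁, h₂⟩ := h (Subfunctor.homOfLe inf_le_left ≫ f)
    (Subfunctor.homOfLe le_sup_right ≫ g) (fun d x hx hx' ↦ hfg d x hx.1 (Or.inr hx'))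
  obtain ⟨k, h₃, h₄⟩ := exists_glue f l (fun d x hx hx' ↦ (h₂ d x ⟨hx, hx'⟩ hx').symm)
  refine ⟨k, ?_, fun d x hx hx' ↦ h₃ d x hx hx'⟩
  ext d ⟨x, hx⟩
  obtain hx' | hx' := hx
  · exact (congrArg (p.app d) (h₃ d x hx' _)).trans (hfg d x hx' _)
  · exact (congrArg (p.app d) (h₄ d x hx' _)).trans (congrArg (fun t ↦ t.app d ⟨x, hx'⟩) h₁)

end liftsAlong

section rect

variable {K L : SSet.{u}}

/-- The external product of two subcomplexes. -/
def rect (X : K.Subcomplex) (Y : L.Subcomplex) : Subfunctor ((box.obj K).obj L) where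
  obj d := {x | x.1 ∈ X.obj d.1 ∧ x.2 ∈ Y.obj d.2}
  map f _ hx := ⟨X.map f.1 hx.1, Y.map f.2 hx.2⟩

lemma mem_rect {X : K.Subcomplex} {Y : L.Subcomplex} {d} {z : ((box.obj K).obj L).obj d} :
    z ∈ (rect X Y).obj d ↔ z.1 ∈ X.obj d.1 ∧ z.2 ∈ Y.obj d.2 := Iff.rfl

lemma rect_mono {X X' : K.Subcomplex} {Y Y' : L.Subcomplex} (h : X ≤ X') (h' : Y ≤ Y') :
    rect X Y ≤ rect X' Y' := fun _ _ hx ↦ ⟨h _ hx.1, h' _ hx.2⟩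

variable {E B : Bisimplicial.{u}} (p : E ⟶ B)

/-- The pushout-products of the inclusion `Y₀ ⊆ Y` with all inclusions have the left lifting
property with respect to `p`. -/
def IsGood (Y₀ Y : L.Subcomplex) : Prop :=
  ∀ (K : SSet.{u}) (X₀ X : K.Subcomplex), X₀ ≤ X →
    LiftsAlong p (rect X₀ Y ⊔ rect X Y₀) (rect X Y)

variable {p}

lemma liftsAlong_of_hasLiftingProperty {X₀ X : K.Subcomplex} {Y₀ Y : L.Subcomplex} (hX : X₀ ≤ X)
    (hY : Y₀ ≤ Y) (sq : box.PushoutObjObj (Subcomplex.homOfLE hX) (Subcomplex.homOfLE hY))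
    (h : HasLiftingProperty sq.ι p) : LiftsAlong p (rect X₀ Y ⊔ rect X Y₀) (rect X Y) := by
  intro f g hfg
  let a : (box.obj (X : SSet.{u})).obj (Y₀ : SSet.{u}) ⟶ (rect X₀ Y ⊔ rect X Y₀).toFunctor :=
    { app d := ↾fun x ↦ ⟨(x.1.1, x.2.1), Or.inr ⟨x.1.2, x.2.2⟩⟩ }
  let b : (box.obj (X₀ : SSet.{u})).obj (Y : SSet.{u}) ⟶ (rect X₀ Y ⊔ rect X Y₀).toFunctor :=
    { app d := ↾fun x ↦ ⟨(x.1.1, x.2.1), Or.inl ⟨x.1.2, x.2.2⟩⟩ }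
  let c : (box.obj (X : SSet.{u})).obj (Y : SSet.{u}) ⟶ (rect X Y).toFunctor :=
    { app d := ↾fun x ↦ ⟨(x.1.1, x.2.1), x.1.2, x.2.2⟩ }
  let c' : (rect X Y).toFunctor ⟶ (box.obj (X : SSet.{u})).obj (Y : SSet.{u}) :=
    { app d := ↾fun x ↦ (⟨x.1.1, x.2.1⟩, ⟨x.1.2, x.2.2⟩) }
  obtain ⟨δ, ha, hb⟩ : ∃ δ, sq.inl ≫ δ = a ∧ sq.inr ≫ δ = b :=
    have hw : (box.map (Subcomplex.homOfLE hX)).app _ ≫ a =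
      (box.obj _).map (Subcomplex.homOfLE hY) ≫ b := rfl
    ⟨sq.isPushout.desc a b hw, IsPushout.inl_desc .., IsPushout.inr_desc ..⟩
  have hw : δ ≫ f ≫ p = sq.ι ≫ c ≫ g := by
    apply sq.isPushout.hom_ext
    · rw [reassoc_of% ha, sq.inl_ι_assoc]
      ext d x
      exact hfg _ _ _ _
    · rw [reassoc_of% hb, sq.inr_ι_assoc]
      ext d x
      exact hfg _ _ _ _
  obtain ⟨l, h₁, h₂⟩ : ∃ l, sq.ι ≫ l = δ ≫ f ∧ l ≫ p = c ≫ g :=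
    let S : CommSq (δ ≫ f) sq.ι p (c ≫ g) := ⟨by simpa using hw⟩
    ⟨S.lift, S.fac_left, S.fac_right⟩
  refine ⟨c' ≫ l, by rw [Category.assoc, h₂]; rfl, ?_⟩
  rintro d x (⟨hx, hx'⟩ | ⟨hx, hx'⟩) h₃
  · have := sq.inr ≫= h₁
    rw [sq.inr_ι_assoc, reassoc_of% hb] at this
    exact ConcreteCategory.congr_hom (congr_app this d) (show ((box.obj (X₀ : SSet.{u})).obj (Y : SSet.{u})).obj d from
      (⟨x.1, hx⟩, ⟨x.2, hx'⟩))
  · have := sq.inl ≫= h₁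
    rw [sq.inl_ι_assoc, reassoc_of% ha] at this
    exact ConcreteCategory.congr_hom (congr_app this d) (show ((box.obj (X : SSet.{u})).obj (Y₀ : SSet.{u})).obj d from
      (⟨x.1, hx⟩, ⟨x.2, hx'⟩))

lemma ReedyFibration.isGood (hp : ReedyFibration p) {Y₀ Y : L.Subcomplex} (hY : Y₀ ≤ Y)
    (h : anodyneExtensions (Subcomplex.homOfLE hY)) : IsGood p Y₀ Y := fun _ _ _ hX ↦
  liftsAlong_of_hasLiftingProperty hX hY (boxPushout _ _) (hp.hasLiftingProperty _ h)

/-- The key combinatorial lemma: extension of lifts from a union of rectangles. -/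
lemma liftsAlong_iSup_rect {ι : Type*} (A : Finset ι) {Y : L.Subcomplex} (Y' : ι → L.Subcomplex)
    (hY' : ∀ i, Y' i ≤ Y) (Y₀ : L.Subcomplex) (hY₀ : Y₀ ≤ Y)
    (h : ∀ T ⊆ A, IsGood p (Y₀ ⊔ ⨆ i ∈ T, Y' i) Y) (X Z : K.Subcomplex) (X' : ι → K.Subcomplex)
    (hX' : ∀ i, X' i ≤ X) (hZ : Z ≤ X) :
    LiftsAlong p ((⨆ i ∈ A, rect (X' i) (Y' i)) ⊔ rect X Y₀ ⊔ rect Z Y) (rect X Y) := by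
  classical
  induction A using Finset.induction_on generalizing Y₀ X Z X' with
  | empty =>
    have := h ∅ le_rfl K Z X hZ
    simp only [Finset.notMem_empty, iSup_false, iSup_bot, sup_bot_eq, bot_sup_eq] at this ⊢
    rwa [sup_comm]
  | insert a A ha IH =>
    -- The rectangle `X' a ⊠ Y` is filled first: within it, the known part is an instance with one
    -- index less, `Y' a` having been absorbed in `Y₀`. Afterwards `X' a` is absorbed in `Z`.
    have h₁ := IH (Y₀ ⊔ Y' a) (sup_le hY₀ (hY' a)) (fun T hT ↦ by
      have := h (insert a T) (Finset.insert_subset_insert a hT)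
      rw [Finset.iSup_insert, ← sup_assoc] at this
      exact this) (X' a) (Z ⊓ X' a) (fun i ↦ X' i ⊓ X' a) (fun _ ↦ inf_le_right) inf_le_right
    have h₂ := IH Y₀ hY₀ (fun T hT ↦ h T (hT.trans (Finset.subset_insert a A))) X (Z ⊔ X' a) X' hX'
      (sup_le hZ (hX' a))
    refine LiftsAlong.trans (LiftsAlong.sup (T := rect (X' a) Y) ?_ rfl) ?_
      le_sup_left ?_
    · convert h₁ using 1
      ext d z
      simp only [Finset.iSup_insert, mem_inf, mem_sup, mem_biSup, mem_rect]
      have := @hY₀ d.2 z.2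
      have := fun i ↦ @hY' i d.2 z.2
      have := @hX' a d.1 z.1
      generalize z.1 = x at *
      generalize z.2 = y at *
      clear IH h h₁ h₂
      grind
    · convert h₂ using 1
      ext d z
      simp only [Finset.iSup_insert, mem_sup, mem_biSup, mem_rect]
      have := @hY' a d.2 z.2
      generalize z.1 = x at *
      generalize z.2 = y at *
      clear IH h h₁ h₂
      grind
    · refine sup_le (sup_le (sup_le ?_ (rect_mono le_rfl hY₀)) (rect_mono hZ le_rfl))
        (rect_mono (hX' a) le_rfl)
      exact iSup₂_le fun i _ ↦ rect_mono (hX' i) (hY' i)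

end rect

end Bisimplicial
namespace Bisimplicial

/-! ### Transposing lifting problems for the diagonal -/

section diagonal

variable {n : ℕ} {E B : Bisimplicial.{u}} {p : E ⟶ B} (S : Finset (Fin (n + 1)))

/-- The endomorphism `γ` of `[n]` lies in the union of the faces in `S` and fixes both simplices. -/
structure Fixes {d : SimplexCategoryᵒᵖ × SimplexCategoryᵒᵖ}
    (z : ((box.obj Δ[n]).obj Δ[n] : Bisimplicial.{u}).obj d) (γ : ⦋n⦌ ⟶ ⦋n⦌) : Prop where
  mem : stdSimplex.objEquiv.symm γ ∈
    (faceUnion S : (Δ[n] : SSet.{u}).Subcomplex).obj (op ⦋n⦌)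
  fst : stdSimplex.objEquiv z.1 ≫ γ = stdSimplex.objEquiv z.1
  snd : stdSimplex.objEquiv z.2 ≫ γ = stdSimplex.objEquiv z.2

variable {S}

/-- Take for `τ` a retraction of `[n]` onto the set of vertices used by either simplex. Any
endomorphism fixing both simplices fixes these vertices, so it is absorbed by `τ`. -/
lemma exists_fixes {d : SimplexCategoryᵒᵖ × SimplexCategoryᵒᵖ}
    (z : ((box.obj Δ[n]).obj Δ[n] : Bisimplicial.{u}).obj d)
    (hz : z ∈ (⨆ i ∈ S, rect (faceUnion {i}) (faceUnion {i})).obj d) :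
    ∃ τ, Fixes S z τ ∧ ∀ γ, Fixes S z γ → τ ≫ γ = τ := by
  classical
  obtain ⟨i, hi, ⟨_, rfl, h₁⟩, ⟨_, h₃, h₂⟩⟩ := mem_biSup.1 hz
  obtain rfl := h₃
  let V := Finset.univ.image (stdSimplex.asOrderHom z.1) ∪
    Finset.univ.image (stdSimplex.asOrderHom z.2)
  obtain ⟨τ, h₄, h₅⟩ := exists_monotone_retraction V ⟨_, Finset.mem_union_left _
    (Finset.mem_image_of_mem (stdSimplex.asOrderHom z.1) (Finset.mem_univ 0))⟩
  refine ⟨SimplexCategory.Hom.mk τ, ⟨⟨_, hi, fun j hj ↦ ?_⟩, ?_, ?_⟩, fun γ hγ ↦ ?_⟩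
  · replace hj : τ j = _ := hj
    have := h₄ j
    rw [hj, Finset.mem_union, Finset.mem_image, Finset.mem_image] at this
    obtain ⟨a, -, ha⟩ | ⟨a, -, ha⟩ := this
    exacts [h₁ a ha, h₂ a ha]
  · ext j : 3
    exact h₅ _ (Finset.mem_union_left _ (Finset.mem_image_of_mem
      (stdSimplex.asOrderHom z.1) (Finset.mem_univ j)))
  · ext j : 3
    exact h₅ _ (Finset.mem_union_right _ (Finset.mem_image_of_mem
      (stdSimplex.asOrderHom z.2) (Finset.mem_univ j)))
  · ext j : 3
    change γ.toOrderHom (τ j) = τ j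
    have := h₄ j
    rw [Finset.mem_union, Finset.mem_image, Finset.mem_image] at this
    obtain ⟨a, -, ha⟩ | ⟨a, -, ha⟩ := this
    · rw [← ha]
      exact congrArg (fun t : d.1.unop ⟶ ⦋n⦌ ↦ t.toOrderHom a) hγ.fst
    · rw [← ha]
      exact congrArg (fun t : d.2.unop ⟶ ⦋n⦌ ↦ t.toOrderHom a) hγ.snd

/-- The morphism of bisimplices corresponding to a pair of simplices of `Δ[n]`. -/
abbrev classify {d : SimplexCategoryᵒᵖ × SimplexCategoryᵒᵖ}
    (z : ((box.obj Δ[n]).obj Δ[n] : Bisimplicial.{u}).obj d) :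
    (op ⦋n⦌, op ⦋n⦌) ⟶ d :=
  Prod.mkHom (stdSimplex.objEquiv z.1).op (stdSimplex.objEquiv z.2).op

/-- The value at the pair `z` of the extension of a map to the diagonal. -/
def extendDiagonal (f : (faceUnion (S : Set (Fin (n + 1))) : (Δ[n] : SSet.{u}).Subcomplex).toSSet ⟶ diagonal.obj E)
    {d : SimplexCategoryᵒᵖ × SimplexCategoryᵒᵖ}
    {z : ((box.obj Δ[n]).obj Δ[n] : Bisimplicial.{u}).obj d} {γ : ⦋n⦌ ⟶ ⦋n⦌} (h : Fixes S z γ) :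
    E.obj d :=
  E.map (classify z) (f.app _ ⟨_, h.mem⟩)

/-- Naturality of `f` along `τ` relates its values at `γ` and at `τ ≫ γ = τ`, and both simplices of
`z` are fixed by `τ`. The extension is therefore independent of the chosen endomorphism. -/
lemma extendDiagonal_eq (f : (faceUnion (S : Set (Fin (n + 1))) : (Δ[n] : SSet.{u}).Subcomplex).toSSet ⟶ diagonal.obj E)
    {d : SimplexCategoryᵒᵖ × SimplexCategoryᵒᵖ}
    {z : ((box.obj Δ[n]).obj Δ[n] : Bisimplicial.{u}).obj d} {γ τ : ⦋n⦌ ⟶ ⦋n⦌} (h : Fixes S z γ)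
    (h' : Fixes S z τ) (h'' : τ ≫ γ = τ) : extendDiagonal f h' = extendDiagonal f h := by
  have h₁ := NatTrans.naturality_apply f τ.op ⟨_, h.mem⟩
  have h₂ : (faceUnion (S : Set (Fin (n + 1))) : (Δ[n] : SSet.{u}).Subcomplex).toSSet.map τ.op ⟨_, h.mem⟩ = ⟨_, h'.mem⟩ :=
    Subtype.ext (congrArg stdSimplex.objEquiv.symm h'')
  rw [h₂] at h₁
  refine (congrArg _ h₁).trans ((E.map_map _ _ _).trans ?_)
  refine congrArg (fun t : (op ⦋n⦌, op ⦋n⦌) ⟶ d ↦ E.map t (f.app _ ⟨_, h.mem⟩)) ?_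
  exact Prod.ext (congrArg Quiver.Hom.op h'.fst) (congrArg Quiver.Hom.op h'.snd)

/-- The left adjoint of the diagonal takes `Δ[n]` to `Δ[n] ⊠ Δ[n]` and a union of faces to the union
of the external squares of these faces. The transposition is explicit: a bisimplex of the latter
union is restricted from the diagonal simplex given by its endomorphism `τ`. -/
lemma hasLiftingProperty_diagonal
    (h : LiftsAlong p (⨆ i ∈ S, rect (faceUnion {i} : (Δ[n] : SSet.{u}).Subcomplex)
      (faceUnion {i} : (Δ[n] : SSet.{u}).Subcomplex)) (rect ⊤ ⊤)) :
    HasLiftingProperty (faceUnion S : (Δ[n] : SSet.{u}).Subcomplex).ι (diagonal.map p) where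
  sq_hasLift {f g} sq := by
    choose τ hτ hτ' using @exists_fixes.{u} n S
    let F : (⨆ i ∈ S, rect (faceUnion {i} : (Δ[n] : SSet.{u}).Subcomplex)
        (faceUnion {i} : (Δ[n] : SSet.{u}).Subcomplex)).toFunctor ⟶ E :=
      { app d := ↾fun z ↦ extendDiagonal f (hτ z.1 z.2)
        naturality d d' θ := by
          ext ⟨z, hz⟩
          have h₁ : Fixes S (((box.obj Δ[n]).obj Δ[n]).map θ z) (τ z hz) :=
            ⟨(hτ z hz).mem, congrArg (fun t ↦ θ.1.unop ≫ t) (hτ z hz).fst,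
              congrArg (fun t ↦ θ.2.unop ≫ t) (hτ z hz).snd⟩
          refine (extendDiagonal_eq f h₁ (hτ _ (Subfunctor.map _ θ hz)) (hτ' _ _ _ h₁)).trans ?_
          exact (E.map_map (classify z) θ (f.app _ ⟨_, (hτ z hz).mem⟩)).symm }
    let G : (rect (⊤ : (Δ[n] : SSet.{u}).Subcomplex) (⊤ : (Δ[n] : SSet.{u}).Subcomplex)).toFunctor ⟶
        B :=
      { app d := ↾fun z ↦ B.map (classify z.1) (yonedaEquiv g)
        naturality d d' θ := by
          ext z
          exact (B.map_map (classify z.1) θ (yonedaEquiv g)).symm }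
    obtain ⟨l, h₁, h₂⟩ := h F G (fun d z hz hz' ↦ by
      refine (NatTrans.naturality_apply p _ _).trans ?_
      refine (congrArg (B.map _) (congr_app_apply sq.w (op ⦋n⦌) ⟨_, (hτ z hz).mem⟩)).trans ?_
      have := NatTrans.naturality_apply g (τ z hz).op (stdSimplex.objEquiv.symm (𝟙 ⦋n⦌))
      refine (congrArg (fun t ↦ B.map _ (g.app (op ⦋n⦌) (stdSimplex.objEquiv.symm t)))
        (Category.comp_id _).symm).trans ?_
      refine (congrArg (B.map _) this).trans ?_
      refine (B.map_map _ _ _).trans ?_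
      refine congrArg (fun t : (op ⦋n⦌, op ⦋n⦌) ⟶ d ↦ B.map t (yonedaEquiv g)) ?_
      exact Prod.ext (congrArg Quiver.Hom.op (hτ z hz).fst)
        (congrArg Quiver.Hom.op (hτ z hz).snd))
    let e : (diagonal.obj E).obj (op ⦋n⦌) := l.app (op ⦋n⦌, op ⦋n⦌)
      ⟨(stdSimplex.objEquiv.symm (𝟙 ⦋n⦌), stdSimplex.objEquiv.symm (𝟙 ⦋n⦌)), trivial, trivial⟩
    refine ⟨⟨⟨yonedaEquiv.symm e, ?_, ?_⟩⟩⟩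
    · ext m ⟨γ, hγ⟩
      let z : ((box.obj Δ[n]).obj Δ[n] : Bisimplicial.{u}).obj (m, m) := (γ, γ)
      have hz : z ∈ (⨆ i ∈ S, rect (faceUnion {i} : (Δ[n] : SSet.{u}).Subcomplex)
        (faceUnion {i} : (Δ[n] : SSet.{u}).Subcomplex)).obj (m, m) := by
        obtain ⟨i, hi, hx⟩ := hγ
        exact mem_biSup.2 ⟨i, hi, ⟨i, rfl, hx⟩, ⟨i, rfl, hx⟩⟩
      refine (NatTrans.naturality_apply l (classify z) _).symm.trans ?_
      refine Eq.trans ?_ ((h₂ (m, m) z hz ⟨trivial, trivial⟩).trans ?_)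
      · refine congrArg (l.app (m, m)) (Subtype.ext ?_)
        have : stdSimplex.objEquiv.symm (stdSimplex.objEquiv γ ≫ 𝟙 _) = γ := by simp
        exact Prod.ext this this
      · refine (NatTrans.naturality_apply f (stdSimplex.objEquiv γ).op ⟨_, (hτ z hz).mem⟩).symm.trans
          ?_
        exact congrArg (f.app m) (Subtype.ext (congrArg stdSimplex.objEquiv.symm (hτ z hz).fst))
    · apply yonedaEquiv.injective
      rw [yonedaEquiv_comp, Equiv.apply_symm_apply]
      refine (ConcreteCategory.congr_hom (NatTrans.congr_app h₁ (op ⦋n⦌, op ⦋n⦌)) _).trans ?_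
      exact B.map_id_apply _

end diagonal

/-- Horn filling in the first direction. -/
def HorizontallyKan {E B : Bisimplicial.{u}} (p : E ⟶ B) : Prop :=
  ∀ (n q : ℕ) (k : Fin (n + 1)), n ≠ 0 → LiftsAlong p
    (rect (faceUnion {k}ᶜ : (Δ[n] : SSet.{u}).Subcomplex) (⊤ : (Δ[q] : SSet.{u}).Subcomplex))
    (rect ⊤ ⊤)

variable {E B : Bisimplicial.{u}} {p : E ⟶ B}

lemma biSup_faceUnion {n : ℕ} (T : Finset (Fin (n + 1))) :
    ⨆ i ∈ T, (faceUnion {i} : (Δ[n] : SSet.{u}).Subcomplex) = faceUnion (T : Set (Fin (n + 1))) := by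
  ext m x
  rw [mem_biSup]
  constructor
  · rintro ⟨i, hi, _, rfl, h⟩
    exact ⟨_, hi, h⟩
  · rintro ⟨i, hi, h⟩
    exact ⟨i, hi, i, rfl, h⟩

/-- The rectangles `face r ⊠ Δ[n]`, for `r ≠ k`, are filled one at a time. What is prescribed in the
second direction is always a union of faces containing face `r` and not face `k`, whose inclusion in
`Δ[n]` is anodyne. -/
lemma ReedyFibration.liftsAlong_rect_faceUnion (hp : ReedyFibration p) {n : ℕ} (k : Fin (n + 1)) :
    LiftsAlong p (⨆ i ∈ Finset.univ.erase k, rect (faceUnion {i} : (Δ[n] : SSet.{u}).Subcomplex)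
      (faceUnion {i} : (Δ[n] : SSet.{u}).Subcomplex)) (rect (faceUnion {k}ᶜ) ⊤) := by
  classical
  have key (S : Finset (Fin (n + 1))) (hS : k ∉ S) :
      LiftsAlong p (⨆ i ∈ Finset.univ.erase k, rect (faceUnion {i} : (Δ[n] : SSet.{u}).Subcomplex)
        (faceUnion {i} : (Δ[n] : SSet.{u}).Subcomplex))
        ((⨆ i ∈ Finset.univ.erase k, rect (faceUnion {i}) (faceUnion {i})) ⊔
          rect (faceUnion S) ⊤) := by
    induction S using Finset.induction_on with
    | empty =>
      intro f g hfg
      have h : (⨆ i ∈ Finset.univ.erase k, rect (faceUnion {i} : (Δ[n] : SSet.{u}).Subcomplex)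
        (faceUnion {i} : (Δ[n] : SSet.{u}).Subcomplex)) ⊔ rect (faceUnion ((∅ : Finset (Fin (n + 1))) : Set _)) ⊤ ≤
        (⨆ i ∈ Finset.univ.erase k, rect (faceUnion {i} : (Δ[n] : SSet.{u}).Subcomplex)
        (faceUnion {i} : (Δ[n] : SSet.{u}).Subcomplex)) := by
        refine sup_le le_rfl ?_
        rintro d z ⟨⟨i, hi, -⟩, -⟩
        simp at hi
      refine ⟨Subfunctor.homOfLe h ≫ f, ?_, fun d x hx hx' ↦ rfl⟩
      ext d x
      exact hfg d x.1 (h d x.2) x.2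
    | insert r S hr IH =>
      have hrk : r ≠ k := by rintro rfl; simp at hS
      refine (IH (by simp at hS; tauto)).trans ?_ le_sup_left ?_
      · refine LiftsAlong.sup (T := rect (faceUnion {r}) ⊤) ?_ ?_
        · convert liftsAlong_iSup_rect (p := p) (Finset.univ.erase k) (Y := ⊤)
            (fun i ↦ (faceUnion {i} : (Δ[n] : SSet.{u}).Subcomplex)) (fun _ ↦ le_top)
            (faceUnion {r}) le_top (fun T hT ↦ ?_) (faceUnion {r} : (Δ[n] : SSet.{u}).Subcomplex)
            (faceUnion S ⊓ faceUnion {r}) (fun i ↦ faceUnion {i} ⊓ faceUnion {r})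
            (fun _ ↦ inf_le_right) inf_le_right using 1
          · ext d z
            simp only [mem_inf, mem_sup, mem_biSup, mem_rect]
            have h₁ : z.2 ∈ (⊤ : (Δ[n] : SSet.{u}).Subcomplex).obj d.2 := trivial
            have h₂ : r ∈ Finset.univ.erase k := by simp [hrk]
            clear IH
            constructor
            · rintro ⟨⟨i, hi, h, h'⟩ | h, h''⟩
              · exact Or.inl (Or.inl ⟨i, hi, ⟨h, h''.1⟩, h'⟩)
              · exact Or.inr ⟨⟨h.1, h''.1⟩, h₁⟩
            · rintro ((⟨i, hi, h, h'⟩ | h) | h)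
              · exact ⟨Or.inl ⟨i, hi, h.1, h'⟩, h.2, h₁⟩
              · exact ⟨Or.inl ⟨r, h₂, h⟩, h.1, h₁⟩
              · exact ⟨Or.inr ⟨h.1.1, h₁⟩, h.1.2, h₁⟩
          · rw [biSup_faceUnion, ← faceUnion_union]
            refine hp.isGood le_top ?_
            have h := anodyne_faceUnion.{u} (n := n) (S := {r} ∪ T) (i := r) (k := k) (by simp) (by
              have : k ∉ T := fun h ↦ by simpa using hT h
              simp [this, Ne.symm hrk])
            exact (anodyneExtensions.cancel_right_of_respectsIso _
              (⊤ : (Δ[n] : SSet.{u}).Subcomplex).ι).1 h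
        · rw [Finset.coe_insert, Set.insert_eq, faceUnion_union, sup_assoc]
          congr 1
          ext d z
          simp only [mem_sup, mem_rect]
          tauto
      · exact sup_le_sup le_rfl (rect_mono (faceUnion_mono (by simp)) le_rfl)
  convert key (Finset.univ.erase k) (by simp) using 1
  have h : ((Finset.univ.erase k : Finset (Fin (n + 1))) : Set (Fin (n + 1))) = {k}ᶜ := by
    ext; simp
  rw [h, right_eq_sup]
  refine iSup₂_le fun i hi ↦ rect_mono (faceUnion_mono ?_) le_top
  simpa [eq_comm] using hi

/-- The transposed horn extends to `Λ ⊠ Δ[n]` by the Reedy condition and from there to `Δ[n] ⊠ Δ[n]`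
by horizontal filling. -/
theorem ReedyFibration.fibration_diagonal (hp : ReedyFibration p) (h : HorizontallyKan p) :
    Fibration (diagonal.map p) := by
  rw [modelCategoryQuillen.fibration_iff]
  intro _ _ i hi
  simp only [J, MorphismProperty.iSup_iff] at hi
  obtain ⟨m, ⟨k⟩⟩ := hi
  rw [← faceUnion_compl]
  have := hasLiftingProperty_diagonal (p := p) (S := Finset.univ.erase k)
    ((hp.liftsAlong_rect_faceUnion k).trans (h _ _ k (by simp)) ?_ (rect_mono le_top le_rfl))
  · have h : ((Finset.univ.erase k : Finset (Fin (m + 1 + 1))) : Set (Fin (m + 1 + 1))) = {k}ᶜ := by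
      ext; simp
    rwa [h] at this
  · refine iSup₂_le fun i hi ↦ rect_mono (faceUnion_mono ?_) le_top
    simpa [eq_comm] using hi

end Bisimplicial
namespace Bisimplicial

/-! ### Diagonals of rowwise weak equivalences -/

section trivial

variable {E B : Bisimplicial.{u}} {p : E ⟶ B} {K : SSet.{u}}

lemma liftsAlong_of_le {D : Type*} [Category* D] {U E B : D ⥤ Type u} {p : E ⟶ B}
    {S T : Subfunctor U} (h : T ≤ S) : LiftsAlong p S T := by
  intro f g hfg
  refine ⟨Subfunctor.homOfLe h ≫ f, ?_, fun d x hx hx' ↦ rfl⟩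
  ext d x
  exact hfg d x.1 (h d x.2) x.2

variable (p) in
/-- The map `E^X ⟶ B^X` is a trivial fibration. -/
def PowerTrivial (X : K.Subcomplex) : Prop :=
  ∀ n : ℕ, LiftsAlong p (rect X (∂Δ[n] : (Δ[n] : SSet.{u}).Subcomplex)) (rect X ⊤)

variable (p) in
/-- The map `E^X ⟶ B^X ×_{B^X₀} E^X₀` is a trivial fibration. -/
def RelativePowerTrivial (X₀ X : K.Subcomplex) : Prop :=
  ∀ n : ℕ, LiftsAlong p (rect X₀ ⊤ ⊔ rect X (∂Δ[n] : (Δ[n] : SSet.{u}).Subcomplex)) (rect X ⊤)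

lemma RelativePowerTrivial.sup {A C : K.Subcomplex} (h : RelativePowerTrivial p (A ⊓ C) C) :
    RelativePowerTrivial p A (A ⊔ C) := by
  intro n
  refine LiftsAlong.sup (T := rect C ⊤) ?_ ?_
  · convert h n using 1
    ext d z
    simp only [mem_inf, mem_sup, mem_rect]
    have : z.2 ∈ (⊤ : (Δ[n] : SSet.{u}).Subcomplex).obj d.2 := trivial
    tauto
  · ext d z
    simp only [mem_sup, mem_rect]
    have : z.2 ∈ (⊤ : (Δ[n] : SSet.{u}).Subcomplex).obj d.2 := trivial
    tauto

lemma PowerTrivial.of_relative {A C : K.Subcomplex} (hAC : A ≤ C)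
    (h : RelativePowerTrivial p A C) (hA : PowerTrivial p A) : PowerTrivial p C := by
  intro n
  refine LiftsAlong.trans (LiftsAlong.sup (T := rect A ⊤) ?_ rfl) ?_ le_sup_left
    (sup_le (rect_mono le_rfl le_top) (rect_mono hAC le_rfl))
  · convert hA n using 1
    ext d z
    simp only [mem_inf, mem_rect]
    have : z.2 ∈ (⊤ : (Δ[n] : SSet.{u}).Subcomplex).obj d.2 := trivial
    have := @hAC d.1 z.1
    tauto
  · rw [sup_comm]
    exact h n

lemma powerTrivial_iff (X : K.Subcomplex) :
    PowerTrivial p X ↔ TrivialFibration ((power.obj (op (X : SSet.{u}))).map p) := by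
  have key (n : ℕ) : LiftsAlong p (rect X (∂Δ[n] : (Δ[n] : SSet.{u}).Subcomplex)) (rect X ⊤) ↔
      HasLiftingProperty (∂Δ[n] : (Δ[n] : SSet.{u}).Subcomplex).ι
        ((power.obj (op (X : SSet.{u}))).map p) := by
    let i := (box.obj (X : SSet.{u})).map (∂Δ[n] : (Δ[n] : SSet.{u}).Subcomplex).ι
    refine Iff.trans ?_ ((powerAdjunction.adj (X : SSet.{u})).hasLiftingProperty_iff _ _)
    let a : (rect X (∂Δ[n] : (Δ[n] : SSet.{u}).Subcomplex)).toFunctor ≅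
        (box.obj (X : SSet.{u})).obj (∂Δ[n] : (Δ[n] : SSet.{u}).Subcomplex) :=
      { hom := { app d := ↾fun z ↦ (⟨z.1.1, z.2.1⟩, ⟨z.1.2, z.2.2⟩) }
        inv := { app d := ↾fun z ↦ ⟨(z.1.1, z.2.1), z.1.2, z.2.2⟩ } }
    let b : (rect X (⊤ : (Δ[n] : SSet.{u}).Subcomplex)).toFunctor ≅
        (box.obj (X : SSet.{u})).obj Δ[n] :=
      { hom := { app d := ↾fun z ↦ (⟨z.1.1, z.2.1⟩, z.1.2) }
        inv := { app d := ↾fun z ↦ ⟨(z.1.1, z.2), z.1.2, trivial⟩ } }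
    constructor
    · intro h
      refine ⟨fun {f g} sq ↦ ?_⟩
      obtain ⟨l, h₁, h₂⟩ := h (a.hom ≫ f) (b.hom ≫ g) (fun d x hx hx' ↦
        ConcreteCategory.congr_hom (NatTrans.congr_app sq.w d) (a.hom.app d ⟨x, hx⟩))
      refine ⟨⟨⟨b.inv ≫ l, ?_, ?_⟩⟩⟩
      · ext d ⟨x, y⟩
        exact h₂ d (x.1, y.1) ⟨x.2, y.2⟩ ⟨x.2, trivial⟩
      · rw [Category.assoc, h₁, b.inv_hom_id_assoc]
    · intro h f g hfg
      have sq : CommSq (a.inv ≫ f) i p (b.inv ≫ g) := ⟨by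
        ext d ⟨x, y⟩
        exact hfg d (x.1, y.1) ⟨x.2, y.2⟩ ⟨x.2, trivial⟩⟩
      have : HasLiftingProperty i p := h
      refine ⟨b.hom ≫ sq.lift, by rw [Category.assoc, sq.fac_right, b.hom_inv_id_assoc], ?_⟩
      intro d x hx hx'
      exact ConcreteCategory.congr_hom (NatTrans.congr_app sq.fac_left d)
          (show ((box.obj (X : SSet.{u})).obj (∂Δ[n] : (Δ[n] : SSet.{u}).Subcomplex)).obj d from
            (⟨x.1, hx.1⟩, ⟨x.2, hx.2⟩))
  rw [TrivialFibration, rlp_monomorphisms]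
  constructor
  · rintro h _ _ _ ⟨n⟩
    exact (key n).1 (h n)
  · intro h n
    exact (key n).2 (h _ ⟨n⟩)

/-- The gap map followed by the pullback of `E^K₀ ⟶ B^K₀` is `E^K ⟶ B^K`. Two-out-of-three makes the
gap map a weak equivalence, and it is a fibration by the Reedy condition. -/
lemma trivialFibration_pullbackObjObj (hp : ReedyFibration p) {K₀ K : SSet.{u}} {i : K₀ ⟶ K}
    [Mono i] (h₀ : TrivialFibration ((power.obj (op K₀)).map p))
    (h : TrivialFibration ((power.obj (op K)).map p)) (sq : power.PullbackObjObj i p) :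
    TrivialFibration sq.π := by
  have := hp.fibration_power sq
  have h₁ : TrivialFibration sq.snd := TrivialFibration.of_isPullback sq.isPullback.flip h₀
  refine TrivialFibration.of_isWeakEquivalence _
    (IsWeakEquivalence.of_postcomp (g := sq.snd) h₁.isWeakEquivalence ?_)
  rw [sq.π_snd]
  exact h.isWeakEquivalence

lemma hasLiftingProperty_of_trivialFibration {K₀ K L₀ L : SSet.{u}} {i : K₀ ⟶ K}
    {j : L₀ ⟶ L} [Mono j] (sq : power.PullbackObjObj i p) (h : TrivialFibration sq.π)
    (sq' : box.PushoutObjObj i j) : HasLiftingProperty sq'.ι p :=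
  (powerAdjunction.hasLiftingProperty_iff sq' sq).2 (h _ inferInstance)

lemma RelativePowerTrivial.of_powerTrivial (hp : ReedyFibration p) {A C : K.Subcomplex}
    (hAC : A ≤ C) (hA : PowerTrivial p A) (hC : PowerTrivial p C) :
    RelativePowerTrivial p A C := fun _ ↦
  liftsAlong_of_hasLiftingProperty hAC le_top (boxPushout _ _)
    (hasLiftingProperty_of_trivialFibration (Functor.PullbackObjObj.ofHasPullback _ _ _)
      (trivialFibration_pullbackObjObj hp ((powerTrivial_iff A).1 hA) ((powerTrivial_iff C).1 hC) _)
      _)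

lemma PowerTrivial.of_retract {A : K.Subcomplex} (r : K ⟶ K) (hr : ∀ n x, r.app n x ∈ A.obj n)
    (hr' : ∀ n x, x ∈ A.obj n → r.app n x = x) (h : PowerTrivial p (⊤ : K.Subcomplex)) :
    PowerTrivial p A := by
  intro m f g hfg
  let a (Y : (Δ[m] : SSet.{u}).Subcomplex) :
      (rect (⊤ : K.Subcomplex) Y).toFunctor ⟶ (rect A Y).toFunctor :=
    { app d := ↾fun z ↦ ⟨(r.app _ z.1.1, z.1.2), hr _ _, z.2.2⟩
      naturality d d' θ := by
        ext z
        apply Subtype.ext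
        refine Prod.ext ?_ rfl
        exact NatTrans.naturality_apply r θ.1 z.1.1 }
  obtain ⟨l, h₁, h₂⟩ := h m (a _ ≫ f) (a _ ≫ g) (fun d x hx hx' ↦
    hfg d (r.app _ x.1, x.2) ⟨hr _ _, hx.2⟩ ⟨hr _ _, trivial⟩)
  refine ⟨Subfunctor.homOfLe (rect_mono le_top le_rfl) ≫ l, ?_, fun d x hx hx' ↦ ?_⟩
  · rw [Category.assoc, h₁]
    ext d x
    refine congrArg (g.app d) (Subtype.ext ?_)
    exact Prod.ext (hr' _ _ x.2.1) rfl
  · refine (h₂ d x ⟨trivial, hx.2⟩ _).trans ?_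
    refine congrArg (f.app d) (Subtype.ext ?_)
    exact Prod.ext (hr' _ _ hx.1) rfl

/-- The intersection of the faces of the standard simplex opposite to the vertices in `R`. -/
@[simps]
def faceInter {n : ℕ} (R : Set (Fin (n + 1))) : (Δ[n] : SSet.{u}).Subcomplex where
  obj m := {x | ∀ r ∈ R, ∀ j, stdSimplex.asOrderHom x j ≠ r}
  map _ _ hx r hr _ := hx r hr _

lemma PowerTrivial.faceInter {n : ℕ} (h : PowerTrivial p (⊤ : (Δ[n] : SSet.{u}).Subcomplex))
    (R : Finset (Fin (n + 1))) :
    PowerTrivial p (faceInter R : (Δ[n] : SSet.{u}).Subcomplex) := by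
  obtain hV | hV := Finset.eq_empty_or_nonempty Rᶜ
  · intro
    refine liftsAlong_of_le ?_
    rintro d z ⟨hz, -⟩
    exact absurd rfl (hz (stdSimplex.asOrderHom z.1 0)
      (by rw [Finset.compl_eq_empty_iff] at hV; simp [hV]) 0)
  · obtain ⟨τ, h₁, h₂⟩ := exists_monotone_retraction _ hV
    refine PowerTrivial.of_retract (SSet.stdSimplex.map (SimplexCategory.Hom.mk τ)) (fun m x ↦ ?_)
      (fun m x hx ↦ ?_) h
    · intro r hr j hj
      have := h₁ (stdSimplex.asOrderHom x j)
      rw [Finset.mem_compl] at this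
      exact this (by rw [← hj] at hr; exact hr)
    · apply stdSimplex.ext
      intro j
      exact h₂ _ (by rw [Finset.mem_compl]; exact fun h ↦ hx _ h j rfl)

/-- Faces are added one at a time. A new face meets the earlier ones in a union of the same kind
inside a smaller intersection of faces, whence the general `R`. An intersection of faces is empty or
a retract of the simplex. -/
lemma PowerTrivial.faceInter_inf_faceUnion (hp : ReedyFibration p) {n : ℕ}
    (h : PowerTrivial p (⊤ : (Δ[n] : SSet.{u}).Subcomplex)) (S R : Finset (Fin (n + 1))) :
    PowerTrivial p (Bisimplicial.faceInter R ⊓ faceUnion S : (Δ[n] : SSet.{u}).Subcomplex) := by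
  induction S using Finset.induction_on generalizing R with
  | empty =>
    intro m
    refine liftsAlong_of_le ?_
    rintro d z ⟨⟨-, i, hi, -⟩, -⟩
    simp at hi
  | insert r S hr IH =>
    have h₁ : (Bisimplicial.faceInter (insert r R : Finset (Fin (n + 1))) :
        (Δ[n] : SSet.{u}).Subcomplex) = faceUnion {r} ⊓ Bisimplicial.faceInter R := by
      ext m x
      simp [faceUnion]
    have h₂ : (Bisimplicial.faceInter R ⊓ faceUnion (insert r S : Finset (Fin (n + 1))) :
        (Δ[n] : SSet.{u}).Subcomplex) = (Bisimplicial.faceInter R ⊓ faceUnion S) ⊔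
          Bisimplicial.faceInter (insert r R : Finset (Fin (n + 1))) := by
      rw [h₁, Finset.coe_insert, Set.insert_eq, faceUnion_union]
      ext m x
      simp only [mem_sup, mem_inf]
      tauto
    rw [h₂]
    refine PowerTrivial.of_relative le_sup_left (RelativePowerTrivial.sup ?_) (IH R)
    refine RelativePowerTrivial.of_powerTrivial hp inf_le_right ?_ (h.faceInter _)
    convert IH (insert r R) using 1
    rw [h₁]
    ext m x
    simp only [mem_inf]
    tauto

/-- The `m`-th row of a bisimplicial set is its power by the `m`-simplex. -/
def rowIso (m : ℕ) (X : Bisimplicial.{u}) :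
    (row (op ⦋m⦌)).obj X ≅ (power.obj (op Δ[m])).obj X :=
  NatIso.ofComponents (fun q ↦ (yonedaEquiv (X := (col q).obj X)).symm.toIso) (fun {q r} g ↦ by
    ext x
    refine yonedaEquiv.injective ?_
    refine (Equiv.apply_symm_apply _ _).trans ?_
    refine Eq.trans ?_ (yonedaEquiv_comp _ _).symm
    exact congrArg (X.map (show (op ⦋m⦌, q) ⟶ (op ⦋m⦌, r) from (𝟙 _, g)))
      (Equiv.apply_symm_apply yonedaEquiv x).symm)

lemma rowIso_hom_naturality (m : ℕ) :
    (rowIso m E).hom ≫ (power.obj (op Δ[m])).map p = (row (op ⦋m⦌)).map p ≫ (rowIso m B).hom := by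
  ext q x
  refine yonedaEquiv.injective ?_
  refine (yonedaEquiv_comp _ _).trans ?_
  refine Eq.trans ?_ (Equiv.apply_symm_apply _ _).symm
  exact congrArg (p.app (op ⦋m⦌, q)) (Equiv.apply_symm_apply yonedaEquiv x)

/-- The `m`-th row of a map is its power by the `m`-simplex. -/
def rowArrowIso (p : E ⟶ B) (m : ℕ) :
    Arrow.mk ((row (op ⦋m⦌)).map p) ≅ Arrow.mk ((power.obj (op Δ[m])).map p) :=
  Arrow.isoMk (rowIso m E) (rowIso m B) (rowIso_hom_naturality m)

lemma ReedyFibration.fibration_power_map (hp : ReedyFibration p) (K : SSet.{u}) :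
    Fibration ((power.obj (op K)).map p) := by
  rw [modelCategoryQuillen.fibration_iff]
  intro L₀ L f h
  have := (rowPowerAdjunction.{u}.adj L).leftAdjoint_preservesColimits
  have := (rowPowerAdjunction.{u}.adj L₀).leftAdjoint_preservesColimits
  refine ((powerAdjunction.adj K).hasLiftingProperty_iff _ _).1 ?_
  exact hp.hasLiftingProperty (.ofIsInitialLeft box (initial.to K) f initialIsInitial)
    (MorphismProperty.le_llp_rlp _ _ h)

lemma ReedyFibration.fibration_row (hp : ReedyFibration p) (m : ℕ) :
    Fibration ((row (op ⦋m⦌)).map p) := by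
  have h := hp.fibration_power_map Δ[m]
  rw [modelCategoryQuillen.fibration_iff] at h ⊢
  exact (J.rlp.arrow_mk_iso_iff (rowArrowIso p m)).2 h

/-- A rowwise weak equivalence which is a Reedy fibration lifts against all pushout-products of
monomorphisms. -/
lemma ReedyFibration.hasLiftingProperty_of_isWeakEquivalence (hp : ReedyFibration p)
    (h : ∀ m : ℕ, IsWeakEquivalence ((row (op ⦋m⦌)).map p)) {K₀ K L₀ L : SSet.{u}} {i : K₀ ⟶ K}
    {j : L₀ ⟶ L} [Mono i] [Mono j] (sq : box.PushoutObjObj i j) : HasLiftingProperty sq.ι p := by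
  let sq₃ := Functor.PullbackObjObj.ofHasPullback rowPower j p
  refine (rowPowerAdjunction.hasLiftingProperty_iff sq.flip sq₃).2 ?_
  suffices (MorphismProperty.monomorphisms _).rlp sq₃.π from this _ inferInstance
  rw [rlp_monomorphisms]
  rintro _ _ _ ⟨m⟩
  refine (rowPowerAdjunction.hasLiftingProperty_iff
    (boxPushout (∂Δ[m] : (Δ[m] : SSet.{u}).Subcomplex).ι j).flip sq₃).1 ?_
  have h₁ : TrivialFibration ((power.obj (op Δ[m])).map p) := by
    have := hp.fibration_row m
    exact ((MorphismProperty.monomorphisms SSet.{u}).rlp.arrow_mk_iso_iff (rowArrowIso p m)).1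
      (TrivialFibration.of_isWeakEquivalence _ (h m))
  have h₂ : PowerTrivial p (⊤ : (Δ[m] : SSet.{u}).Subcomplex) := by
    let e : op (Δ[m] : SSet.{u}) ≅ op (⊤ : (Δ[m] : SSet.{u}).Subcomplex).toSSet :=
      (Subcomplex.topIso _).op
    rw [powerTrivial_iff]
    exact ((MorphismProperty.monomorphisms SSet.{u}).rlp.arrow_mk_iso_iff (Arrow.isoMk
      ((power.mapIso e).app E) ((power.mapIso e).app B) ((power.map e.hom).naturality p).symm)).1 h₁
  have h₃ := (powerTrivial_iff _).1 (h₂.faceInter_inf_faceUnion hp Finset.univ ∅)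
  have h₄ : faceInter ((∅ : Finset (Fin (m + 1))) : Set (Fin (m + 1))) ⊓
      faceUnion ((Finset.univ : Finset (Fin (m + 1))) : Set (Fin (m + 1))) =
      (∂Δ[m] : (Δ[m] : SSet.{u}).Subcomplex) := by
    rw [Finset.coe_univ, faceUnion_univ, inf_eq_right]
    intro n x hx r hr
    simp at hr
  rw [h₄] at h₃
  exact hasLiftingProperty_of_trivialFibration (Functor.PullbackObjObj.ofHasPullback _ _ _)
    (trivialFibration_pullbackObjObj hp h₃ h₁ _) _

/-- Now `p` lifts against pushout-products of arbitrary monomorphisms, so the transposed boundary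
extends to `Δ[n] ⊠ Δ[n]` by filling rectangles, without any horizontal condition. -/
theorem ReedyFibration.trivialFibration_diagonal (hp : ReedyFibration p)
    (h : ∀ m : ℕ, IsWeakEquivalence ((row (op ⦋m⦌)).map p)) :
    TrivialFibration (diagonal.map p) := by
  rw [TrivialFibration, rlp_monomorphisms]
  rintro _ _ _ ⟨n⟩
  have := hasLiftingProperty_diagonal (p := p) (S := (Finset.univ : Finset (Fin (n + 1)))) (by
    convert liftsAlong_iSup_rect (p := p) (Finset.univ) (Y := ⊤)
      (fun i ↦ (faceUnion {i} : (Δ[n] : SSet.{u}).Subcomplex)) (fun _ ↦ le_top)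
      ⊥ le_top (fun T hT ↦ ?_) (⊤ : (Δ[n] : SSet.{u}).Subcomplex) ⊥ (fun i ↦ faceUnion {i})
      (fun _ ↦ le_top) le_top using 1
    · ext d z
      simp only [mem_sup, mem_rect]
      have h₁ : z.1 ∉ (⊥ : (Δ[n] : SSet.{u}).Subcomplex).obj d.1 := fun h ↦ h
      have h₂ : z.2 ∉ (⊥ : (Δ[n] : SSet.{u}).Subcomplex).obj d.2 := fun h ↦ h
      tauto
    · intro K X₀ X hX
      exact liftsAlong_of_hasLiftingProperty hX le_top (boxPushout _ _)
        (hp.hasLiftingProperty_of_isWeakEquivalence h _))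
  rwa [Finset.coe_univ, faceUnion_univ] at this

end trivial

/-- The diagonal of a rowwise weak equivalence is a weak equivalence. -/
theorem isWeakEquivalence_diagonal {X Y : Bisimplicial.{u}} (f : X ⟶ Y)
    (h : ∀ m : ℕ, IsWeakEquivalence ((row (op ⦋m⦌)).map f)) :
    IsWeakEquivalence (diagonal.map f) := by
  -- The first factor is anodyne both in rows and on the diagonal; the second is then a rowwise weak
  -- equivalence by two-out-of-three.
  obtain ⟨Z, i, p, hi, hp, rfl⟩ := exists_reedy_factorization f
  rw [Functor.map_comp]
  refine (isWeakEquivalence_of_anodyne (anodyne_diagonal hi)).comp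
    (hp.trivialFibration_diagonal fun m ↦ ?_).isWeakEquivalence
  exact IsWeakEquivalence.of_precomp (isWeakEquivalence_of_anodyne (anodyne_row hi _))
    (by simpa using h m)

end Bisimplicial
-- Edges and triangles in the rows
section fill

variable {Y Z : SSet.{u}} (f : Y ⟶ Z) [Fibration f]

lemma exists_edge_lift (y : Y _⦋0⦌) (z : Z _⦋1⦌) (h : Z.δ 1 z = f.app _ y) :
    ∃ e : Y _⦋1⦌, Y.δ 1 e = y ∧ f.app _ e = z := by
  obtain ⟨φ, h₁, h₂⟩ := horn.IsCompatible.exists_lift (i := (0 : Fin 2))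
    (f := fun _ _ ↦ yonedaEquiv.symm y) trivial f (yonedaEquiv.symm z) (by
      intro j hj
      obtain rfl : j = 1 := by fin_cases j <;> simp_all
      rw [stdSimplex.δ_comp_yonedaEquiv_symm, h, yonedaEquiv_symm_comp])
  refine ⟨yonedaEquiv φ, ?_, ?_⟩
  · rw [← stdSimplex.yonedaEquiv_δ_comp, h₁ 1 (by simp), Equiv.apply_symm_apply]
  · rw [← yonedaEquiv_comp, h₂, Equiv.apply_symm_apply]

lemma exists_triangle_lift (a b : Y _⦋1⦌) (z : Z _⦋2⦌) (hab : Y.δ 0 a = Y.δ 0 b)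
    (ha : Z.δ 0 z = f.app _ a) (hb : Z.δ 1 z = f.app _ b) :
    ∃ t : Y _⦋2⦌, Y.δ 0 t = a ∧ Y.δ 1 t = b ∧ f.app _ t = z := by
  obtain ⟨φ, h₁, h₂⟩ := horn.IsCompatible.exists_lift (i := (2 : Fin 3))
    (f := fun j _ ↦ if j = 0 then yonedaEquiv.symm a else yonedaEquiv.symm b)
    (by
      rw [horn.isCompatible_iff]
      intro j k hj hk hjk
      obtain rfl : j = 0 := by fin_cases j <;> fin_cases k <;> simp_all
      obtain rfl : k = 1 := by fin_cases k <;> simp_all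
      simp only [reduceIte, one_ne_zero, stdSimplex.δ_comp_yonedaEquiv_symm]
      exact congrArg yonedaEquiv.symm hab) f (yonedaEquiv.symm z) (by
      intro j hj
      obtain rfl | rfl : j = 0 ∨ j = 1 := by fin_cases j <;> simp_all
      · simp only [reduceIte]
        rw [stdSimplex.δ_comp_yonedaEquiv_symm, ha, yonedaEquiv_symm_comp]
      · simp only [one_ne_zero, reduceIte]
        rw [stdSimplex.δ_comp_yonedaEquiv_symm, hb, yonedaEquiv_symm_comp])
  refine ⟨yonedaEquiv φ, ?_, ?_, ?_⟩
  · rw [← stdSimplex.yonedaEquiv_δ_comp, h₁ 0 (by simp), if_pos rfl, Equiv.apply_symm_apply]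
  · rw [← stdSimplex.yonedaEquiv_δ_comp, h₁ 1 (by simp), if_neg (by simp), Equiv.apply_symm_apply]
  · rw [← yonedaEquiv_comp, h₂, Equiv.apply_symm_apply]

end fill

namespace Bisimplicial

/-- The map of columns given by a vertical operator. -/
def vert (X : Bisimplicial.{u}) {q r : SimplexCategoryᵒᵖ} (θ : q ⟶ r) :
    (col q).obj X ⟶ (col r).obj X where
  app n := X.map (show (n, q) ⟶ (n, r) from (𝟙 n, θ))
  naturality n m ψ := by
    ext x
    refine (X.map_map _ _ _).trans ((congrArg (fun t : (n, q) ⟶ (m, r) ↦ X.map t x) ?_).trans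
      (X.map_map _ _ _).symm)
    exact Prod.ext ((Category.comp_id _).trans (Category.id_comp _).symm)
      ((Category.id_comp _).trans (Category.comp_id _).symm)

section

variable {E B : Bisimplicial.{u}} (p : E ⟶ B) {q r s : SimplexCategoryᵒᵖ}

lemma vert_naturality (θ : q ⟶ r) : E.vert θ ≫ (col r).map p = (col q).map p ≫ B.vert θ := by
  ext n x
  exact NatTrans.naturality_apply p (show (n, q) ⟶ (n, r) from (𝟙 n, θ)) x

lemma vert_comp (θ : q ⟶ r) (ψ : r ⟶ s) : E.vert θ ≫ E.vert ψ = E.vert (θ ≫ ψ) := by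
  ext n x
  refine (E.map_map _ _ _).trans (congrArg (fun t : (n, q) ⟶ (n, s) ↦ E.map t x) ?_)
  exact Prod.ext (Category.comp_id _) rfl

lemma vert_id : E.vert (𝟙 q) = 𝟙 _ := by
  ext n x
  exact E.map_id_apply x

/-- Vertices of the columns. -/
abbrev X₀ (X : Bisimplicial.{u}) : SSet.{u} := (col (op ⦋0⦌)).obj X
/-- Edges. -/
abbrev X₁ (X : Bisimplicial.{u}) : SSet.{u} := (col (op ⦋1⦌)).obj X

/-- The source of edges in the rows. -/
abbrev src (X : Bisimplicial.{u}) : X.X₁ ⟶ X.X₀ := X.vert (SimplexCategory.δ 1).op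
/-- The target of edges in the rows. -/
abbrev tgt (X : Bisimplicial.{u}) : X.X₁ ⟶ X.X₀ := X.vert (SimplexCategory.δ 0).op
/-- Constant edges in the rows. -/
abbrev con (X : Bisimplicial.{u}) : X.X₀ ⟶ X.X₁ := X.vert (SimplexCategory.σ 0).op

variable (X : Bisimplicial.{u})

@[simp]
lemma con_src : X.con ≫ X.src = 𝟙 _ := by
  rw [vert_comp, ← vert_id, ← op_comp]
  exact congrArg (fun t ↦ X.vert (Quiver.Hom.op t)) (SimplexCategory.δ_comp_σ_succ (i := (0 : Fin 1)))

@[simp]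
lemma con_tgt : X.con ≫ X.tgt = 𝟙 _ := by
  rw [vert_comp, ← vert_id, ← op_comp]
  exact congrArg (fun t ↦ X.vert (Quiver.Hom.op t)) (SimplexCategory.δ_comp_σ_self (i := (0 : Fin 1)))

end

section

variable {E B : Bisimplicial.{u}} {p : E ⟶ B} (hp : ReedyFibration p) {K L : SSet.{u}} (i : K ⟶ L)
  [Mono i]
include hp

/-- Lifting of edges of the power, relative to a subobject. -/
lemma ReedyFibration.exists_edge (x : L ⟶ E.X₀) (γ : K ⟶ E.X₁) (δ : L ⟶ B.X₁)
    (h₁ : i ≫ x = γ ≫ E.src) (h₂ : i ≫ δ = γ ≫ (col _).map p) (h₃ : x ≫ (col _).map p = δ ≫ B.src) :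
    ∃ e : L ⟶ E.X₁, e ≫ E.src = x ∧ i ≫ e = γ ∧ e ≫ (col _).map p = δ := by
  let sq := Functor.PullbackObjObj.ofHasPullback power i p
  have := hp.fibration_power sq
  obtain ⟨z, hz₁, hz₂⟩ := exists_of_isPullback sq.isPullback (n := op ⦋1⦌) γ δ h₂.symm
  obtain ⟨e, he₁, he₂⟩ := exists_edge_lift sq.π x z (ext_of_isPullback sq.isPullback _ _ (by
      refine (NatTrans.naturality_apply sq.fst (SimplexCategory.δ 1).op z).trans ?_
      rw [hz₁]
      refine Eq.trans ?_ (congr_app_apply sq.π_fst _ x).symm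
      exact h₁.symm) (by
      refine (NatTrans.naturality_apply sq.snd (SimplexCategory.δ 1).op z).trans ?_
      rw [hz₂]
      refine Eq.trans ?_ (congr_app_apply sq.π_snd _ x).symm
      exact h₃.symm))
  refine ⟨e, he₁, ?_, ?_⟩
  · exact (congr_app_apply sq.π_fst _ e).symm.trans ((congrArg (sq.fst.app _) he₂).trans hz₁)
  · exact (congr_app_apply sq.π_snd _ e).symm.trans ((congrArg (sq.snd.app _) he₂).trans hz₂)

lemma ReedyFibration.exists_triangle (a b : L ⟶ E.X₁) (τ : K ⟶ (col (op ⦋2⦌)).obj E)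
    (δ : L ⟶ (col (op ⦋2⦌)).obj B) (hab : a ≫ E.tgt = b ≫ E.tgt)
    (ha : i ≫ a = τ ≫ E.vert (SimplexCategory.δ 0).op)
    (hb : i ≫ b = τ ≫ E.vert (SimplexCategory.δ 1).op)
    (hτ : i ≫ δ = τ ≫ (col _).map p)
    (ha' : a ≫ (col _).map p = δ ≫ B.vert (SimplexCategory.δ 0).op)
    (hb' : b ≫ (col _).map p = δ ≫ B.vert (SimplexCategory.δ 1).op) :
    ∃ t : L ⟶ (col (op ⦋2⦌)).obj E, t ≫ E.vert (SimplexCategory.δ 0).op = a ∧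
      t ≫ E.vert (SimplexCategory.δ 1).op = b ∧ i ≫ t = τ := by
  let sq := Functor.PullbackObjObj.ofHasPullback power i p
  have := hp.fibration_power sq
  obtain ⟨z, hz₁, hz₂⟩ := exists_of_isPullback sq.isPullback (n := op ⦋2⦌) τ δ hτ.symm
  obtain ⟨e, he₀, he₁, he₂⟩ := exists_triangle_lift sq.π a b z hab
    (ext_of_isPullback sq.isPullback _ _ (by
      refine (NatTrans.naturality_apply sq.fst (SimplexCategory.δ 0).op z).trans ?_
      rw [hz₁]
      refine Eq.trans ?_ (congr_app_apply sq.π_fst _ a).symm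
      exact ha.symm) (by
      refine (NatTrans.naturality_apply sq.snd (SimplexCategory.δ 0).op z).trans ?_
      rw [hz₂]
      refine Eq.trans ?_ (congr_app_apply sq.π_snd _ a).symm
      exact ha'.symm))
    (ext_of_isPullback sq.isPullback _ _ (by
      refine (NatTrans.naturality_apply sq.fst (SimplexCategory.δ 1).op z).trans ?_
      rw [hz₁]
      refine Eq.trans ?_ (congr_app_apply sq.π_fst _ b).symm
      exact hb.symm) (by
      refine (NatTrans.naturality_apply sq.snd (SimplexCategory.δ 1).op z).trans ?_
      rw [hz₂]
      refine Eq.trans ?_ (congr_app_apply sq.π_snd _ b).symm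
      exact hb'.symm))
  refine ⟨e, he₀, he₁, ?_⟩
  exact (congr_app_apply sq.π_fst _ e).symm.trans ((congrArg (sq.fst.app _) he₂).trans hz₁)

end

end Bisimplicial
namespace Bisimplicial

section

/-- The map of a bisimplicial set to the point. -/
def toPoint (X : Bisimplicial.{u}) : X ⟶ (Functor.const _).obj PUnit.{u + 1} where
  app _ := ↾fun _ ↦ PUnit.unit

lemma point_ext {Y : SSet.{u}} {q : SimplexCategoryᵒᵖ}
    (f g : Y ⟶ (col q).obj ((Functor.const _).obj PUnit.{u + 1})) : f = g := by
  ext n y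
  rfl

variable {X : Bisimplicial.{u}} (hX : ReedyFibration X.toPoint) {K L : SSet.{u}} (i : K ⟶ L)
  [Mono i]
include hX

lemma exists_edge (x : L ⟶ X.X₀) (γ : K ⟶ X.X₁) (h₁ : i ≫ x = γ ≫ X.src) :
    ∃ e : L ⟶ X.X₁, e ≫ X.src = x ∧ i ≫ e = γ := by
  obtain ⟨e, he, he', -⟩ := hX.exists_edge i x γ { app _ := ↾fun _ ↦ PUnit.unit } h₁
    (point_ext _ _) (point_ext _ _)
  exact ⟨e, he, he'⟩

/-- A family of horns `Λ[2, 2]` is filled relative to `K`; the new face is `b` followed by the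
inverse of `a`. -/
lemma exists_edge_of_triangle (a b : L ⟶ X.X₁) (τ : K ⟶ (col (op ⦋2⦌)).obj X)
    (hab : a ≫ X.tgt = b ≫ X.tgt)
    (ha : i ≫ a = τ ≫ X.vert (SimplexCategory.δ 0).op)
    (hb : i ≫ b = τ ≫ X.vert (SimplexCategory.δ 1).op) :
    ∃ c : L ⟶ X.X₁, c ≫ X.src = b ≫ X.src ∧ c ≫ X.tgt = a ≫ X.src ∧
      i ≫ c = τ ≫ X.vert (SimplexCategory.δ 2).op := by
  obtain ⟨t, rfl, rfl, rfl⟩ := hX.exists_triangle i a b τ { app _ := ↾fun _ ↦ PUnit.unit } hab ha hb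
    (point_ext _ _) (point_ext _ _) (point_ext _ _)
  refine ⟨t ≫ X.vert (SimplexCategory.δ 2).op, ?_, ?_, ?_⟩
  · rw [Category.assoc, Category.assoc, vert_comp, vert_comp]
    congr 2
    exact congrArg Quiver.Hom.op (SimplexCategory.δ_comp_δ_self (i := (1 : Fin 2))).symm
  · rw [Category.assoc, Category.assoc, vert_comp, vert_comp]
    congr 2
    exact congrArg Quiver.Hom.op
      (SimplexCategory.δ_comp_δ (i := (0 : Fin 2)) (j := (1 : Fin 2)) (by simp))
  · simp

/-- Where `a` and `b` agree, the composite of `b` with the inverse of `a` can be taken constant: the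
triangle prescribed on `K` is the degeneracy `σ 0` of `b`. -/
lemma exists_edge_const (a b : L ⟶ X.X₁) (hab : a ≫ X.tgt = b ≫ X.tgt) (h : i ≫ a = i ≫ b) :
    ∃ c : L ⟶ X.X₁, c ≫ X.src = b ≫ X.src ∧ c ≫ X.tgt = a ≫ X.src ∧
      i ≫ c = i ≫ b ≫ X.src ≫ X.con := by
  have h₀ : X.vert (SimplexCategory.σ (0 : Fin 2)).op ≫ X.vert (SimplexCategory.δ 0).op = 𝟙 _ := by
    rw [vert_comp, ← vert_id, ← op_comp]
    exact congrArg (fun t ↦ X.vert (Quiver.Hom.op t))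
      (SimplexCategory.δ_comp_σ_self (i := (0 : Fin 2)))
  have h₁ : X.vert (SimplexCategory.σ (0 : Fin 2)).op ≫ X.vert (SimplexCategory.δ 1).op = 𝟙 _ := by
    rw [vert_comp, ← vert_id, ← op_comp]
    exact congrArg (fun t ↦ X.vert (Quiver.Hom.op t))
      (SimplexCategory.δ_comp_σ_succ (i := (0 : Fin 2)))
  have h₂ : X.vert (SimplexCategory.σ (0 : Fin 2)).op ≫ X.vert (SimplexCategory.δ 2).op =
      X.src ≫ X.con := by
    rw [vert_comp, vert_comp]
    exact congrArg (fun t ↦ X.vert (Quiver.Hom.op t))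
      (SimplexCategory.δ_comp_σ_of_gt (i := (1 : Fin 2)) (j := (0 : Fin 1)) (by simp))
  obtain ⟨c, h₃, h₄, h₅⟩ := exists_edge_of_triangle hX i a b
    (i ≫ b ≫ X.vert (SimplexCategory.σ (0 : Fin 2)).op) hab (by simp [h₀, h]) (by simp [h₁])
  exact ⟨c, h₃, h₄, by simpa [h₂] using h₅⟩

/-- Where `a` is constant, the composite of `b` with the inverse of `a` can be taken equal to `b`:
the triangle prescribed on `K` is the degeneracy `σ 1` of `b`. -/
lemma exists_edge_relative (a b : L ⟶ X.X₁) (hab : a ≫ X.tgt = b ≫ X.tgt)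
    (h : i ≫ a = i ≫ b ≫ X.tgt ≫ X.con) :
    ∃ c : L ⟶ X.X₁, c ≫ X.src = b ≫ X.src ∧ c ≫ X.tgt = a ≫ X.src ∧ i ≫ c = i ≫ b := by
  have h₀ : X.vert (SimplexCategory.σ (1 : Fin 2)).op ≫ X.vert (SimplexCategory.δ 0).op =
      X.tgt ≫ X.con := by
    rw [vert_comp, vert_comp]
    exact congrArg (fun t ↦ X.vert (Quiver.Hom.op t))
      (SimplexCategory.δ_comp_σ_of_le (i := (0 : Fin 2)) (j := (0 : Fin 1)) (by simp))
  have h₁ : X.vert (SimplexCategory.σ (1 : Fin 2)).op ≫ X.vert (SimplexCategory.δ 1).op = 𝟙 _ := by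
    rw [vert_comp, ← vert_id, ← op_comp]
    exact congrArg (fun t ↦ X.vert (Quiver.Hom.op t))
      (SimplexCategory.δ_comp_σ_self (i := (1 : Fin 2)))
  have h₂ : X.vert (SimplexCategory.σ (1 : Fin 2)).op ≫ X.vert (SimplexCategory.δ 2).op = 𝟙 _ := by
    rw [vert_comp, ← vert_id, ← op_comp]
    exact congrArg (fun t ↦ X.vert (Quiver.Hom.op t))
      (SimplexCategory.δ_comp_σ_succ (i := (1 : Fin 2)))
  obtain ⟨c, h₃, h₄, h₅⟩ := exists_edge_of_triangle hX i a b
    (i ≫ b ≫ X.vert (SimplexCategory.σ (1 : Fin 2)).op) hab (by simp [h₀, h]) (by simp [h₁])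
  exact ⟨c, h₃, h₄, by simpa [h₂] using h₅⟩

end

/-! ### Joining and extending vertices relative to faces -/

section

variable {n : ℕ}

/-- The endomorphism of the standard simplex given by a monotone map. -/
abbrev endo (τ : Fin (n + 1) →o Fin (n + 1)) : (Δ[n] : SSet.{u}) ⟶ Δ[n] :=
  SSet.stdSimplex.map (SimplexCategory.Hom.mk τ)

lemma asOrderHom_endo (τ : Fin (n + 1) →o Fin (n + 1)) {m} (z : (Δ[n] : SSet.{u}).obj m) (j) :
    stdSimplex.asOrderHom ((endo τ).app m z) j = τ (stdSimplex.asOrderHom z j) := rfl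

/-- A map out of a simplex which factors through the point. -/
def IsConst {Y : SSet.{u}} (f : Δ[n] ⟶ Y) : Prop := ∀ τ, endo τ ≫ f = f

/-- Two maps agree on the union of faces in `S`. -/
def AgreeOn {Y : SSet.{u}} (S : Set (Fin (n + 1))) (f g : Δ[n] ⟶ Y) : Prop :=
  (faceUnion S : (Δ[n] : SSet.{u}).Subcomplex).ι ≫ f = (faceUnion S).ι ≫ g

variable {S T : Set (Fin (n + 1))} {Y : SSet.{u}} {f g h : Δ[n] ⟶ Y}

lemma agreeOn_iff : AgreeOn S f g ↔
    ∀ m, ∀ z ∈ (faceUnion S : (Δ[n] : SSet.{u}).Subcomplex).obj m, f.app m z = g.app m z := by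
  constructor
  · intro h m z hz
    exact congr_app_apply h m ⟨z, hz⟩
  · intro h
    refine NatTrans.ext (funext fun m ↦ ?_)
    ext z
    exact h m z.1 z.2

lemma agreeOn_empty : AgreeOn ∅ f g := agreeOn_iff.2 fun _ _ ⟨_, h, _⟩ ↦ h.elim

lemma AgreeOn.mono (h : AgreeOn T f g) (hST : S ⊆ T) : AgreeOn S f g :=
  agreeOn_iff.2 fun m z hz ↦ agreeOn_iff.1 h m z (faceUnion_mono hST m hz)

lemma AgreeOn.trans (h₁ : AgreeOn S f g) (h₂ : AgreeOn S g h) : AgreeOn S f h := Eq.trans h₁ h₂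
lemma AgreeOn.symm (h₁ : AgreeOn S f g) : AgreeOn S g f := Eq.symm h₁

lemma AgreeOn.comp (h : AgreeOn S f g) {Z : SSet.{u}} (k : Y ⟶ Z) : AgreeOn S (f ≫ k) (g ≫ k) :=
  agreeOn_iff.2 fun m z hz ↦ congrArg (k.app m) (agreeOn_iff.1 h m z hz)

lemma AgreeOn.endo_comp_eq (h : AgreeOn S f g) {τ : Fin (n + 1) →o Fin (n + 1)} {r : Fin (n + 1)}
    (hr : r ∈ S) (hτ : ∀ x, τ x ≠ r) : endo τ ≫ f = endo τ ≫ g := by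
  refine NatTrans.ext (funext fun m ↦ ?_)
  ext z
  exact agreeOn_iff.1 h m _ ⟨r, hr, fun j ↦ hτ _⟩

/-- A nonempty union of faces, other than the boundary, contains a face `r` with a retraction of the
simplex on it which preserves the other faces of the union. -/
lemma exists_collapse (S : Finset (Fin (n + 1))) (hS : S.Nonempty) {c : Fin (n + 1)} (hc : c ∉ S) :
    ∃ r ∈ S, ∃ ρ : Fin (n + 1) →o Fin (n + 1), (∀ x, x ≠ r → ρ x = x) ∧ ρ r ∉ S := by
  -- Move the greatest element of `S` below `c` up by one or, if there is none, the least element of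
  -- `S` down by one; extremality, or `c ∉ S`, keeps the new value outside `S`.
  obtain h | h := (S.filter (· < c)).eq_empty_or_nonempty
  · have h₁ : ∀ x ∈ S, c < x := fun x hx ↦ by
      have : x ∉ S.filter (· < c) := by simp [h]
      simp only [Finset.mem_filter, not_and, not_lt] at this
      exact lt_of_le_of_ne (this hx) (by rintro rfl; exact hc hx)
    have h₂ := h₁ _ (S.min'_mem hS)
    set r := S.min' hS
    let r' : Fin (n + 1) := ⟨r - 1, by omega⟩
    have hr' : r'.1 + 1 = r.1 := by simp only [r']; omega
    refine ⟨r, S.min'_mem hS, ⟨fun x ↦ if x = r then r' else x, fun x y hxy ↦ ?_⟩,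
      fun x hx ↦ if_neg hx, ?_⟩
    · dsimp only
      split_ifs <;> omega
    · change (if r = r then r' else r) ∉ S
      rw [if_pos rfl]
      intro hr
      have := S.min'_le _ hr
      omega
  · have h₁ := (S.filter (· < c)).max'_mem h
    have h₂ := (S.filter (· < c)).le_max'
    set r := (S.filter (· < c)).max' h
    rw [Finset.mem_filter] at h₁
    let r' : Fin (n + 1) := ⟨r + 1, by omega⟩
    have hr' : r.1 + 1 = r'.1 := rfl
    refine ⟨r, h₁.1, ⟨fun x ↦ if x = r then r' else x, fun x y hxy ↦ ?_⟩,
      fun x hx ↦ if_neg hx, ?_⟩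
    · dsimp only
      split_ifs <;> omega
    · change (if r = r then r' else r) ∉ S
      rw [if_pos rfl]
      intro hr
      by_cases hrc : r' = c
      · exact hc (hrc ▸ hr)
      · have := h₂ _ (Finset.mem_filter.2 ⟨hr, by omega⟩)
        omega

/-- The vertices `x` and `y` of `X_n` are joined by an edge which is constant on the faces in
`S`. -/
def Joined (X : Bisimplicial.{u}) (S : Set (Fin (n + 1))) (x y : Δ[n] ⟶ X.X₀) : Prop :=
  ∃ γ : Δ[n] ⟶ X.X₁, γ ≫ X.src = x ∧ γ ≫ X.tgt = y ∧ AgreeOn S γ (x ≫ X.con)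

variable {X : Bisimplicial.{u}} {x y z : Δ[n] ⟶ X.X₀}

lemma Joined.agreeOn (h : Joined X S x y) : AgreeOn S x y := by
  obtain ⟨γ, hx, rfl, h⟩ := h
  refine AgreeOn.symm ((h.comp X.tgt).trans ?_)
  rw [Category.assoc, con_tgt, Category.comp_id]
  exact rfl

lemma Joined.refl (x : Δ[n] ⟶ X.X₀) : Joined X S x x := ⟨x ≫ X.con, by simp, by simp, rfl⟩

variable (hX : ReedyFibration X.toPoint)
include hX

lemma Joined.euclidean (h : Joined X S x z) (h' : Joined X S y z) : Joined X S x y := by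
  have h₁ := h.agreeOn.trans h'.agreeOn.symm
  obtain ⟨b, rfl, h₂, hb⟩ := h
  obtain ⟨a, rfl, h₃, ha⟩ := h'
  obtain ⟨c, hc, hc', h⟩ := exists_edge_const hX (faceUnion S : (Δ[n] : SSet.{u}).Subcomplex).ι a b
    (h₃.trans h₂.symm) (ha.trans ((h₁.symm.comp X.con).trans hb.symm))
  refine ⟨c, hc, hc', ?_⟩
  rw [Category.assoc]
  exact h

lemma Joined.symm (h : Joined X S x y) : Joined X S y x :=
  Joined.euclidean hX (Joined.refl y) h

lemma Joined.trans (h : Joined X S x y) (h' : Joined X S y z) : Joined X S x z :=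
  Joined.euclidean hX h (h'.symm hX)

/-- Let `γ` join `x` to `y`, constant on all faces in `S` but `r`. Its precomposite with the
collapse `ρ` agrees with `γ` on every face in `S`, face `r` included, since `ρ` fixes that face and
`y` is constant. Thus `γ` followed by the inverse of `endo ρ ≫ γ` is constant on `S`; it ends at
`endo ρ ≫ x = endo ρ ≫ y = y`. -/
lemma Joined.of_isConst (S : Finset (Fin (n + 1))) {c : Fin (n + 1)} (hc : c ∉ S) (hy : IsConst y)
    (h : Joined X ∅ x y) (hS : AgreeOn S x y) : Joined X S x y := by
  induction S using Finset.strongInduction with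
  | H S IH =>
    obtain rfl | hS' := S.eq_empty_or_nonempty
    · simpa using h
    obtain ⟨r, hr, ρ, hρ, hρ'⟩ := exists_collapse S hS' hc
    obtain ⟨γ, hx, hy', h₁⟩ := IH (S.erase r) (Finset.erase_ssubset hr) (by simp [hc])
      (hS.mono (by simp))
    have hρr (z) : ρ z ≠ r := by
      intro hz
      obtain h | h := eq_or_ne z r
      · rw [h] at hz
        exact hρ' (by rwa [hz])
      · exact h ((hρ z h).symm.trans hz)
    have h₂ : AgreeOn (S : Set (Fin (n + 1))) (endo ρ ≫ γ) γ := by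
      rw [agreeOn_iff]
      rintro m z ⟨s, hs, hz⟩
      obtain rfl | hsr := eq_or_ne s r
      · refine congrArg (γ.app m) (stdSimplex.ext _ _ fun j ↦ ?_)
        exact hρ _ (hz j)
      · have h₃ : s ∈ (S.erase r : Finset (Fin (n + 1))) := by simpa [hsr] using hs
        have h₄ : AgreeOn (S.erase r : Finset (Fin (n + 1))) γ (y ≫ X.con) :=
          h₁.trans ((hS.mono (by simp)).comp _)
        rw [agreeOn_iff] at h₄
        refine (h₄ m ((endo ρ).app m z) ⟨s, h₃, fun j ↦ ?_⟩).trans (Eq.trans ?_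
          (h₄ m z ⟨s, h₃, hz⟩).symm)
        · rw [asOrderHom_endo]
          obtain h | h := eq_or_ne (stdSimplex.asOrderHom z j) r
          · rw [h]
            rintro rfl
            exact hρ' hs
          · rw [hρ _ h]
            exact hz j
        · exact congrArg (X.con.app m) (congr_app_apply (hy ρ) m z)
    obtain ⟨c, hc₁, hc₂, hc₃⟩ := exists_edge_const hX
      (faceUnion S : (Δ[n] : SSet.{u}).Subcomplex).ι (endo ρ ≫ γ) γ
      (by rw [Category.assoc, hy', hy ρ]) h₂
    refine ⟨c, hc₁.trans hx, hc₂.trans ?_, ?_⟩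
    · rw [Category.assoc, hx, hS.endo_comp_eq hr hρr, hy ρ]
    · rw [← hx, Category.assoc]
      exact hc₃

/-- Every vertex of a row is joined to a degenerate one. -/
def RowConnected (X : Bisimplicial.{u}) : Prop :=
  ∀ (n : ℕ) (x : Δ[n] ⟶ X.X₀), ∃ b : Δ[n] ⟶ X.X₀, IsConst b ∧ Joined X ∅ x b

variable (hX' : RowConnected X)
include hX'

/-- Each of `x` and `y` is joined to the constant map at its value on the vertex `c`, and this
vertex lies in a face on which they agree. -/
lemma RowConnected.joined_of_agreeOn {c : Fin (n + 1)} (hc : c ∉ S) (hS : S.Nonempty)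
    (h : AgreeOn S x y) : Joined X ∅ x y := by
  have key (x) : Joined X ∅ x (endo ((OrderHom.const _) c) ≫ x) := by
    obtain ⟨b, hb, h⟩ := hX' n x
    refine Joined.euclidean hX h ?_
    obtain ⟨γ, h₁, h₂, -⟩ := h
    refine ⟨endo ((OrderHom.const _) c) ≫ γ, ?_, ?_, agreeOn_empty⟩
    · rw [Category.assoc, h₁]
    · rw [Category.assoc, h₂, hb]
  obtain ⟨s, hs⟩ := hS
  refine Joined.euclidean hX (key x) ?_
  rw [h.endo_comp_eq (τ := (OrderHom.const _) c) hs (fun _ ↦ by rintro rfl; exact hc hs)]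
  exact key y

/-- Join `y` to a constant `b` by `β`, and lift the restriction of `β` to `S` to an edge `β'`
starting at `x`. Its end agrees with `b` on `S`, so `Joined.of_isConst` corrects it to an edge `δ`
from `x` to `b` which equals `β` on `S`; then `δ` followed by the inverse of `β` is the required
edge. -/
lemma RowConnected.joined (S : Finset (Fin (n + 1))) {c : Fin (n + 1)} (hc : c ∉ S)
    (hS : S.Nonempty) (h : AgreeOn S x y) : Joined X S x y := by
  have hxy := hX'.joined_of_agreeOn hX hc hS h
  obtain ⟨b, hb, hyb⟩ := hX' n y
  have hyb' := hyb
  obtain ⟨β, h₁, h₂, -⟩ := hyb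
  obtain ⟨β', h₃, h₄⟩ := exists_edge hX (faceUnion S : (Δ[n] : SSet.{u}).Subcomplex).ι x
    ((faceUnion S : (Δ[n] : SSet.{u}).Subcomplex).ι ≫ β)
    (by rw [Category.assoc, h₁]; exact h)
  have h₅ : Joined X ∅ x (β' ≫ X.tgt) := ⟨β', h₃, rfl, agreeOn_empty⟩
  have h₆ : Joined X S (β' ≫ X.tgt) b := Joined.of_isConst hX S hc hb
    ((h₅.symm hX).trans hX (hxy.trans hX hyb')) (by
      rw [← h₂]
      exact AgreeOn.comp h₄ _)
  obtain ⟨ε, h₇, h₈, h₉⟩ := h₆.symm hX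
  obtain ⟨δ, e₁, e₂, e₃⟩ := exists_edge_relative hX (faceUnion S : (Δ[n] : SSet.{u}).Subcomplex).ι
    ε β' h₈ (h₉.trans (by
      rw [← Category.assoc β']
      exact h₆.agreeOn.symm.comp _))
  obtain ⟨c, c₁, c₂, c₃⟩ := exists_edge_const hX (faceUnion S : (Δ[n] : SSet.{u}).Subcomplex).ι
    β δ (by rw [h₂, e₂, h₇]) (by rw [e₃, h₄])
  refine ⟨c, by rw [c₁, e₁, h₃], by rw [c₂, h₁], ?_⟩
  rw [← Category.assoc δ, e₁, h₃] at c₃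
  exact c₃

/-- An extension `y` from the faces other than `r` may be wrong on face `r`. There it is joined to
`w` by an edge that is constant on the other faces, obtained by comparing `endo ρ ≫ y` with `R ≫ w`.
Glued with constant edges on those faces, it extends to an edge starting at `y`, whose other end
extends `w`. -/
lemma RowConnected.exists_extension (S : Finset (Fin (n + 1))) {c : Fin (n + 1)} (hc : c ∉ S)
    (hS : S.Nonempty) (w : (faceUnion S : (Δ[n] : SSet.{u}).Subcomplex).toSSet ⟶ X.X₀) :
    ∃ x : Δ[n] ⟶ X.X₀, (faceUnion S : (Δ[n] : SSet.{u}).Subcomplex).ι ≫ x = w := by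
  induction S using Finset.strongInduction with
  | H S IH =>
    obtain ⟨r, hr, ρ, hρ, hρ'⟩ := exists_collapse S hS hc
    have hρr (z) : ρ z ≠ r := by
      intro hz
      obtain h | h := eq_or_ne z r
      · rw [h] at hz
        exact hρ' (by rwa [hz])
      · exact h ((hρ z h).symm.trans hz)
    let R : (Δ[n] : SSet.{u}) ⟶ (faceUnion S : (Δ[n] : SSet.{u}).Subcomplex).toSSet :=
      Subfunctor.lift (endo ρ) (by
        rintro m _ ⟨z, rfl⟩
        exact ⟨r, hr, fun j ↦ hρr _⟩)
    have hR {m} (z : (Δ[n] : SSet.{u}).obj m) (hz : ∀ j, stdSimplex.asOrderHom z j ≠ r)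
        (hz') : R.app m z = ⟨z, hz'⟩ :=
      Subtype.ext (stdSimplex.ext _ _ fun j ↦ hρ _ (hz j))
    obtain hS' | hS' := (S.erase r).eq_empty_or_nonempty
    · refine ⟨R ≫ w, ?_⟩
      refine NatTrans.ext (funext fun m ↦ ?_)
      ext ⟨z, hz⟩
      refine congrArg (w.app m) (hR z ?_ _)
      obtain ⟨s, hs, hz⟩ := hz
      obtain rfl : s = r := by
        by_contra h
        have : s ∈ S.erase r := Finset.mem_erase.2 ⟨h, hs⟩
        simp [hS'] at this
      exact hz
    · have hle : (faceUnion (S.erase r : Finset (Fin (n + 1))) : (Δ[n] : SSet.{u}).Subcomplex) ≤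
        faceUnion S := faceUnion_mono (by simp)
      obtain ⟨y, hy⟩ := IH (S.erase r) (Finset.erase_ssubset hr) (by simp [hc]) hS'
        (Subcomplex.homOfLE hle ≫ w)
      have hy' {m} (z : (Δ[n] : SSet.{u}).obj m) (hz) (hz') : y.app m z = w.app m ⟨z, hz'⟩ :=
        congr_app_apply hy m ⟨z, hz⟩
      obtain ⟨γ, h₁, h₂, h₃⟩ := hX'.joined (x := endo ρ ≫ y) (y := R ≫ w) hX (S.erase r)
        (c := c) (by simp [hc]) hS' (by
          rw [agreeOn_iff]
          rintro m z ⟨s, hs, hz⟩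
          refine hy' ((endo ρ).app m z) ⟨s, hs, fun j ↦ ?_⟩ _
          rw [asOrderHom_endo]
          simp only [Finset.coe_erase, Set.mem_sdiff, Finset.mem_coe] at hs
          obtain h | h := eq_or_ne (stdSimplex.asOrderHom z j) r
          · rw [h]
            rintro rfl
            exact hρ' hs.1
          · rw [hρ _ h]
            exact hz j)
      rw [agreeOn_iff] at h₃
      have h₄ {m} (z : (Δ[n] : SSet.{u}).obj m) (hz : ∀ j, stdSimplex.asOrderHom z j ≠ r) :
          (endo ρ).app m z = z := stdSimplex.ext _ _ fun j ↦ hρ _ (hz j)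
      obtain ⟨η, h₅, h₆⟩ := exists_glue
        ((faceUnion (S.erase r : Finset (Fin (n + 1))) : (Δ[n] : SSet.{u}).Subcomplex).ι ≫
          y ≫ X.con) ((faceUnion {r} : (Δ[n] : SSet.{u}).Subcomplex).ι ≫ γ) (by
          rintro m z hz ⟨_, rfl, hz'⟩
          refine Eq.trans ?_ (h₃ m z hz).symm
          exact congrArg (fun t ↦ X.con.app m (y.app m t)) (h₄ z hz').symm)
      have h₇ : (faceUnion S : (Δ[n] : SSet.{u}).Subcomplex) =
          faceUnion (S.erase r : Finset (Fin (n + 1))) ⊔ faceUnion {r} := by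
        rw [← faceUnion_union]
        congr 1
        ext s
        by_cases hs : s = r <;> simp [hs, hr]
      obtain ⟨e, he, he'⟩ := exists_edge hX (faceUnion S : (Δ[n] : SSet.{u}).Subcomplex).ι y
        (Subcomplex.homOfLE h₇.le ≫ η) (by
          refine NatTrans.ext (funext fun m ↦ ?_)
          ext ⟨z, hz⟩
          obtain hz' | hz' := h₇.le m hz
          · refine Eq.trans ?_ (congrArg (X.src.app m) (h₅ m z hz' _)).symm
            exact (congr_app_apply X.con_src m _).symm
          · refine Eq.trans ?_ (congrArg (X.src.app m) (h₆ m z hz' _)).symm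
            refine Eq.trans ?_ (congr_app_apply h₁ m z).symm
            obtain ⟨_, rfl, hz'⟩ := hz'
            exact congrArg (y.app m) (h₄ z hz').symm)
      refine ⟨e ≫ X.tgt, ?_⟩
      rw [reassoc_of% he']
      refine NatTrans.ext (funext fun m ↦ ?_)
      ext ⟨z, hz⟩
      obtain hz' | hz' := h₇.le m hz
      · refine (congrArg (X.tgt.app m) (h₅ m z hz' _)).trans ?_
        exact (congr_app_apply X.con_tgt m _).trans (hy' z hz' _)
      · refine (congrArg (X.tgt.app m) (h₆ m z hz' _)).trans ?_
        refine (congr_app_apply h₂ m z).trans ?_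
        obtain ⟨_, rfl, hz'⟩ := hz'
        exact congrArg (w.app m) (hR z hz' _)

end

end Bisimplicial
-- Kan fibrations on diagonals from the condition on rows
section vertices

/-- A Kan fibration which is surjective on vertices is surjective. -/
lemma exists_lift_of_fibration {Y Z : SSet.{u}} (f : Y ⟶ Z) [Fibration f]
    (h : ∀ z : Z _⦋0⦌, ∃ y, f.app _ y = z) {q : ℕ} (g : Δ[q] ⟶ Z) : ∃ l : Δ[q] ⟶ Y, l ≫ f = g := by
  -- `C` is the vertex `0` of `Δ[q]`, and `F` contracts the simplex to it; hence a lift of this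
  -- vertex extends to the simplex.
  let C : (Δ[q] : SSet.{u}).Subcomplex :=
    { obj m := {x | ∀ j, stdSimplex.asOrderHom x j = 0}
      map _ _ hx j := hx _ }
  let F : Fin (q + 1) × Fin (1 + 1) →o Fin (q + 1) :=
    { toFun x := if x.2 = 0 then 0 else x.1
      monotone' := by
        rintro ⟨a, s⟩ ⟨b, t⟩ ⟨hab, hst⟩
        dsimp at hab hst ⊢
        split_ifs <;> grind }
  have hC : IsDeformation C (stdSimplexProdMap F) 1 :=
    { endι_H := by
        ext m x
        apply stdSimplex.ext
        intro j
        exact (rfl : F (_, 1) = _)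
      mem_of_mem := by
        rintro m b t hb j
        change ite _ _ _ = _
        split_ifs
        exacts [rfl, hb j]
      mem_of_end b j := (rfl : F (stdSimplex.asOrderHom b j, 1 - 1) = 0) }
  have han : anodyneExtensions C.ι := hC.anodyne_preimage (𝟙 _)
  obtain ⟨y, hy⟩ := h (g.app _ (stdSimplex.objEquiv.symm (SimplexCategory.Hom.mk (OrderHom.const _ 0))))
  obtain ⟨l, -, hl⟩ := exists_lift_of_anodyne han f (SSet.const y) g (by
    refine NatTrans.ext (funext fun m ↦ ?_)
    ext ⟨x, hx⟩
    have h₁ : x = Δ[q].map (SimplexCategory.const m.unop ⦋0⦌ 0).op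
      (stdSimplex.objEquiv.symm (SimplexCategory.Hom.mk (OrderHom.const _ 0))) :=
      stdSimplex.ext _ _ fun j ↦ hx j
    change f.app m (Y.map _ y) = g.app m x
    rw [h₁]
    refine (NatTrans.naturality_apply f _ y).trans ?_
    rw [hy]
    exact (NatTrans.naturality_apply g _ _).symm)
  exact ⟨l, hl⟩

end vertices

namespace Bisimplicial

section

variable {E B : Bisimplicial.{u}} {p : E ⟶ B} (hp : ReedyFibration p)
  (hE : ReedyFibration E.toPoint) (hE' : RowConnected E)
  (hB : ReedyFibration B.toPoint) (hB' : RowConnected B)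

include hp hE hE' hB hB'

/-- Any extension `y` of `w` has an image agreeing with `x` on `S`, hence joined to `x` by an edge
constant there. Lifting this edge from `y`, constantly on `S`, gives the solution at its other end.
-/
lemma exists_lift_of_rowConnected {n : ℕ} (S : Finset (Fin (n + 1))) {c : Fin (n + 1)} (hc : c ∉ S)
    (hS : S.Nonempty) (w : (faceUnion S : (Δ[n] : SSet.{u}).Subcomplex).toSSet ⟶ E.X₀)
    (x : Δ[n] ⟶ B.X₀) (h : w ≫ (col _).map p = (faceUnion S).ι ≫ x) :
    ∃ y : Δ[n] ⟶ E.X₀, (faceUnion S : (Δ[n] : SSet.{u}).Subcomplex).ι ≫ y = w ∧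
      y ≫ (col _).map p = x := by
  obtain ⟨y, rfl⟩ := hE'.exists_extension hE S hc hS w
  obtain ⟨γ, h₁, h₂, h₃⟩ := hB'.joined (x := y ≫ (col _).map p) (y := x) hB S hc hS h
  obtain ⟨e, he, he', he''⟩ := hp.exists_edge (faceUnion S : (Δ[n] : SSet.{u}).Subcomplex).ι y
    ((faceUnion S : (Δ[n] : SSet.{u}).Subcomplex).ι ≫ y ≫ E.con) γ
    (by rw [Category.assoc, Category.assoc, con_src, Category.comp_id])
    (Eq.trans h₃ (by simp only [Category.assoc, vert_naturality])) h₁.symm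
  refine ⟨e ≫ E.tgt, ?_, ?_⟩
  · rw [reassoc_of% he', con_tgt, Category.comp_id]
  · rw [Category.assoc, vert_naturality, reassoc_of% he'', h₂]

/-- In transposed form, the gap map from `E^Δ[n]` to the pullback over the horn must be surjective
on `q`-simplices. It is a fibration, so vertices suffice. -/
theorem horizontallyKan_of_rowConnected : HorizontallyKan p := by
  intro n q k hn
  have hS : (({k}ᶜ : Finset (Fin (n + 1))) : Set (Fin (n + 1))) = {k}ᶜ := by simp
  have hne : ({k}ᶜ : Finset (Fin (n + 1))).Nonempty := by
    rw [Finset.nonempty_iff_ne_empty, Ne, Finset.compl_eq_empty_iff]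
    intro h
    have := congrArg Finset.card h
    simp at this
    omega
  rw [← hS]
  set S : Finset (Fin (n + 1)) := {k}ᶜ
  let i := Subcomplex.homOfLE (le_top : (faceUnion S : (Δ[n] : SSet.{u}).Subcomplex) ≤ ⊤)
  let sq := Functor.PullbackObjObj.ofHasPullback power i p
  have := hp.fibration_power sq
  have key : HasLiftingProperty (Subcomplex.homOfLE (bot_le : ⊥ ≤ (⊤ : (Δ[q] : SSet.{u}).Subcomplex)))
      sq.π := by
    refine ⟨fun {f g} s ↦ ?_⟩
    have hπ (z) : ∃ y, sq.π.app (op ⦋0⦌) y = z := by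
      obtain ⟨y, h₁, h₂⟩ := exists_lift_of_rowConnected hp hE hE' hB hB' S (c := k) (by simp [S]) hne
        (sq.fst.app _ z) ((Subcomplex.topIso _).inv ≫ sq.snd.app _ z)
        (congr_app_apply sq.isPullback.w _ z)
      refine ⟨(Subcomplex.topIso _).hom ≫ y, ext_of_isPullback sq.isPullback _ _ ?_ ?_⟩
      · exact (congr_app_apply sq.π_fst _ _).trans h₁
      · refine (congr_app_apply sq.π_snd _ _).trans ?_
        change ((Subcomplex.topIso _).hom ≫ y) ≫ (col _).map p = _
        rw [Category.assoc, h₂]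
        rfl
    obtain ⟨l, hl⟩ := exists_lift_of_fibration sq.π hπ ((Subcomplex.topIso _).inv ≫ g)
    refine ⟨⟨(Subcomplex.topIso _).hom ≫ l, ?_, ?_⟩⟩
    · refine NatTrans.ext (funext fun m ↦ ?_)
      ext ⟨z, hz⟩
      exact hz.elim
    · rw [Category.assoc, hl, Iso.hom_inv_id_assoc]
  have := liftsAlong_of_hasLiftingProperty _ _ (boxPushout i _)
    ((powerAdjunction.hasLiftingProperty_iff (boxPushout i _) sq).2 key)
  convert this using 1
  refine le_antisymm le_sup_left (sup_le le_rfl ?_)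
  rintro d z ⟨-, h⟩
  exact h.elim

/-- A Reedy fibration between suitable Reedy fibrant objects induces a Kan fibration on diagonals. -/
theorem fibration_diagonal_of_rowConnected : Fibration (diagonal.map p) :=
  hp.fibration_diagonal (horizontallyKan_of_rowConnected hp hE hE' hB hB')

end

end Bisimplicial
-- Connected components and the diagonal theorem
section components

variable {A B : SSet.{u}}

/-- The connected component of a simplex. -/
def component {m : SimplexCategoryᵒᵖ} (b : B.obj m) : π₀ B :=
  π₀.mk (B.map (SimplexCategory.const ⦋0⦌ m.unop 0).op b)

lemma component_map {m n : SimplexCategoryᵒᵖ} (θ : m ⟶ n) (b : B.obj m) :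
    component (B.map θ b) = component b := by
  have h₀ : (SimplexCategory.const ⦋0⦌ m.unop 0) =
      SimplexCategory.δ 1 ≫ SimplexCategory.mkOfLe 0 (θ.unop.toOrderHom 0) (Fin.zero_le _) := by
    ext i : 3
    fin_cases i
    rfl
  have h₁ : SimplexCategory.const ⦋0⦌ n.unop 0 ≫ θ.unop =
      SimplexCategory.δ 0 ≫ SimplexCategory.mkOfLe 0 (θ.unop.toOrderHom 0) (Fin.zero_le _) := by
    ext i : 3
    fin_cases i
    rfl
  have h₂ (f : ⦋0⦌ ⟶ ⦋1⦌) : B.map f.op (B.map (SimplexCategory.mkOfLe 0 (θ.unop.toOrderHom 0)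
      (Fin.zero_le _)).op b) = B.map (f ≫ SimplexCategory.mkOfLe 0 (θ.unop.toOrderHom 0)
        (Fin.zero_le _)).op b := by simp
  have h₃ : B.map (SimplexCategory.const ⦋0⦌ n.unop 0).op (B.map θ b) =
    B.map (SimplexCategory.const ⦋0⦌ n.unop 0 ≫ θ.unop).op b :=
    (ConcreteCategory.congr_hom (B.map_comp θ (SimplexCategory.const ⦋0⦌ n.unop 0).op) b).symm
  unfold component
  rw [h₃, h₁, h₀]
  exact (π₀.sound (Edge.mk (B.map (SimplexCategory.mkOfLe 0 (θ.unop.toOrderHom 0)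
      (Fin.zero_le _)).op b) (h₂ _) (h₂ _))).symm

lemma mapπ₀_component (f : A ⟶ B) {m : SimplexCategoryᵒᵖ} (a : A.obj m) :
    mapπ₀ f (component a) = component (f.app m a) :=
  congrArg π₀.mk (NatTrans.naturality_apply f _ a)

lemma component_eq_mk (b : B _⦋0⦌) : component b = π₀.mk b := by
  have : SimplexCategory.const ⦋0⦌ (unop (op ⦋0⦌)) 0 = 𝟙 _ := by
    ext i : 3
    fin_cases i
    rfl
  rw [component, this]
  simp

/-- The components meeting the image of `f` form a subcomplex whose inclusion is a fibration, as a
simplex belongs to it once one of its vertices does. Lifting the identity of `B` along `f` shows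
that it is all of `B`. -/
lemma surjective_mapπ₀_of_anodyne {f : A ⟶ B} (hf : anodyneExtensions f) :
    Function.Surjective (mapπ₀ f) := by
  let C : B.Subcomplex :=
    { obj m := {b | component b ∈ Set.range (mapπ₀ f)}
      map θ b hb := by
        change component (B.map θ b) ∈ Set.range (mapπ₀ f)
        rwa [component_map] }
  have : Fibration C.ι := by
    rw [modelCategoryQuillen.fibration_iff]
    intro _ _ i hi
    simp only [J, MorphismProperty.iSup_iff] at hi
    obtain ⟨m, ⟨k⟩⟩ := hi
    refine ⟨fun {a b} sq ↦ ?_⟩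
    let v : (Δ[m + 1] : SSet.{u}) _⦋0⦌ :=
      stdSimplex.objEquiv.symm (SimplexCategory.const ⦋0⦌ ⦋m + 1⦌ k)
    have hv : v ∈ (Λ[m + 1, k] : (Δ[m + 1] : SSet.{u}).Subcomplex).obj _ := by
      rw [← faceUnion_compl]
      obtain ⟨i, hi⟩ := exists_ne k
      exact ⟨i, hi, fun j ↦ Ne.symm hi⟩
    have hb : component (b.app _ v) ∈ Set.range (mapπ₀ f) := by
      have h₁ : component (a.app _ ⟨v, hv⟩).1 ∈ Set.range (mapπ₀ f) := (a.app _ ⟨v, hv⟩).2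
      have h₂ : (a.app _ ⟨v, hv⟩).1 = b.app _ v := congr_app_apply sq.w _ ⟨v, hv⟩
      rwa [h₂] at h₁
    refine ⟨⟨Subfunctor.lift b ?_, ?_, ?_⟩⟩
    · rintro d _ ⟨x, rfl⟩
      change component (b.app d x) ∈ Set.range (mapπ₀ f)
      have hx : x = Δ[m + 1].map (stdSimplex.objEquiv x).op (yonedaEquiv (𝟙 _)) :=
        stdSimplex.ext _ _ fun j ↦ rfl
      have hv' : v = Δ[m + 1].map (stdSimplex.objEquiv v).op (yonedaEquiv (𝟙 _)) :=
        stdSimplex.ext _ _ fun j ↦ rfl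
      rw [hx, NatTrans.naturality_apply, component_map]
      rwa [hv', NatTrans.naturality_apply, component_map] at hb
    · ext d x
      exact Subtype.ext (congr_app_apply sq.w d x).symm
    · rfl
  obtain ⟨l, -, hl⟩ := exists_lift_of_anodyne hf C.ι (Subfunctor.lift f (by
    rintro d _ ⟨x, rfl⟩
    exact ⟨component x, mapπ₀_component f x⟩)) (𝟙 B) rfl
  intro c
  induction c with
  | mk b =>
    have := (l.app _ b).2
    rw [← component_eq_mk]
    rwa [show (l.app _ b).1 = b from congr_app_apply hl _ b] at this

end components

namespace Bisimplicial

/-- The map of rows given by a horizontal operator. -/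
def horiz (X : Bisimplicial.{u}) {m n : SimplexCategoryᵒᵖ} (θ : m ⟶ n) :
    (row m).obj X ⟶ (row n).obj X where
  app q := X.map (show (m, q) ⟶ (n, q) from (θ, 𝟙 q))
  naturality q r ψ := by
    ext x
    refine (X.map_map _ _ _).trans ((congrArg (fun t : (m, q) ⟶ (n, r) ↦ X.map t x) ?_).trans
      (X.map_map _ _ _).symm)
    exact Prod.ext ((Category.id_comp _).trans (Category.comp_id _).symm)
      ((Category.comp_id _).trans (Category.id_comp _).symm)

variable {X Y : Bisimplicial.{u}}

lemma horiz_naturality (f : X ⟶ Y) {m n : SimplexCategoryᵒᵖ} (θ : m ⟶ n) :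
    X.horiz θ ≫ (row n).map f = (row m).map f ≫ Y.horiz θ := by
  ext q x
  exact NatTrans.naturality_apply f (show (m, q) ⟶ (n, q) from (θ, 𝟙 q)) x

/-- Every connected component of a row contains a degenerate vertex. -/
def DegenerateComponents (X : Bisimplicial.{u}) : Prop :=
  ∀ n : ℕ, Function.Surjective (mapπ₀ (X.horiz (SimplexCategory.const ⦋n⦌ ⦋0⦌ 0).op))

lemma DegenerateComponents.of_reedyAnodyne (hX : X.DegenerateComponents) {f : X ⟶ Y}
    (hf : reedyAnodyne f) : Y.DegenerateComponents := by
  intro n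
  have h : Function.Surjective (mapπ₀ (X.horiz (SimplexCategory.const ⦋n⦌ ⦋0⦌ 0).op ≫
      (row (op ⦋n⦌)).map f)) := by
    intro z
    obtain ⟨y, rfl⟩ := surjective_mapπ₀_of_anodyne (anodyne_row hf (op ⦋n⦌)) z
    obtain ⟨x, rfl⟩ := hX n y
    exact ⟨x, mapπ₀_comp_apply _ _ _⟩
  intro z
  obtain ⟨x, rfl⟩ := h z
  rw [horiz_naturality]
  exact ⟨_, (mapπ₀_comp_apply _ _ _).symm⟩

/-- In a Reedy fibrant object edges can be composed and inverted, so a single edge replaces a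
zigzag. -/
lemma joined_of_mk_eq (hX : ReedyFibration X.toPoint) {n : ℕ} {x y : ((row (op ⦋n⦌)).obj X) _⦋0⦌}
    (h : π₀.mk x = π₀.mk y) : Joined X ∅ (yonedaEquiv (X := X.X₀).symm x)
      (yonedaEquiv (X := X.X₀).symm y) := by
  rw [π₀.mk_eq_mk_iff] at h
  induction h with
  | rel x y h =>
    obtain ⟨e⟩ := h
    refine ⟨yonedaEquiv.symm e.edge, ?_, ?_, agreeOn_empty⟩
    · exact (yonedaEquiv_symm_comp (Y := X.X₀) _ _).trans (congrArg _ e.src_eq)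
    · exact (yonedaEquiv_symm_comp (Y := X.X₀) _ _).trans (congrArg _ e.tgt_eq)
  | refl x => exact .refl _
  | symm x y _ h => exact h.symm hX
  | trans x y z _ _ h h' => exact h.trans hX h'

lemma DegenerateComponents.rowConnected (hX' : X.DegenerateComponents)
    (hX : ReedyFibration X.toPoint) : X.RowConnected := by
  intro n x
  obtain ⟨c, hc⟩ := hX' n (π₀.mk (yonedaEquiv (X := X.X₀) x))
  induction c with
  | mk b =>
    rw [mapπ₀_mk] at hc
    have := joined_of_mk_eq hX hc.symm
    rw [Equiv.symm_apply_apply] at this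
    refine ⟨_, fun τ ↦ ?_, this⟩
    refine (yonedaEquiv_symm_naturality_left _ _).trans (congrArg _ ?_)
    refine (X.map_map _ _ _).trans (congrArg (fun t : (op ⦋0⦌, op ⦋0⦌) ⟶ (op ⦋n⦌, op ⦋0⦌) ↦ X.map t b) ?_)
    exact Prod.ext rfl (Category.id_comp _)

/-- If a square of bisimplicial sets is homotopy Cartesian in each row, and the components of the
rows on the right-hand side contain degenerate vertices, then the diagonal square is homotopy
Cartesian. -/
theorem isHomotopyCartesian_diagonal {sq : Square Bisimplicial.{u}}
    (h : ∀ n : ℕ, IsHomotopyCartesian (sq.map (row (op ⦋n⦌))))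
    (h₂ : sq.X₂.DegenerateComponents) (h₄ : sq.X₄.DegenerateComponents) :
    IsHomotopyCartesian (sq.map diagonal) := by
  -- Both ends are made Reedy fibrant so that the diagonal of `p` is a Kan fibration. Pulling `p`
  -- back along `j` then factors the original `f₂₄`; its first factor is a rowwise weak equivalence
  -- because the pullback of `j` along `p` is anodyne in each row.
  obtain ⟨B, j, q, hj, hq, -⟩ := exists_reedy_factorization sq.X₄.toPoint
  obtain rfl : q = B.toPoint := by ext; rfl
  obtain ⟨E, i, p, hi, hp, fac⟩ := exists_reedy_factorization (sq.f₂₄ ≫ j)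
  have hE : ReedyFibration E.toPoint := reedyJ.rlp.comp_mem p B.toPoint hp hq
  have hpd : Fibration (diagonal.map p) := fibration_diagonal_of_rowConnected hp hE
    ((h₂.of_reedyAnodyne hi).rowConnected hE) hq ((h₄.of_reedyAnodyne hj).rowConnected hq)
  have sq₁ := IsPullback.of_hasPullback j p
  set E' := pullback j p
  let i' : sq.X₂ ⟶ E' := pullback.lift sq.f₂₄ i fac.symm
  have h₁ (n : ℕ) : Fibration ((row (op ⦋n⦌)).map (pullback.fst j p)) := by
    have := hp.fibration_row n
    exact fibration_of_isPullback (sq₁.map (row (op ⦋n⦌)))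
  have h₁' : Fibration (diagonal.map (pullback.fst j p)) :=
    fibration_of_isPullback (sq₁.map diagonal)
  have hi' (n : ℕ) : IsWeakEquivalence ((row (op ⦋n⦌)).map i') := by
    have := hp.fibration_row n
    refine IsWeakEquivalence.of_postcomp (g := (row (op ⦋n⦌)).map (pullback.snd j p))
      (isWeakEquivalence_of_anodyne
        (anodyne_of_isPullback (sq₁.map (row (op ⦋n⦌))).flip (anodyne_row hj _))) ?_
    rw [← Functor.map_comp, pullback.lift_snd]
    exact isWeakEquivalence_of_anodyne (anodyne_row hi _)
  have sq₂ := IsPullback.of_hasPullback sq.f₃₄ (pullback.fst j p)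
  let l : sq.X₁ ⟶ pullback sq.f₃₄ (pullback.fst j p) :=
    pullback.lift sq.f₁₃ (sq.f₁₂ ≫ i') (by rw [Category.assoc, pullback.lift_fst, sq.fac])
  have e₁ : i' ≫ pullback.fst j p = sq.f₂₄ := pullback.lift_fst _ _ _
  have e₂ : l ≫ pullback.fst sq.f₃₄ (pullback.fst j p) = sq.f₁₃ := pullback.lift_fst _ _ _
  have e₃ : l ≫ pullback.snd sq.f₃₄ (pullback.fst j p) = sq.f₁₂ ≫ i' := pullback.lift_snd _ _ _
  have hl (n : ℕ) : IsWeakEquivalence ((row (op ⦋n⦌)).map l) :=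
    @IsHomotopyCartesian.isWeakEquivalence_lift _ (h n) _ _ _ _ (h₁ n) (hi' n)
      (((row _).map_comp _ _).symm.trans (congrArg (row _).map e₁)) _ _ (sq₂.map _) _
      (((row _).map_comp _ _).symm.trans (congrArg (row _).map e₂))
      (((row _).map_comp _ _).symm.trans ((congrArg (row _).map e₃).trans ((row _).map_comp _ _)))
  exact IsHomotopyCartesian.mk' h₁' (isWeakEquivalence_diagonal i' hi')
    ((diagonal.map_comp _ _).symm.trans (congrArg diagonal.map e₁)) (sq₂.map diagonal)
    ((diagonal.map_comp _ _).symm.trans (congrArg diagonal.map e₂))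
    ((diagonal.map_comp _ _).symm.trans ((congrArg diagonal.map e₃).trans (diagonal.map_comp _ _)))
    (isWeakEquivalence_diagonal l hl)

end Bisimplicial
end SSet

/-! ### Transport along isomorphisms and components of presheaf values -/

/-- The image of a square under isomorphic functors. -/
def CategoryTheory.Square.mapIsoOfNatIso {C D : Type*} [Category* C] [Category* D] (Q : Square C)
    {F G : C ⥤ D} (α : F ≅ G) : Q.map F ≅ Q.map G :=
  Square.isoMk (α.app _) (α.app _) (α.app _) (α.app _) (α.hom.naturality _)
    (α.hom.naturality _) (α.hom.naturality _) (α.hom.naturality _)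

namespace SSet

lemma IsWeaklyContractible.of_iso {X Y : SSet.{u}} (e : X ≅ Y) (h : IsWeaklyContractible X) :
    IsWeaklyContractible Y := by
  have : toUnit Y = e.inv ≫ toUnit X := toUnit_unique _ _
  rw [IsWeaklyContractible, this]
  exact (isWeakEquivalence_of_isIso e.inv).comp h

lemma isWeaklyContractible_iff {X Y : SSet.{u}} (f : X ⟶ Y) (hY : IsIso (toUnit Y)) :
    IsWeaklyContractible X ↔ IsWeakEquivalence f := by
  have h := isWeakEquivalence_of_isIso (toUnit Y)
  rw [IsWeaklyContractible, show toUnit X = f ≫ toUnit Y from toUnit_unique _ _]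
  exact ⟨fun h' ↦ IsWeakEquivalence.of_postcomp h h', fun h' ↦ h'.comp h⟩

end SSet

namespace SSet.Bisimplicial

/-- The rows of an uncurried bisimplicial set. -/
def rowUncurryIso (n : SimplexCategoryᵒᵖ) :
    Functor.uncurry ⋙ row n ≅ (evaluation SimplexCategoryᵒᵖ SSet.{u}).obj n :=
  NatIso.ofComponents (fun Z ↦ NatIso.ofComponents (fun q ↦ Iso.refl _) (fun {q r} f ↦ by
    refine (Category.comp_id _).trans (Eq.trans ?_ (Category.id_comp _).symm)
    exact (congrArg (fun t ↦ NatTrans.app t q ≫ (Z.obj n).map f) (Z.map_id n)).trans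
      (Category.id_comp _)))

lemma surjective_mapπ₀_horiz (Z : SimplexCategoryᵒᵖ ⥤ SSet.{u}) {m n : SimplexCategoryᵒᵖ}
    (θ : m ⟶ n) (h : Function.Surjective (mapπ₀ (Z.map θ))) :
    Function.Surjective (mapπ₀ (horiz (Functor.uncurry.obj Z) θ)) := by
  have e : horiz (Functor.uncurry.obj Z) θ =
      (rowUncurryIso m).hom.app Z ≫ Z.map θ ≫ (rowUncurryIso n).inv.app Z := by
    refine NatTrans.ext (funext fun q ↦ ?_)
    change (Z.map θ).app q ≫ (Z.obj n).map (𝟙 q) = 𝟙 _ ≫ (Z.map θ).app q ≫ 𝟙 _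
    simp
  intro z
  obtain ⟨y, hy⟩ := h (mapπ₀ ((rowUncurryIso n).hom.app Z) z)
  refine ⟨mapπ₀ ((rowUncurryIso m).inv.app Z) y, ?_⟩
  rw [e, ← mapπ₀_comp_apply, Iso.inv_hom_id_app_assoc, mapπ₀_comp_apply, hy, ← mapπ₀_comp_apply,
    Iso.hom_inv_id_app, mapπ₀_id_apply]

end SSet.Bisimplicial

variable {C : Type u} [SmallCategory C]

/-- The induced map on components of the values of `F` is surjective. -/
def IsSurjectiveOnComponents (F : Cᵒᵖ ⥤ SSet.{u}) {A B : Cᵒᵖ ⥤ Type u} (g : A ⟶ B) : Prop :=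
  Function.Surjective (SSet.mapπ₀ ((presheafValue F).map g.op))

lemma IsSurjectiveOnComponents.comp {F : Cᵒᵖ ⥤ SSet.{u}} {A B D : Cᵒᵖ ⥤ Type u} {f : A ⟶ B}
    {g : B ⟶ D} (hf : IsSurjectiveOnComponents F f) (hg : IsSurjectiveOnComponents F g) :
    IsSurjectiveOnComponents F (f ≫ g) := by
  intro z
  obtain ⟨y, rfl⟩ := hf z
  obtain ⟨x, rfl⟩ := hg y
  exact ⟨x, by rw [op_comp, Functor.map_comp, SSet.mapπ₀_comp_apply]⟩

lemma isSurjectiveOnComponents_of_isIso (F : Cᵒᵖ ⥤ SSet.{u}) {A B : Cᵒᵖ ⥤ Type u} (f : A ⟶ B)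
    [IsIso f] : IsSurjectiveOnComponents F f := by
  intro z
  refine ⟨SSet.mapπ₀ ((presheafValue F).map (inv f).op) z, ?_⟩
  rw [← SSet.mapπ₀_comp_apply, ← Functor.map_comp, ← op_comp, IsIso.hom_inv_id]
  simp

lemma isSurjectiveOnComponents_yoneda_map {F : Cᵒᵖ ⥤ SSet.{u}} {X Y : C} (p : Y ⟶ X)
    (h : Function.Surjective (SSet.mapπ₀ (F.map p.op))) :
    IsSurjectiveOnComponents F (yoneda.map p) := by
  have e : (presheafValue F).map (yoneda.map p).op = (presheafValueYonedaIso F).hom.app (op X) ≫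
      F.map p.op ≫ (presheafValueYonedaIso F).inv.app (op Y) := by
    rw [← Category.assoc]
    exact (Iso.eq_comp_inv ((presheafValueYonedaIso F).app _)).2
      ((presheafValueYonedaIso F).hom.naturality p.op)
  intro z
  obtain ⟨y, hy⟩ := h (SSet.mapπ₀ ((presheafValueYonedaIso F).hom.app (op Y)) z)
  refine ⟨SSet.mapπ₀ ((presheafValueYonedaIso F).inv.app (op X)) y, ?_⟩
  rw [e, ← SSet.mapπ₀_comp_apply, Iso.inv_hom_id_app_assoc, SSet.mapπ₀_comp_apply, hy,
    ← SSet.mapπ₀_comp_apply, Iso.hom_inv_id_app, SSet.mapπ₀_id_apply]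

/-! ### Products with powers of the interval and the theorem -/

namespace RepresentableInterval

variable (J : RepresentableInterval C)

lemma isSurjectiveOnComponents_fst {F : Cᵒᵖ ⥤ SSet.{u}}
    (hF : J.IsInvariant (F ⋙ SSet.π₀Functor)) (A : Cᵒᵖ ⥤ Type u) [A.IsRepresentable] :
    IsSurjectiveOnComponents F (fst A J.I) := by
  have := J.isRepresentable A.reprX
  let e := (yoneda.obj A.reprX ⊗ J.I).reprW
  let p := yoneda.preimage (e.hom ≫ fst _ _)
  have hp : yoneda.map p = e.hom ≫ fst _ _ := yoneda.map_preimage _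
  have h : fst A J.I = (A.reprW.inv ▷ J.I) ≫ e.inv ≫ yoneda.map p ≫ A.reprW.hom := by
    rw [hp]
    simp
  rw [h]
  exact (isSurjectiveOnComponents_of_isIso F _).comp ((isSurjectiveOnComponents_of_isIso F _).comp
    ((isSurjectiveOnComponents_yoneda_map p (hF _ _ e p hp).2).comp
      (isSurjectiveOnComponents_of_isIso F _)))

/-- The endofunctor `X ↦ X × I` of `C`. -/
noncomputable def prod : C ⥤ C :=
  Functor.essImage.liftFunctor (yoneda ⋙ tensorRight J.I) yoneda
    (fun X ↦ have := J.isRepresentable X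
      ⟨_, ⟨(yoneda.obj X ⊗ J.I).reprW⟩⟩)

/-- The objects `X × I` represent the products. -/
noncomputable def prodIso : J.prod ⋙ yoneda ≅ yoneda ⋙ tensorRight J.I :=
  Functor.essImage.liftFunctorCompIso _ _ _

/-- The endofunctor `X ↦ X × Iⁿ` of `C`. -/
noncomputable def iteratedProd (n : ℕ) : C ⥤ C :=
  match n with
  | .zero => 𝟭 C
  | .succ n => iteratedProd n ⋙ J.prod

/-- The first coordinates and the last coordinate. -/
def powSuccIso (n : ℕ) : J.pow (n + 1) ≅ J.pow n ⊗ J.I :=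
  NatIso.ofComponents (fun Y ↦
    { hom := ↾fun s ↦ (fun k ↦ s k.castSucc, s (Fin.last n))
      inv := ↾fun s ↦ Fin.snoc (α := fun _ ↦ J.I.obj Y) s.1 s.2
      hom_inv_id := by
        ext s
        exact Fin.snoc_init_self (α := fun _ ↦ J.I.obj Y) s
      inv_hom_id := by
        ext s
        refine Prod.ext ?_ ?_
        · funext k
          exact Fin.snoc_castSucc (α := fun _ ↦ J.I.obj Y) _ _ _
        · exact Fin.snoc_last (α := fun _ ↦ J.I.obj Y) _ _ })

/-- The presheaf `I⁰` is terminal. -/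
lemma pow_zero_ext {A : Cᵒᵖ ⥤ Type u} (f g : A ⟶ J.pow 0) : f = g := by
  ext Y x
  funext k
  exact k.elim0

instance isIso_fst_pow_zero (A : Cᵒᵖ ⥤ Type u) : IsIso (fst A (J.pow 0)) :=
  ⟨lift (𝟙 _) { app _ := ↾fun _ k ↦ k.elim0
                naturality _ _ _ := by
                  ext
                  funext k
                  exact k.elim0 }, by
    ext1
    · simp
    · exact J.pow_zero_ext _ _, by simp⟩

/-- The objects `X × Iⁿ` represent the products. -/
noncomputable def iteratedProdIso (n : ℕ) :
    J.iteratedProd n ⋙ yoneda ≅ yoneda ⋙ tensorRight (J.pow n) :=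
  match n with
  | .zero => NatIso.ofComponents (fun X ↦ (asIso (fst (yoneda.obj X) (J.pow 0))).symm) (fun f ↦ by
      rw [← cancel_mono (fst _ (J.pow 0))]
      simp [iteratedProd])
  | .succ n => Functor.associator _ _ _ ≪≫ Functor.isoWhiskerLeft (J.iteratedProd n) J.prodIso ≪≫
      (Functor.associator _ _ _).symm ≪≫
      Functor.isoWhiskerRight (iteratedProdIso n) (tensorRight J.I) ≪≫
      NatIso.ofComponents (fun X ↦ α_ _ _ _ ≪≫ whiskerLeftIso _ (J.powSuccIso n).symm) (fun f ↦ by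
        simp [whisker_exchange])

lemma isRepresentable_pow (X : C) (n : ℕ) : (yoneda.obj X ⊗ J.pow n).IsRepresentable :=
  .mk' ((J.iteratedProdIso n).app X)

lemma squares_iteratedProd {P : CDStructure C} (hP : J.StableUnderProduct P) {Q : Square C}
    (hQ : P.squares Q) (n : ℕ) : P.squares (Q.map (J.iteratedProd n)) := by
  induction n with
  | zero => exact hQ
  | succ n IH => exact hP _ _ IH ⟨(Q.map (J.iteratedProd n)).mapIsoOfNatIso J.prodIso⟩

variable (F : Cᵒᵖ ⥤ SSet.{u})

open SSet.Bisimplicial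

/-- The presheaf of bisimplicial sets `X ↦ F(X × I^•)`. -/
abbrev bisimplicialPresheaf : Cᵒᵖ ⥤ SSet.Bisimplicial.{u} :=
  J.singBisimplicial F ⋙ Functor.uncurry

/-- The diagonal is the singular construction. -/
def diagonalIso : J.bisimplicialPresheaf F ⋙ diagonal ≅ J.sing F :=
  NatIso.ofComponents (fun X ↦ NatIso.ofComponents (fun n ↦ Iso.refl _))

/-- The rows are the values of `F` on the presheaves `X × Iⁿ`. -/
def rowPresheafIso (n : ℕ) : J.bisimplicialPresheaf F ⋙ row (op ⦋n⦌) ≅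
    (yoneda ⋙ tensorRight (J.pow n)).op ⋙ presheafValue F :=
  Functor.isoWhiskerLeft (J.singBisimplicial F) (rowUncurryIso (op ⦋n⦌)) ≪≫
    NatIso.ofComponents (fun X ↦ Iso.refl _)

/-- The rows are the values of `F` on the objects `X × Iⁿ`. -/
noncomputable def rowIteratedProdIso (n : ℕ) : J.bisimplicialPresheaf F ⋙ row (op ⦋n⦌) ≅
    (J.iteratedProd n).op ⋙ F :=
  J.rowPresheafIso F n ≪≫ Functor.isoWhiskerRight (NatIso.op (J.iteratedProdIso n)) _ ≪≫
    Functor.isoWhiskerLeft (J.iteratedProd n).op (presheafValueYonedaIso F)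

variable {F}

/-- Up to isomorphism `X × Iⁿ⁺¹ → X × I⁰` is the projection `(X × Iⁿ) × I → X × Iⁿ` followed by the
case of `n`, and `X × Iⁿ` is representable, so invariance applies to it. -/
lemma isSurjectiveOnComponents_pow (hF : J.IsInvariant (F ⋙ SSet.π₀Functor)) (X : C) (n : ℕ)
    (f : J.pow n ⟶ J.pow 0) : IsSurjectiveOnComponents F (yoneda.obj X ◁ f) := by
  induction n with
  | zero =>
    obtain rfl : f = 𝟙 _ := J.pow_zero_ext _ _
    exact isSurjectiveOnComponents_of_isIso F _
  | succ n IH =>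
    have := J.isRepresentable_pow X n
    let g : J.pow n ⟶ J.pow 0 :=
      { app _ := ↾fun _ k ↦ k.elim0
        naturality _ _ _ := by
          ext
          funext k
          exact k.elim0 }
    have h : yoneda.obj X ◁ f = (yoneda.obj X ◁ (J.powSuccIso n).hom ≫ (α_ _ _ _).inv) ≫
        fst (yoneda.obj X ⊗ J.pow n) J.I ≫ yoneda.obj X ◁ g := by
      ext1
      · simp
      · exact J.pow_zero_ext _ _
    rw [h]
    exact (isSurjectiveOnComponents_of_isIso F _).comp ((J.isSurjectiveOnComponents_fst hF _).comp
      (IH g))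

lemma degenerateComponents (hF : J.IsInvariant (F ⋙ SSet.π₀Functor)) (X : Cᵒᵖ) :
    DegenerateComponents ((J.bisimplicialPresheaf F).obj X) := by
  intro n
  let f := J.cosimplicial.map (SimplexCategory.const ⦋n⦌ ⦋0⦌ 0)
  have h := J.isSurjectiveOnComponents_pow hF X.unop n f
  exact surjective_mapπ₀_horiz ((J.singBisimplicial F).obj X) _ h

lemma isHomotopyCartesian_sing {P : CDStructure C} (hP : J.StableUnderProduct P)
    (h : ∀ Q : Square C, P.squares Q → SSet.IsHomotopyCartesian (Q.op.map F))
    (hF : J.IsInvariant (F ⋙ SSet.π₀Functor)) {Q : Square C} (hQ : P.squares Q) :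
    SSet.IsHomotopyCartesian (Q.op.map (J.sing F)) := by
  refine SSet.IsHomotopyCartesian.of_iso ?_ (Q.op.mapIsoOfNatIso (J.diagonalIso F))
  exact isHomotopyCartesian_diagonal (sq := Q.op.map (J.bisimplicialPresheaf F))
    (fun n ↦ (h _ (J.squares_iteratedProd hP hQ n)).of_iso
      (Q.op.mapIsoOfNatIso (J.rowIteratedProdIso F n)).symm)
    (J.degenerateComponents hF _) (J.degenerateComponents hF _)

/-- By full faithfulness the projection `∅ × Iⁿ → ∅` is a morphism of `C` to a strict initial
object. -/
lemma isIso_iteratedProd_initial [HasInitial C] [HasStrictInitialObjects C] (n : ℕ) :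
    Nonempty ((J.iteratedProd n).obj (⊥_ C) ≅ ⊥_ C) := by
  refine ⟨@asIso _ _ _ _ (yoneda.preimage ((J.iteratedProdIso n).hom.app (⊥_ C) ≫ fst _ _)) ?_⟩
  infer_instance

/-- Every row is isomorphic to `F(∅)`, so the map to the constant bisimplicial point is a rowwise
weak equivalence. -/
lemma isWeaklyContractible_sing [HasInitial C] [HasStrictInitialObjects C]
    (h : SSet.IsWeaklyContractible (F.obj (op (⊥_ C)))) :
    SSet.IsWeaklyContractible ((J.sing F).obj (op (⊥_ C))) := by
  have hp {Y : SSet.{u}} (hY : ∀ n, Subsingleton (Y.obj n) ∧ Nonempty (Y.obj n)) :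
      IsIso (toUnit Y) := by
    refine ⟨{ app n := ↾fun _ ↦ (hY n).2.some
              naturality _ _ _ := by
                ext
                exact (hY _).1.elim _ _ }, ?_, toUnit_unique _ _⟩
    ext n y
    exact (hY n).1.elim _ _
  refine SSet.IsWeaklyContractible.of_iso ((J.diagonalIso F).app _) ?_
  refine (SSet.isWeaklyContractible_iff
    (diagonal.map (toPoint ((J.bisimplicialPresheaf F).obj (op (⊥_ C))))) (hp fun n ↦ ?_)).2 ?_
  · exact ⟨inferInstanceAs (Subsingleton PUnit), inferInstanceAs (Nonempty PUnit)⟩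
  · refine isWeakEquivalence_diagonal _ fun n ↦ ?_
    refine (SSet.isWeaklyContractible_iff _ (hp fun n ↦ ?_)).1 ?_
    · exact ⟨inferInstanceAs (Subsingleton PUnit), inferInstanceAs (Nonempty PUnit)⟩
    · obtain ⟨e⟩ := J.isIso_iteratedProd_initial n
      let e' : F.obj (op ((J.iteratedProd n).obj (⊥_ C))) ≅
          (row (op ⦋n⦌)).obj ((J.bisimplicialPresheaf F).obj (op (⊥_ C))) :=
        ((J.rowIteratedProdIso F n).app (op (⊥_ C))).symm
      exact h.of_iso (F.mapIso e.op ≪≫ e')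

end RepresentableInterval

theorem theorem4p3 {C : Type u} [SmallCategory C] [HasInitial C] [HasStrictInitialObjects C]
    (J : RepresentableInterval C) (P : CDStructure C) (hP : J.StableUnderProduct P)
    (F : Cᵒᵖ ⥤ SSet.{u}) (hF : SatisfiesExcision P F)
    (hπ₀ : J.IsInvariant (F ⋙ SSet.π₀Functor)) :
    SatisfiesExcision P (J.sing F) := by
  exact ⟨J.isWeaklyContractible_sing hF.1, fun _ hQ ↦ J.isHomotopyCartesian_sing hP hF.2 hπ₀ hQ⟩
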